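/- **Setting.** Points of $\mathbb R\times\mathbb R^d$ are $x=(x_0,x')$, with parabolic distance $d(x,y)=\sqrt{|x_0-y_0|}+|x'-y'|$. Let $\mathcal G=\partial_{x_0}^2-\Delta_{x'}^2$, let $p_t(x,y)$ be the kernel of $e^{t\mathcal G}$, and for an integer $N\ge1$ let $Q^{(N)}_t=(-t\mathcal G)^Ne^{t\mathcal G}$ and $P^{(N)}_t=\int_t^\infty Q^{(N)}_s\frac{ds}{s}=(N-1)!\sum_{k<N}\frac{(-t\mathcal G)^k}{k!}e^{t\mathcal G}$. For $\alpha<4N$, the space $\mathcal C^\alpha$ consists of the tempered distributions $\Lambda$ with $\|\Lambda\|_{\mathcal C^\alpha}=\|P^{(N)}_1\Lambda\|_{L^\infty}+\sup_{0<t\le1}t^{-\alpha/4}\|Q^{(N)}_t\Lambda\|_{L^\infty}<\infty$. A *concrete regularity structure* $\mathscr T=(T^+,T)$ consists of: a connected graded real bialgebra $T^+=\bigoplus_{\alpha\in A^+}T^+_\alpha$ with coproduct $\Delta^+$ and counit $\mathbf 1_+'$, where $A^+\subset[0,\infty)$ is locally finite, contains $0$ and is closed under addition, and $T_0^+=\langle\mathbf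 1_+\rangle$; and a graded vector space $T=\bigoplus_{\beta\in A}T_\beta$, with $A\subset\mathbb R$ non-empty, locally finite and bounded below, with a linear map $\Delta:T\to T\otimes T^+$ such that $(\Delta\otimes\mathrm{Id})\Delta=(\mathrm{Id}\otimes\Delta^+)\Delta$, $(\mathrm{Id}\otimes\mathbf 1_+')\Delta=\mathrm{Id}$ and $\Delta T_\beta\subset\bigoplus_{\alpha\ge0}T_{\beta-\alpha}\otimes T^+_\alpha$. All $T^+_\alpha$ and $T_\beta$ are finite dimensional; $\mathcal B^+,\mathcal B$ are fixed homogeneous bases of $T^+,T$, $|\tau|$ is the homogeneity of a basis element, $\|\tau\|_\beta$ is a norm of the component of $\tau$ in $T_\beta$, $T_{<\gamma}=\bigoplus_{\beta<\gamma}T_\beta$ and $\beta_0=\min A$. Characters of $T^+$ form a group for $(g_1*g_2)=(g_1\otimes g_2)\Delta^+$; put $\widehat g=(\mathrm{Id}\otimes g)\Delta:T\to T$. A *model* $\mathsf M=(\mathsf\Pi,\mathsf g)$ consists of a map $\mathsf g$ from $\mathbb R\times\mathbb R^d$ to the characters of $T^+$ and a linear map $\mathsf\Pi:T\to\mathcal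 S'(\mathbb R\times\mathbb R^d)$ such that, with $\mathsf g_{yx}=\mathsf g_y*\mathsf g_x^{-1}$ and $\mathsf\Pi^{\mathsf g}_x=(\mathsf\Pi\otimes\mathsf g_x^{-1})\Delta$, for every $\gamma\in\mathbb R$ $$\sup_{\tau\in\mathcal B^+,|\tau|<\gamma}\ \sup_{x,y}\frac{|\mathsf g_{yx}(\tau)|}{d(y,x)^{|\tau|}}<\infty,\qquad \|\mathsf\Pi^{\mathsf g}\|_\gamma:=\sup_{\sigma\in\mathcal B,|\sigma|<\gamma}\ \sup_{x,\,0<t\le1}t^{-|\sigma|/4}\big|\langle\mathsf\Pi^{\mathsf g}_x\sigma,p_t(x,\cdot)\rangle\big|<\infty .$$ $\mathcal D^\gamma(T,\mathsf g)$ is the space of functions $f:\mathbb R\times\mathbb R^d\to T_{<\gamma}$ for which $$\max_{\beta<\gamma}\sup_x\|f(x)\|_\beta<\infty,\qquad \|f\|_{\mathcal D^\gamma}:=\max_{\beta<\gamma}\sup_{x,y}\frac{\|f(y)-\widehat{\mathsf g_{yx}}f(x)\|_\beta}{d(y,x)^{\gamma-\beta}}<\infty,$$ normed by the sum of these two quantities.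 **Theorem (Reconstruction).** Let $\mathscr T$ be a concrete regularity structure and $\gamma\in\mathbb R\setminus\{0\}$. There is a constant $C$, not depending on the model, such that for every model $\mathsf M=(\mathsf\Pi,\mathsf g)$ over $\mathscr T$ there is a continuous linear operator $$\mathbf R^{\mathsf M}:\mathcal D^\gamma(T,\mathsf g)\to\mathcal C^{\beta_0\wedge0}(\mathbb R\times\mathbb R^d)$$ with $$\big|\langle\mathbf R^{\mathsf M}f-\mathsf\Pi^{\mathsf g}_xf(x),p_t(x,\cdot)\rangle\big|\le C\,\|\mathsf\Pi^{\mathsf g}\|_\gamma\,\|f\|_{\mathcal D^\gamma}\,t^{\gamma/4}$$ for all $f\in\mathcal D^\gamma(T,\mathsf g)$, $x\in\mathbb R\times\mathbb R^d$ and $0<t\le1$. If $\gamma>0$, then for each model $\mathsf M$ there is only one continuous linear operator $\mathcal D^\gamma(T,\mathsf g)\to\mathcal C^{\beta_0\wedge0}$ that satisfies such a bound for some constant. -/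

import Mathlib

open scoped SchwartzMap TensorProduct ENNReal FourierTransform

noncomputable section

namespace RegStruct

/-! ### The parabolic space and the heat semigroup of `∂₀² - Δ'²` -/

/-- The space `ℝ × ℝᵈ`, with points `x = (x₀, x₁, …, x_d)`; the coordinate `x 0` is the time
variable and `x i.succ`, `i : Fin d`, are the space variables. -/
abbrev Spacetime (d : ℕ) : Type := EuclideanSpace ℝ (Fin (d + 1))

/-- The parabolic distance `√|x₀ - y₀| + |x' - y'|`. -/
def pdist {d : ℕ} (x y : Spacetime d) : ℝ :=
  Real.sqrt |x 0 - y 0| + Real.sqrt (∑ i : Fin d, (x i.succ - y i.succ) ^ 2)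

/-- Real tempered distributions on `ℝ × ℝᵈ`. -/
abbrev TempDist (d : ℕ) : Type := 𝓢(Spacetime d, ℝ) →L[ℝ] ℝ

/-- The Fourier symbol of `-𝒢`, where `𝒢 = ∂₀² - Δ'²`, for the Fourier transform with
character `exp (2 π i ⟨x, ξ⟩)`. -/
def symbolG {d : ℕ} (ξ : Spacetime d) : ℝ :=
  (2 * Real.pi * ξ 0) ^ 2 + (∑ i : Fin d, (2 * Real.pi * ξ i.succ) ^ 2) ^ 2

lemma coord_hasTemperateGrowth {d : ℕ} (i : Fin (d + 1)) :
    Function.HasTemperateGrowth (fun ξ : Spacetime d => ξ i) :=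
  (EuclideanSpace.proj (𝕜 := ℝ) i : Spacetime d →L[ℝ] ℝ).hasTemperateGrowth

lemma symbolG_hasTemperateGrowth (d : ℕ) :
    Function.HasTemperateGrowth (symbolG : Spacetime d → ℝ) := by
  have h (i : Fin (d + 1)) :
      Function.HasTemperateGrowth (fun ξ : Spacetime d => (2 * Real.pi * ξ i) ^ 2) :=
    ((Function.HasTemperateGrowth.const (2 * Real.pi)).mul (coord_hasTemperateGrowth i)).pow 2
  have hs : Function.HasTemperateGrowth
      (fun ξ : Spacetime d => ∑ i : Fin d, (2 * Real.pi * ξ i.succ) ^ 2) :=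
    Function.HasTemperateGrowth.sum (fun i _ => h i.succ)
  exact (h 0).add (hs.pow 2)

lemma norm_sq_le_symbolG {d : ℕ} (ξ : Spacetime d) : (1 + ‖ξ‖) ^ 2 ≤ 2 * (symbolG ξ + 2) := by
  have hn : ‖ξ‖ ^ 2 = ξ 0 ^ 2 + ∑ i : Fin d, ξ i.succ ^ 2 := by
    rw [EuclideanSpace.norm_sq_eq, Fin.sum_univ_succ]
    simp
  have hpi : (1 : ℝ) ≤ (2 * Real.pi) ^ 2 := by nlinarith [Real.pi_gt_three]
  have hr : 0 ≤ ∑ i : Fin d, ξ i.succ ^ 2 := Finset.sum_nonneg fun i _ => sq_nonneg _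
  have hs : ∑ i : Fin d, (2 * Real.pi * ξ i.succ) ^ 2
      = (2 * Real.pi) ^ 2 * ∑ i : Fin d, ξ i.succ ^ 2 := by
    rw [Finset.mul_sum]
    exact Finset.sum_congr rfl fun i _ => by ring
  have h1 : ∑ i : Fin d, ξ i.succ ^ 2 ≤ ∑ i : Fin d, (2 * Real.pi * ξ i.succ) ^ 2 := by
    rw [hs]
    exact le_mul_of_one_le_left hr hpi
  have h0 : ξ 0 ^ 2 ≤ (2 * Real.pi * ξ 0) ^ 2 := by
    rw [mul_pow]
    exact le_mul_of_one_le_left (sq_nonneg _) hpi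
  unfold symbolG
  nlinarith [sq_nonneg (∑ i : Fin d, (2 * Real.pi * ξ i.succ) ^ 2 - 1), sq_nonneg (1 - ‖ξ‖)]

lemma heatSymbol_decay {d : ℕ} {t : ℝ} (ht : 0 < t) (k n : ℕ) :
    ∃ C : ℝ, ∀ ξ : Spacetime d,
      ‖ξ‖ ^ k * ‖iteratedFDeriv ℝ n (fun η : Spacetime d => Real.exp (-t * symbolG η)) ξ‖ ≤ C := by
  have hf : Function.HasTemperateGrowth (fun η : Spacetime d => -t * symbolG η) :=
    (Function.HasTemperateGrowth.const (-t)).mul (symbolG_hasTemperateGrowth d)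
  obtain ⟨m, C, hC0, hC⟩ := hf.norm_iteratedFDeriv_le_uniform n
  let M := k + m * n
  refine ⟨n.factorial * (1 + C) ^ n * (2 ^ M * ((M.factorial : ℝ) / t ^ M * Real.exp (2 * t))),
    fun ξ => ?_⟩
  have hq : (0 : ℝ) ≤ symbolG ξ := by unfold symbolG; positivity
  have hone : (1 : ℝ) ≤ 1 + ‖ξ‖ := by linarith [norm_nonneg ξ]
  have hexp : ∀ i, i ≤ n →
      ‖iteratedFDeriv ℝ i Real.exp (-t * symbolG ξ)‖ ≤ Real.exp (-t * symbolG ξ) := by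
    intro i _
    rw [norm_iteratedFDeriv_eq_norm_iteratedDeriv, iteratedDeriv_eq_iterate, Real.iter_deriv_exp,
      Real.norm_of_nonneg (Real.exp_pos _).le]
  have hD : ∀ i, 1 ≤ i → i ≤ n →
      ‖iteratedFDeriv ℝ i (fun η : Spacetime d => -t * symbolG η) ξ‖
        ≤ ((1 + C) * (1 + ‖ξ‖) ^ m) ^ i := by
    intro i hi hin
    have hb : (1 : ℝ) ≤ (1 + C) * (1 + ‖ξ‖) ^ m :=
      one_le_mul_of_one_le_of_one_le (by linarith) (one_le_pow₀ hone)
    calc _ ≤ C * (1 + ‖ξ‖) ^ m := hC i hin ξ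
      _ ≤ (1 + C) * (1 + ‖ξ‖) ^ m := by gcongr; linarith
      _ ≤ _ := le_self_pow₀ hb (by omega)
  have hmain := norm_iteratedFDeriv_comp_le (𝕜 := ℝ) (g := Real.exp)
    (f := fun η : Spacetime d => -t * symbolG η) (n := n) (N := n)
    Real.contDiff_exp (hf.1.of_le (by exact_mod_cast le_top)) le_rfl ξ hexp hD
  have hpow : (1 + ‖ξ‖) ^ M ≤ 2 ^ M * (symbolG ξ + 2) ^ M := by
    rw [← mul_pow]
    calc (1 + ‖ξ‖) ^ M ≤ ((1 + ‖ξ‖) ^ 2) ^ M := by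
          gcongr
          exact le_self_pow₀ hone (by norm_num)
      _ ≤ _ := by gcongr; exact norm_sq_le_symbolG ξ
  have hexp2 : (symbolG ξ + 2) ^ M * Real.exp (-t * symbolG ξ)
      ≤ (M.factorial : ℝ) / t ^ M * Real.exp (2 * t) := by
    have h := Real.pow_div_factorial_le_exp (x := t * (symbolG ξ + 2)) (by positivity) M
    have hfac : (0 : ℝ) < M.factorial := by exact_mod_cast M.factorial_pos
    rw [div_le_iff₀ hfac, mul_pow] at h
    have h' : (symbolG ξ + 2) ^ M
        ≤ (M.factorial : ℝ) / t ^ M * Real.exp (t * (symbolG ξ + 2)) := by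
      rw [div_mul_eq_mul_div, le_div_iff₀ (by positivity)]
      linarith
    calc _ ≤ (M.factorial : ℝ) / t ^ M * Real.exp (t * (symbolG ξ + 2))
          * Real.exp (-t * symbolG ξ) := by gcongr
      _ = _ := by
          rw [mul_assoc, ← Real.exp_add]
          congr 2
          ring
  calc ‖ξ‖ ^ k * ‖iteratedFDeriv ℝ n (fun η : Spacetime d => Real.exp (-t * symbolG η)) ξ‖
      ≤ (1 + ‖ξ‖) ^ k * (n.factorial * Real.exp (-t * symbolG ξ)
          * ((1 + C) * (1 + ‖ξ‖) ^ m) ^ n) := by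
        gcongr
        · linarith
        · exact hmain
    _ = n.factorial * (1 + C) ^ n * ((1 + ‖ξ‖) ^ M * Real.exp (-t * symbolG ξ)) := by
        simp only [M]
        rw [mul_pow, ← pow_mul, pow_add]
        ring
    _ ≤ n.factorial * (1 + C) ^ n
          * (2 ^ M * (symbolG ξ + 2) ^ M * Real.exp (-t * symbolG ξ)) := by gcongr
    _ ≤ _ := by
        rw [mul_assoc (2 ^ M)]
        gcongr

/-- The Fourier symbol `exp (-t ((2πξ₀)² + |2πξ'|⁴))` of `exp (t𝒢)`, for `t > 0`. -/
def heatSymbol (d : ℕ) (t : ℝ) (ht : 0 < t) : 𝓢(Spacetime d, ℝ) where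
  toFun ξ := Real.exp (-t * symbolG ξ)
  smooth' := Real.contDiff_exp.comp
    (((Function.HasTemperateGrowth.const (-t)).mul (symbolG_hasTemperateGrowth d)).1)
  decay' k n := heatSymbol_decay ht k n

/-- The convolution kernel of `exp (t𝒢)`: the inverse Fourier transform of `heatSymbol`. It is an
even real function. (Only `t > 0` is meaningful; the value is `0` otherwise.) -/
def heatKernel (d : ℕ) (t : ℝ) : 𝓢(Spacetime d, ℝ) :=
  if ht : 0 < t then
    SchwartzMap.postcompCLM Complex.reCLM
      (𝓕⁻ (SchwartzMap.postcompCLM Complex.ofRealCLM (heatSymbol d t ht)) : 𝓢(Spacetime d, ℂ))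
  else 0

/-- The test function `y ↦ p_t(x, y) = p_t(y, x)`. -/
def heatAt {d : ℕ} (t : ℝ) (x : Spacetime d) : 𝓢(Spacetime d, ℝ) :=
  SchwartzMap.compSubConstCLM ℝ x (heatKernel d t)

/-- The partial derivative `∂_i` on Schwartz functions. -/
def partialD (d : ℕ) (i : Fin (d + 1)) : 𝓢(Spacetime d, ℝ) →L[ℝ] 𝓢(Spacetime d, ℝ) :=
  LineDeriv.lineDerivOpCLM ℝ 𝓢(Spacetime d, ℝ) (EuclideanSpace.single i (1 : ℝ))

/-- The Laplacian `Δ'` in the space variables. -/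
def spatialLaplacian (d : ℕ) : 𝓢(Spacetime d, ℝ) →L[ℝ] 𝓢(Spacetime d, ℝ) :=
  ∑ i : Fin d, partialD d i.succ ∘L partialD d i.succ

/-- The operator `𝒢 = ∂₀² - Δ'²`. -/
def opG (d : ℕ) : 𝓢(Spacetime d, ℝ) →L[ℝ] 𝓢(Spacetime d, ℝ) :=
  partialD d 0 ∘L partialD d 0 - spatialLaplacian d ∘L spatialLaplacian d

/-- The kernel `y ↦ q_t^{(N)}(x, y)` of `Q_t^{(N)} = (-t𝒢)^N exp (t𝒢)`. -/
def QAt {d : ℕ} (N : ℕ) (t : ℝ) (x : Spacetime d) : 𝓢(Spacetime d, ℝ) :=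
  (((-t) • opG d) ^ N) (heatAt t x)

/-- The kernel of `P_t^{(N)} = ∫_t^∞ Q_s^{(N)} ds / s`. Since
`∫_t^∞ (sλ)^N exp (-sλ) ds / s = (N-1)! (∑_{k < N} (tλ)^k / k!) exp (-tλ)` for `λ > 0`, this is
the polynomial `(N-1)! ∑_{k < N} u^k / k!` of `u = -t𝒢`, composed with `exp (t𝒢)`. -/
def PAt {d : ℕ} (N : ℕ) (t : ℝ) (x : Spacetime d) : 𝓢(Spacetime d, ℝ) :=
  ∑ k ∈ Finset.range N, (((N - 1).factorial : ℝ) / (k.factorial : ℝ)) • QAt k t x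

/-! ### Hölder spaces -/

/-- The `𝒞^α` norm of a tempered distribution, with values in `[0, ∞]`. The functions
`x ↦ ⟨Λ, q_t^{(N)}(x, ·)⟩` are continuous, so their `L^∞` norms are suprema. -/
def holderENorm {d : ℕ} (N : ℕ) (α : ℝ) (Λ : TempDist d) : ℝ≥0∞ :=
  (⨆ x : Spacetime d, ‖Λ (PAt N 1 x)‖ₑ) +
    ⨆ t ∈ Set.Ioc (0 : ℝ) 1,
      ENNReal.ofReal (t ^ (-α / 4)) * ⨆ x : Spacetime d, ‖Λ (QAt N t x)‖ₑ

lemma holderENorm_add_le {d : ℕ} (N : ℕ) (α : ℝ) (Λ Λ' : TempDist d) :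
    holderENorm N α (Λ + Λ') ≤ holderENorm N α Λ + holderENorm N α Λ' := by
  unfold holderENorm
  rw [add_add_add_comm]
  refine add_le_add (iSup_le fun x => ?_) (iSup₂_le fun t ht => ?_)
  · exact (enorm_add_le _ _).trans (add_le_add
      (le_iSup (fun x => ‖Λ (PAt N 1 x)‖ₑ) x) (le_iSup (fun x => ‖Λ' (PAt N 1 x)‖ₑ) x))
  · refine le_trans ?_ (add_le_add
      (le_iSup₂ (f := fun t (_ : t ∈ Set.Ioc (0 : ℝ) 1) =>
        ENNReal.ofReal (t ^ (-α / 4)) * ⨆ x : Spacetime d, ‖Λ (QAt N t x)‖ₑ) t ht)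
      (le_iSup₂ (f := fun t (_ : t ∈ Set.Ioc (0 : ℝ) 1) =>
        ENNReal.ofReal (t ^ (-α / 4)) * ⨆ x : Spacetime d, ‖Λ' (QAt N t x)‖ₑ) t ht))
    rw [← mul_add]
    refine mul_le_mul_right (iSup_le fun x => ?_) _
    exact (enorm_add_le _ _).trans (add_le_add
      (le_iSup (fun x => ‖Λ (QAt N t x)‖ₑ) x) (le_iSup (fun x => ‖Λ' (QAt N t x)‖ₑ) x))

lemma holderENorm_smul {d : ℕ} (N : ℕ) (α : ℝ) (c : ℝ) (Λ : TempDist d) :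
    holderENorm N α (c • Λ) = ‖c‖ₑ * holderENorm N α Λ := by
  unfold holderENorm
  simp only [smul_apply, enorm_smul, ← ENNReal.mul_iSup, mul_add]
  simp only [mul_left_comm _ ‖c‖ₑ, ← ENNReal.mul_iSup]

/-- The distributions with finite `𝒞^α` norm. -/
def holderSubmodule (d N : ℕ) (α : ℝ) : Submodule ℝ (TempDist d) where
  carrier := {Λ | holderENorm N α Λ < ⊤}
  add_mem' ha hb := (holderENorm_add_le N α _ _).trans_lt (ENNReal.add_lt_top.2 ⟨ha, hb⟩)
  zero_mem' := by
    have h := holderENorm_smul N α (0 : ℝ) (0 : TempDist d)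
    simp only [zero_smul, enorm_zero, zero_mul] at h
    simp [h]
  smul_mem' c Λ h := by
    change holderENorm N α Λ < ⊤ at h
    change holderENorm N α (c • Λ) < ⊤
    rw [holderENorm_smul]
    exact ENNReal.mul_lt_top enorm_lt_top h

/-- The Hölder space `𝒞^α(ℝ × ℝᵈ)`, `α < 4N`. -/
def HolderSpace (d N : ℕ) (α : ℝ) : Type := holderSubmodule d N α

namespace HolderSpace

instance (d N : ℕ) (α : ℝ) : AddCommGroup (HolderSpace d N α) :=
  inferInstanceAs (AddCommGroup (holderSubmodule d N α))

instance (d N : ℕ) (α : ℝ) : Module ℝ (HolderSpace d N α) :=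
  inferInstanceAs (Module ℝ (holderSubmodule d N α))

/-- The underlying distribution. -/
def toDist {d N : ℕ} {α : ℝ} (Λ : HolderSpace d N α) : TempDist d := Subtype.val Λ

instance (d N : ℕ) (α : ℝ) : Norm (HolderSpace d N α) where
  norm Λ := (holderENorm N α Λ.toDist).toReal

lemma normCore (d N : ℕ) (α : ℝ) : SeminormedSpace.Core ℝ (HolderSpace d N α) where
  norm_nonneg _ := ENNReal.toReal_nonneg
  norm_smul c Λ := by
    change (holderENorm N α (c • Λ.toDist)).toReal = ‖c‖ * (holderENorm N α Λ.toDist).toReal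
    rw [holderENorm_smul, ENNReal.toReal_mul, toReal_enorm]
  norm_triangle Λ Λ' := by
    change (holderENorm N α (Λ.toDist + Λ'.toDist)).toReal
      ≤ (holderENorm N α Λ.toDist).toReal + (holderENorm N α Λ'.toDist).toReal
    have h : holderENorm N α Λ.toDist < ⊤ := Subtype.property Λ
    have h' : holderENorm N α Λ'.toDist < ⊤ := Subtype.property Λ'
    rw [← ENNReal.toReal_add h.ne h'.ne]
    exact ENNReal.toReal_mono (ENNReal.add_lt_top.2 ⟨h, h'⟩).ne (holderENorm_add_le N α _ _)

instance (d N : ℕ) (α : ℝ) : SeminormedAddCommGroup (HolderSpace d N α) :=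
  SeminormedAddCommGroup.ofCore (normCore d N α)

instance (d N : ℕ) (α : ℝ) : NormedSpace ℝ (HolderSpace d N α) where
  norm_smul_le c Λ := ((normCore d N α).norm_smul c Λ).le

end HolderSpace

/-! ### Concrete regularity structures -/

/-- The homogeneous component of degree `α` of the vector space `V` that is graded by giving a
degree to each element of a basis. -/
def gradedPart {V I : Type*} [AddCommGroup V] [Module ℝ V] (b : Module.Basis I ℝ V) (deg : I → ℝ)
    (α : ℝ) : Submodule ℝ V :=
  Submodule.span ℝ (b '' {i | deg i = α})

/-- A concrete regularity structure `((T⁺, Δ⁺), (T, Δ))`, with homogeneous bases `𝓑⁺` of `T⁺`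
(indexed by `Bp`) and `𝓑` of `T` (indexed by `B`). The coproduct `Δ⁺` and the counit are those of
the bialgebra `Tp`. -/
structure ConcreteRegularityStructure (Tp T Bp B : Type*) [Ring Tp] [Bialgebra ℝ Tp]
    [AddCommGroup T] [Module ℝ T] where
  /-- the grading of `T⁺` -/
  Ap : Set ℝ
  Ap_nonneg : ∀ α ∈ Ap, 0 ≤ α
  Ap_locallyFinite : ∀ a b : ℝ, (Ap ∩ Set.Icc a b).Finite
  zero_mem_Ap : (0 : ℝ) ∈ Ap
  add_mem_Ap : ∀ α ∈ Ap, ∀ β ∈ Ap, α + β ∈ Ap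
  /-- the basis `𝓑⁺` -/
  basisp : Module.Basis Bp ℝ Tp
  /-- the homogeneity of the elements of `𝓑⁺` -/
  degp : Bp → ℝ
  degp_mem : ∀ i, degp i ∈ Ap
  /-- each `T⁺_α` is finite dimensional -/
  degp_finite : ∀ α : ℝ, {i | degp i = α}.Finite
  /-- connectedness, `T⁺_0 = ⟨𝟏₊⟩` -/
  connected : gradedPart basisp degp 0 = Submodule.span ℝ {(1 : Tp)}
  mul_graded : ∀ α β : ℝ, ∀ σ ∈ gradedPart basisp degp α, ∀ τ ∈ gradedPart basisp degp β,
    σ * τ ∈ gradedPart basisp degp (α + β)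
  comul_graded : ∀ α : ℝ, ∀ τ ∈ gradedPart basisp degp α,
    (Coalgebra.comul (R := ℝ) τ : Tp ⊗[ℝ] Tp) ∈ ⨆ (μ : ℝ) (ν : ℝ) (_ : μ + ν = α),
      LinearMap.range
        (TensorProduct.mapIncl (gradedPart basisp degp μ) (gradedPart basisp degp ν))
  /-- the index set of the grading of `T` -/
  A : Set ℝ
  A_nonempty : A.Nonempty
  A_bddBelow : BddBelow A
  A_locallyFinite : ∀ a b : ℝ, (A ∩ Set.Icc a b).Finite
  /-- the basis `𝓑` -/
  basis : Module.Basis B ℝ T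
  /-- the homogeneity of the elements of `𝓑` -/
  deg : B → ℝ
  deg_mem : ∀ i, deg i ∈ A
  /-- each `T_β` is finite dimensional -/
  deg_finite : ∀ β : ℝ, {i | deg i = β}.Finite
  /-- the splitting map `Δ : T → T ⊗ T⁺` -/
  split : T →ₗ[ℝ] T ⊗[ℝ] Tp
  /-- `(Δ ⊗ Id) Δ = (Id ⊗ Δ⁺) Δ` -/
  split_coassoc : (TensorProduct.assoc ℝ T Tp Tp).toLinearMap ∘ₗ split.rTensor Tp ∘ₗ split
    = (Coalgebra.comul (R := ℝ) (A := Tp)).lTensor T ∘ₗ split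
  /-- `(Id ⊗ 𝟏₊') Δ = Id` -/
  split_counit : (TensorProduct.rid ℝ T).toLinearMap ∘ₗ
    (Coalgebra.counit (R := ℝ) (A := Tp)).lTensor T ∘ₗ split = LinearMap.id
  split_graded : ∀ β : ℝ, ∀ τ ∈ gradedPart basis deg β,
    split τ ∈ ⨆ (α : ℝ) (_ : 0 ≤ α), LinearMap.range
      (TensorProduct.mapIncl (gradedPart basis deg (β - α)) (gradedPart basisp degp α))

section

variable {Tp T Bp B : Type*} [Ring Tp] [Bialgebra ℝ Tp] [AddCommGroup T] [Module ℝ T]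

namespace ConcreteRegularityStructure

variable (𝒯 : ConcreteRegularityStructure Tp T Bp B)

/-- `β₀ = min A`. -/
def minHom : ℝ := sInf 𝒯.A

/-- `T_{<γ}`. -/
def TLt (γ : ℝ) : Submodule ℝ T := ⨆ (β : ℝ) (_ : β < γ), gradedPart 𝒯.basis 𝒯.deg β

/-- `‖τ‖_β`, the maximum norm in the basis of the component of `τ` in `T_β`. -/
def compENorm (β : ℝ) (τ : T) : ℝ≥0∞ := ⨆ (i : B) (_ : 𝒯.deg i = β), ‖𝒯.basis.repr τ i‖ₑ

/-- The map `ĝ = (Id ⊗ g) Δ : T → T` of a linear functional `g` on `T⁺`. -/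
def hat (g : Tp →ₗ[ℝ] ℝ) : T →ₗ[ℝ] T :=
  (TensorProduct.rid ℝ T).toLinearMap ∘ₗ g.lTensor T ∘ₗ 𝒯.split

lemma compENorm_add_le (β : ℝ) (σ τ : T) :
    𝒯.compENorm β (σ + τ) ≤ 𝒯.compENorm β σ + 𝒯.compENorm β τ := by
  refine iSup₂_le fun i hi => ?_
  rw [map_add, Finsupp.add_apply]
  exact (enorm_add_le _ _).trans (add_le_add
    (le_iSup₂ (f := fun i (_ : 𝒯.deg i = β) => ‖𝒯.basis.repr σ i‖ₑ) i hi)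
    (le_iSup₂ (f := fun i (_ : 𝒯.deg i = β) => ‖𝒯.basis.repr τ i‖ₑ) i hi))

lemma compENorm_smul (β c : ℝ) (τ : T) :
    𝒯.compENorm β (c • τ) = ‖c‖ₑ * 𝒯.compENorm β τ := by
  unfold compENorm
  simp only [map_smul, Finsupp.smul_apply, enorm_smul, ← ENNReal.mul_iSup]

end ConcreteRegularityStructure

/-! ### Characters and models -/

/-- The inverse `g⁻¹` of a character of `T⁺` for the convolution `(g₁ * g₂) τ = (g₁ ⊗ g₂) Δ⁺ τ`,
taken in the convolution algebra of all linear functionals on `T⁺`. -/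
def charInv (g : Tp →ₐ[ℝ] ℝ) : Tp →ₗ[ℝ] ℝ :=
  (Ring.inverse (WithConv.toConv g.toLinearMap)).ofConv

/-- `g_{yx} = g_y * g_x⁻¹`. -/
def transition {d : ℕ} (g : Spacetime d → Tp →ₐ[ℝ] ℝ) (y x : Spacetime d) : Tp →ₗ[ℝ] ℝ :=
  (WithConv.toConv (g y).toLinearMap * WithConv.toConv (charInv (g x))).ofConv

namespace ConcreteRegularityStructure

variable (𝒯 : ConcreteRegularityStructure Tp T Bp B)

/-- `‖g‖_γ`. (On the diagonal the quotient is `0 / 0 = 0`, or has denominator `1` for elements of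
homogeneity `0`.) -/
def gENorm {d : ℕ} (g : Spacetime d → Tp →ₐ[ℝ] ℝ) (γ : ℝ) : ℝ≥0∞ :=
  ⨆ (i : Bp) (_ : 𝒯.degp i < γ) (x : Spacetime d) (y : Spacetime d),
    ‖transition g y x (𝒯.basisp i)‖ₑ / ENNReal.ofReal (pdist y x ^ 𝒯.degp i)

/-- `Π_x^g = (Π ⊗ g_x⁻¹) Δ`. -/
def PiAt {d : ℕ} (g : Spacetime d → Tp →ₐ[ℝ] ℝ) (P : T →ₗ[ℝ] TempDist d) (x : Spacetime d) :
    T →ₗ[ℝ] TempDist d :=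
  (TensorProduct.rid ℝ (TempDist d)).toLinearMap ∘ₗ
    TensorProduct.map P (charInv (g x)) ∘ₗ 𝒯.split

/-- `‖Π^g‖_γ`. -/
def PiENorm {d : ℕ} (g : Spacetime d → Tp →ₐ[ℝ] ℝ) (P : T →ₗ[ℝ] TempDist d) (γ : ℝ) : ℝ≥0∞ :=
  ⨆ (i : B) (_ : 𝒯.deg i < γ) (x : Spacetime d) (t : ℝ) (_ : t ∈ Set.Ioc (0 : ℝ) 1),
    ENNReal.ofReal (t ^ (-𝒯.deg i / 4)) * ‖𝒯.PiAt g P x (𝒯.basis i) (heatAt t x)‖ₑ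

end ConcreteRegularityStructure

/-- A model `(Π, g)` over a regularity structure. -/
structure Model (d : ℕ) (𝒯 : ConcreteRegularityStructure Tp T Bp B) where
  /-- the map `g : ℝ × ℝᵈ → G⁺` -/
  g : Spacetime d → Tp →ₐ[ℝ] ℝ
  /-- the map `Π : T → 𝒮'` -/
  P : T →ₗ[ℝ] TempDist d
  g_bound : ∀ γ : ℝ, 𝒯.gENorm g γ < ⊤
  P_bound : ∀ γ : ℝ, 𝒯.PiENorm g P γ < ⊤

/-! ### Modelled distributions -/

namespace ConcreteRegularityStructure

variable (𝒯 : ConcreteRegularityStructure Tp T Bp B)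

/-- `⟦f⟧_{𝒟^γ} = max_{β < γ} sup_x ‖f(x)‖_β`. -/
def supENorm {d : ℕ} (γ : ℝ) (f : Spacetime d → T) : ℝ≥0∞ :=
  ⨆ (β : ℝ) (_ : β < γ) (x : Spacetime d), 𝒯.compENorm β (f x)

/-- `‖f‖_{𝒟^γ}`, the supremum of `‖f(y) - ĝ_{yx} f(x)‖_β / d(y, x)^{γ - β}`. (On the diagonal the
quotient is `0 / 0 = 0`.) -/
def incrENorm {d : ℕ} (g : Spacetime d → Tp →ₐ[ℝ] ℝ) (γ : ℝ) (f : Spacetime d → T) : ℝ≥0∞ :=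
  ⨆ (β : ℝ) (_ : β < γ) (x : Spacetime d) (y : Spacetime d),
    𝒯.compENorm β (f y - 𝒯.hat (transition g y x) (f x)) / ENNReal.ofReal (pdist y x ^ (γ - β))

lemma supENorm_add_le {d : ℕ} (γ : ℝ) (f h : Spacetime d → T) :
    𝒯.supENorm γ (f + h) ≤ 𝒯.supENorm γ f + 𝒯.supENorm γ h := by
  refine iSup₂_le fun β hβ => iSup_le fun x => ?_
  refine (𝒯.compENorm_add_le β (f x) (h x)).trans (add_le_add ?_ ?_)
  · exact le_iSup₂_of_le (f := fun β (_ : β < γ) => ⨆ x, 𝒯.compENorm β (f x)) β hβ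
      (le_iSup (fun x => 𝒯.compENorm β (f x)) x)
  · exact le_iSup₂_of_le (f := fun β (_ : β < γ) => ⨆ x, 𝒯.compENorm β (h x)) β hβ
      (le_iSup (fun x => 𝒯.compENorm β (h x)) x)

lemma supENorm_smul {d : ℕ} (γ c : ℝ) (f : Spacetime d → T) :
    𝒯.supENorm γ (c • f) = ‖c‖ₑ * 𝒯.supENorm γ f := by
  unfold supENorm
  simp only [Pi.smul_apply, compENorm_smul, ← ENNReal.mul_iSup]

lemma incrENorm_add_le {d : ℕ} (g : Spacetime d → Tp →ₐ[ℝ] ℝ) (γ : ℝ) (f h : Spacetime d → T) :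
    𝒯.incrENorm g γ (f + h) ≤ 𝒯.incrENorm g γ f + 𝒯.incrENorm g γ h := by
  refine iSup₂_le fun β hβ => iSup₂_le fun x y => ?_
  have key (k : Spacetime d → T) :
      𝒯.compENorm β (k y - 𝒯.hat (transition g y x) (k x)) / ENNReal.ofReal (pdist y x ^ (γ - β))
        ≤ 𝒯.incrENorm g γ k :=
    le_iSup₂_of_le (f := fun β (_ : β < γ) => ⨆ (x) (y),
      𝒯.compENorm β (k y - 𝒯.hat (transition g y x) (k x))
        / ENNReal.ofReal (pdist y x ^ (γ - β))) β hβ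
      (le_iSup₂ (f := fun x y => 𝒯.compENorm β (k y - 𝒯.hat (transition g y x) (k x))
        / ENNReal.ofReal (pdist y x ^ (γ - β))) x y)
  refine le_trans ?_ (add_le_add (key f) (key h))
  rw [← ENNReal.add_div]
  refine ENNReal.div_le_div_right ?_ _
  have e : (f + h) y - 𝒯.hat (transition g y x) ((f + h) x)
      = (f y - 𝒯.hat (transition g y x) (f x)) + (h y - 𝒯.hat (transition g y x) (h x)) := by
    simp only [Pi.add_apply, map_add]
    abel
  rw [e]
  exact 𝒯.compENorm_add_le β _ _

lemma incrENorm_smul {d : ℕ} (g : Spacetime d → Tp →ₐ[ℝ] ℝ) (γ c : ℝ) (f : Spacetime d → T) :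
    𝒯.incrENorm g γ (c • f) = ‖c‖ₑ * 𝒯.incrENorm g γ f := by
  unfold incrENorm
  simp only [Pi.smul_apply, map_smul, ← smul_sub, compENorm_smul, mul_div_assoc,
    ← ENNReal.mul_iSup]

/-- The functions with values in `T_{<γ}` for which both `𝒟^γ` norms are finite. -/
def modelledSubmodule {d : ℕ} (g : Spacetime d → Tp →ₐ[ℝ] ℝ) (γ : ℝ) :
    Submodule ℝ (Spacetime d → T) where
  carrier := {f | (∀ x, f x ∈ 𝒯.TLt γ) ∧ 𝒯.supENorm γ f < ⊤ ∧ 𝒯.incrENorm g γ f < ⊤}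
  add_mem' ha hb :=
    ⟨fun x => add_mem (ha.1 x) (hb.1 x),
      (𝒯.supENorm_add_le γ _ _).trans_lt (ENNReal.add_lt_top.2 ⟨ha.2.1, hb.2.1⟩),
      (𝒯.incrENorm_add_le g γ _ _).trans_lt (ENNReal.add_lt_top.2 ⟨ha.2.2, hb.2.2⟩)⟩
  zero_mem' := by
    have h := 𝒯.supENorm_smul γ 0 (0 : Spacetime d → T)
    have h' := 𝒯.incrENorm_smul g γ 0 (0 : Spacetime d → T)
    simp only [zero_smul, enorm_zero, zero_mul] at h h'
    exact ⟨fun x => zero_mem _, by simp [h], by simp [h']⟩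
  smul_mem' c f hf :=
    ⟨fun x => Submodule.smul_mem _ c (hf.1 x),
      by rw [supENorm_smul]; exact ENNReal.mul_lt_top enorm_lt_top hf.2.1,
      by rw [incrENorm_smul]; exact ENNReal.mul_lt_top enorm_lt_top hf.2.2⟩

end ConcreteRegularityStructure

/-- The space `𝒟^γ(T, g)` of modelled distributions. -/
def ModelledDistribution {d : ℕ} (𝒯 : ConcreteRegularityStructure Tp T Bp B)
    (g : Spacetime d → Tp →ₐ[ℝ] ℝ) (γ : ℝ) : Type _ := 𝒯.modelledSubmodule g γ

namespace ModelledDistribution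

variable {d : ℕ} {𝒯 : ConcreteRegularityStructure Tp T Bp B} {g : Spacetime d → Tp →ₐ[ℝ] ℝ}
  {γ : ℝ}

instance : AddCommGroup (ModelledDistribution 𝒯 g γ) :=
  inferInstanceAs (AddCommGroup (𝒯.modelledSubmodule g γ))

instance : Module ℝ (ModelledDistribution 𝒯 g γ) :=
  inferInstanceAs (Module ℝ (𝒯.modelledSubmodule g γ))

/-- The underlying `T`-valued function. -/
def toFun (f : ModelledDistribution 𝒯 g γ) : Spacetime d → T := Subtype.val f

/-- The seminorm `‖f‖_{𝒟^γ}`. -/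
def incrNorm (f : ModelledDistribution 𝒯 g γ) : ℝ := (𝒯.incrENorm g γ f.toFun).toReal

/-- The norm `⟦f⟧_{𝒟^γ} + ‖f‖_{𝒟^γ}`, which gives `𝒟^γ(T, g)` its topology. -/
instance : Norm (ModelledDistribution 𝒯 g γ) where
  norm f := (𝒯.supENorm γ f.toFun).toReal + f.incrNorm

lemma normCore : SeminormedSpace.Core ℝ (ModelledDistribution 𝒯 g γ) where
  norm_nonneg _ := add_nonneg ENNReal.toReal_nonneg ENNReal.toReal_nonneg
  norm_smul c f := by
    change (𝒯.supENorm γ (c • f.toFun)).toReal + (𝒯.incrENorm g γ (c • f.toFun)).toReal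
      = ‖c‖ * ((𝒯.supENorm γ f.toFun).toReal + (𝒯.incrENorm g γ f.toFun).toReal)
    rw [𝒯.supENorm_smul, 𝒯.incrENorm_smul, ENNReal.toReal_mul, ENNReal.toReal_mul, toReal_enorm,
      mul_add]
  norm_triangle f h := by
    change (𝒯.supENorm γ (f.toFun + h.toFun)).toReal
        + (𝒯.incrENorm g γ (f.toFun + h.toFun)).toReal
      ≤ ((𝒯.supENorm γ f.toFun).toReal + (𝒯.incrENorm g γ f.toFun).toReal)
        + ((𝒯.supENorm γ h.toFun).toReal + (𝒯.incrENorm g γ h.toFun).toReal)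
    have hf : 𝒯.supENorm γ f.toFun < ⊤ ∧ 𝒯.incrENorm g γ f.toFun < ⊤ := (Subtype.property f).2
    have hh : 𝒯.supENorm γ h.toFun < ⊤ ∧ 𝒯.incrENorm g γ h.toFun < ⊤ := (Subtype.property h).2
    rw [add_add_add_comm, ← ENNReal.toReal_add hf.1.ne hh.1.ne,
      ← ENNReal.toReal_add hf.2.ne hh.2.ne]
    exact add_le_add
      (ENNReal.toReal_mono (ENNReal.add_lt_top.2 ⟨hf.1, hh.1⟩).ne (𝒯.supENorm_add_le γ _ _))
      (ENNReal.toReal_mono (ENNReal.add_lt_top.2 ⟨hf.2, hh.2⟩).ne (𝒯.incrENorm_add_le g γ _ _))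

instance : SeminormedAddCommGroup (ModelledDistribution 𝒯 g γ) :=
  SeminormedAddCommGroup.ofCore normCore

instance : NormedSpace ℝ (ModelledDistribution 𝒯 g γ) where
  norm_smul_le c f := (normCore.norm_smul c f).le

end ModelledDistribution

/-! ### Reconstruction -/

namespace Model

variable {d : ℕ} {𝒯 : ConcreteRegularityStructure Tp T Bp B}

/-- `Π_x^g` for the model `M = (Π, g)`. -/
def PiX (M : Model d 𝒯) (x : Spacetime d) : T →ₗ[ℝ] TempDist d := 𝒯.PiAt M.g M.P x

/-- `‖Π^g‖_γ`, as a (finite) real number. -/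
def PiNorm (M : Model d 𝒯) (γ : ℝ) : ℝ := (𝒯.PiENorm M.g M.P γ).toReal

/-- The bound `|⟨R f - Π_x^g f(x), p_t(x, ·)⟩| ≤ C ‖Π^g‖_γ ‖f‖_{𝒟^γ} t^{γ/4}` for all modelled
distributions `f`, all points `x` and all `0 < t ≤ 1`. -/
def ReconstructionBound (M : Model d 𝒯) {γ : ℝ} {N : ℕ} {α : ℝ}
    (R : ModelledDistribution 𝒯 M.g γ →L[ℝ] HolderSpace d N α) (C : ℝ) : Prop :=
  ∀ (f : ModelledDistribution 𝒯 M.g γ) (x : Spacetime d) (t : ℝ), 0 < t → t ≤ 1 →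
    |((R f).toDist - M.PiX x (f.toFun x)) (heatAt t x)|
      ≤ C * M.PiNorm γ * f.incrNorm * t ^ (γ / 4)

end Model

end

end RegStruct

end

open scoped SchwartzMap TensorProduct ENNReal FourierTransform

noncomputable section

namespace RegStruct

open MeasureTheory LineDeriv

/-! ### Convolution of real Schwartz functions and translation of tempered distributions -/

section Schwartz

variable {E : Type*} [NormedAddCommGroup E] [NormedSpace ℝ E]

/-! The regularity structure enters only through the germ Λ_x = Π_x^g f(x). Characters are
invertible for convolution and g ↦ ĝ is multiplicative, so Π_y ĝ_{yx} = Π_x (`PiAt_hat_transition`)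
and Λ_y - Λ_x = Π_y (f(y) - ĝ_{yx} f(x)). The bounds on the model and on f then give coherence
(`isGerm_germ`): |⟨Λ_y - Λ_x, p_s(y,·)⟩| ≤ A Σ_i s^(β_i/4) d(y,x)^(γ-β_i), where A = ‖Π^g‖_γ
‖f‖_{𝒟^γ} and the β_i < γ are the homogeneities of basis elements. Everything else concerns germs. A
single linear operator serves all coherent germs with given exponents, with a constant depending
only on d and these exponents (`exists_reconstruction`); hence C does not depend on the model.

Two properties of the heat semigroup carry the analysis. The first is scaling: the parabolic moment
of order a of 𝒢ʲ p_t is a constant times t^(a/4-j) (`integral_heatDeriv_pnorm`). With F_s(y) = ⟨Λ_y,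
p_s(y,·)⟩ it turns coherence into a bound on 𝒢ʲ p_r ⋆ (F_s - ⟨Λ_x, p_s⟩) at x, by A Σ_i c_i
s^(β_i/4) r^((γ-β_i)/4-j) (`IsGerm.abs_sconv_sub_le`). The second is Taylor's formula in time
(`IsCaloric.taylor`): if v_{t+s} = p_t ⋆ v_s, then v_t is Σ_{j≤n} (-1)^j/j! 𝒢ʲ p_t ⋆ v_1 minus ∫_0^1
(-s)^n/n! 𝒢^(n+1) p_t ⋆ v_s ds. The right side is a distribution tested against p_t. It makes sense
for any measurable family bounded by C s^(α/4), caloric or not, once n ≥ -α/4; this is `familyDist`.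

If γ > 0, successive functions p_{s-2⁻ⁿ} ⋆ F_{2⁻ⁿ} differ by O(2^(-nγ/4)), so they converge. The
limit is caloric, `familyDist` turns it into a distribution with these values on heat kernels, and
stopping at 2⁻ⁿ comparable to t gives the bound. If γ < 0 there need be no limit. Instead
`familyDist` is applied to G_s = p_{s/2} ⋆ F_{s/2} and compared with Taylor's formula for the fixed
distribution Λ_x. The error is at most a constant plus a multiple of ∫_0^1 (t+s/2)^(γ/4-1) ds, which
is O(t^(γ/4)) because γ < 0.

Membership in the Hölder space follows because Q_t averages the values on p_{t/2} against t^N 𝒢^N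
p_{t/2}, whose L¹ norm does not depend on t. Uniqueness for γ > 0 holds because the difference of
two reconstructions is O(t^(γ/4)) on heat kernels, hence zero (`eq_zero_of_heatAt_small`). -/

/-- The inclusion of real into complex Schwartz functions. -/
def complexify : 𝓢(E, ℝ) →L[ℝ] 𝓢(E, ℂ) := SchwartzMap.postcompCLM Complex.ofRealCLM

lemma complexify_apply (φ : 𝓢(E, ℝ)) (x : E) : complexify φ x = (φ x : ℂ) := rfl

lemma complexify_injective : Function.Injective (complexify (E := E)) := fun φ χ h => by
  ext x
  have hx : complexify φ x = complexify χ x := DFunLike.congr_fun h x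
  rwa [complexify_apply, complexify_apply, Complex.ofReal_inj] at hx

lemma lineDerivOp_postcompCLM {F G : Type*} [NormedAddCommGroup F] [NormedSpace ℝ F]
    [NormedAddCommGroup G] [NormedSpace ℝ G] (L : F →L[ℝ] G) (m : E) (f : 𝓢(E, F)) :
    ∂_{m} (SchwartzMap.postcompCLM L f) = SchwartzMap.postcompCLM L (∂_{m} f) := by
  ext x
  rw [SchwartzMap.postcompCLM_apply, SchwartzMap.lineDerivOp_apply_eq_fderiv,
    SchwartzMap.lineDerivOp_apply_eq_fderiv]
  have h : (SchwartzMap.postcompCLM L f : E → G) = L ∘ f := rfl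
  rw [h, fderiv_comp x L.differentiableAt f.differentiableAt, L.fderiv]
  rfl

lemma lineDerivOp_complexify (m : E) (φ : 𝓢(E, ℝ)) :
    ∂_{m} (complexify φ) = complexify (∂_{m} φ) :=
  lineDerivOp_postcompCLM _ m φ

/-- The translate `z ↦ φ (z - y)`. -/
abbrev translate (y : E) (φ : 𝓢(E, ℝ)) : 𝓢(E, ℝ) := SchwartzMap.compSubConstCLM ℝ y φ

lemma translate_apply (y : E) (φ : 𝓢(E, ℝ)) (z : E) : translate y φ z = φ (z - y) := rfl

lemma lineDerivOp_translate (m y : E) (φ : 𝓢(E, ℝ)) :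
    ∂_{m} (translate y φ) = translate y (∂_{m} φ) := by
  ext x
  rw [translate_apply, SchwartzMap.lineDerivOp_apply_eq_fderiv,
    SchwartzMap.lineDerivOp_apply_eq_fderiv]
  have h : (translate y φ : E → ℝ) = fun z => φ (z - y) := rfl
  rw [h, fderiv_comp_sub]

lemma iteratedFDeriv_translate (n : ℕ) (y z : E) (φ : 𝓢(E, ℝ)) :
    iteratedFDeriv ℝ n (translate y φ) z = iteratedFDeriv ℝ n φ (z - y) := by
  have h : (translate y φ : E → ℝ) = fun z => φ (z - y) := rfl
  rw [h, iteratedFDeriv_comp_sub]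

lemma exists_decay_bound (φ : 𝓢(E, ℝ)) (k n : ℕ) :
    ∃ C : ℝ, 0 ≤ C ∧ ∀ w, (1 + ‖w‖) ^ k * ‖iteratedFDeriv ℝ n φ w‖ ≤ C :=
  ⟨_, by positivity, fun w => SchwartzMap.one_add_le_sup_seminorm_apply (𝕜 := ℝ) (m := (k, n))
    le_rfl le_rfl φ w⟩

lemma seminorm_translate_le (φ : 𝓢(E, ℝ)) (k n : ℕ) :
    ∃ C : ℝ, 0 ≤ C ∧ ∀ y,
      SchwartzMap.seminorm ℝ k n (translate y φ) ≤ C * (1 + ‖y‖) ^ k := by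
  obtain ⟨C, hC0, hC⟩ := exists_decay_bound φ k n
  refine ⟨C, hC0, fun y => SchwartzMap.seminorm_le_bound ℝ k n _ (by positivity) fun z => ?_⟩
  rw [iteratedFDeriv_translate]
  have hz : ‖z‖ ≤ (1 + ‖z - y‖) * (1 + ‖y‖) := by
    have := norm_le_norm_sub_add z y
    nlinarith [norm_nonneg (z - y), norm_nonneg y]
  calc ‖z‖ ^ k * ‖iteratedFDeriv ℝ n φ (z - y)‖
      ≤ ((1 + ‖z - y‖) * (1 + ‖y‖)) ^ k * ‖iteratedFDeriv ℝ n φ (z - y)‖ := by gcongr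
    _ = ((1 + ‖z - y‖) ^ k * ‖iteratedFDeriv ℝ n φ (z - y)‖) * (1 + ‖y‖) ^ k := by
      rw [mul_pow]; ring
    _ ≤ _ := by gcongr; exact hC _

/-- Mean value inequality along the segment from z - y' to z - y, with the decay of the derivative
of order n + 1. Together with the growth bound above it makes y ↦ Λ(φ(· - y)) continuous of
polynomial growth, hence integrable against Schwartz functions. -/
lemma seminorm_translate_sub_le (φ : 𝓢(E, ℝ)) (k n : ℕ) :
    ∃ C : ℝ, 0 ≤ C ∧ ∀ y y',
      SchwartzMap.seminorm ℝ k n (translate y φ - translate y' φ)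
        ≤ C * (1 + ‖y‖ + ‖y'‖) ^ k * ‖y - y'‖ := by
  obtain ⟨C, hC0, hC⟩ := exists_decay_bound φ k (n + 1)
  refine ⟨C, hC0, fun y y' => SchwartzMap.seminorm_le_bound ℝ k n _ (by positivity) fun z => ?_⟩
  have hsub : iteratedFDeriv ℝ n (translate y φ - translate y' φ : 𝓢(E, ℝ)) z
      = iteratedFDeriv ℝ n φ (z - y) - iteratedFDeriv ℝ n φ (z - y') := by
    rw [← iteratedFDeriv_translate, ← iteratedFDeriv_translate]
    exact iteratedFDeriv_sub_apply ((translate y φ).smooth n).contDiffAt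
      ((translate y' φ).smooth n).contDiffAt
  have hd : Differentiable ℝ (iteratedFDeriv ℝ n φ) :=
    (φ.smooth ⊤).differentiable_iteratedFDeriv (mod_cast ENat.natCast_lt_top n)
  have hmv : ‖iteratedFDeriv ℝ n φ (z - y) - iteratedFDeriv ℝ n φ (z - y')‖
      ≤ C * ((1 + ‖y‖ + ‖y'‖) / (1 + ‖z‖)) ^ k * ‖(z - y) - (z - y')‖ := by
    refine (convex_segment (z - y') (z - y)).norm_image_sub_le_of_norm_fderiv_le (𝕜 := ℝ)
      (fun w _ => hd w) (fun w hw => ?_) (left_mem_segment ℝ _ _) (right_mem_segment ℝ _ _)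
    rw [norm_fderiv_iteratedFDeriv]
    have hzw : ‖z - w‖ ≤ ‖y‖ + ‖y'‖ := by
      obtain ⟨a, b, ha, hb, hab, rfl⟩ := hw
      have : z - (a • (z - y') + b • (z - y)) = a • y' + b • y := by
        have hz : z = a • z + b • z := by rw [← add_smul, hab, one_smul]
        nth_rewrite 1 [hz]
        simp only [smul_sub]
        abel
      rw [this]
      refine (norm_add_le _ _).trans ?_
      rw [norm_smul, norm_smul, Real.norm_of_nonneg ha, Real.norm_of_nonneg hb]
      nlinarith [norm_nonneg y, norm_nonneg y']
    -- Transfers the decay from the intermediate point w to z, uniformly on the segment.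
    have hz : 1 + ‖z‖ ≤ (1 + ‖w‖) * (1 + ‖y‖ + ‖y'‖) := by
      have := norm_le_norm_sub_add z w
      nlinarith [norm_nonneg w, norm_nonneg y, norm_nonneg y']
    have hw0 : (0 : ℝ) < (1 + ‖w‖) ^ k := by positivity
    have hz0 : (0 : ℝ) < (1 + ‖z‖) ^ k := by positivity
    have h1 : ‖iteratedFDeriv ℝ (n + 1) φ w‖ ≤ C / (1 + ‖w‖) ^ k := by
      rw [le_div_iff₀ hw0, mul_comm]
      exact hC w
    refine h1.trans ?_
    rw [div_pow, ← mul_div_assoc, div_le_div_iff₀ hw0 hz0, mul_assoc, ← mul_pow]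
    gcongr
    linarith
  rw [hsub]
  have hz0 : (0 : ℝ) < 1 + ‖z‖ := by positivity
  have hy : ‖(z - y) - (z - y')‖ = ‖y - y'‖ := by
    rw [sub_sub_sub_cancel_left, norm_sub_rev]
  rw [hy] at hmv
  calc ‖z‖ ^ k * ‖iteratedFDeriv ℝ n φ (z - y) - iteratedFDeriv ℝ n φ (z - y')‖
      ≤ (1 + ‖z‖) ^ k * (C * ((1 + ‖y‖ + ‖y'‖) / (1 + ‖z‖)) ^ k * ‖y - y'‖) := by
        gcongr
        linarith
    _ = C * ((1 + ‖z‖) * ((1 + ‖y‖ + ‖y'‖) / (1 + ‖z‖))) ^ k * ‖y - y'‖ := by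
        rw [mul_pow]; ring
    _ = _ := by rw [mul_div_cancel₀ _ hz0.ne']

/-- A tempered distribution is bounded by a finite sum of Schwartz seminorms. -/
lemma exists_sum_seminorm_bound (Λ : 𝓢(E, ℝ) →L[ℝ] ℝ) :
    ∃ (s : Finset (ℕ × ℕ)) (C : ℝ), 0 ≤ C ∧
      ∀ φ, |Λ φ| ≤ C * ∑ i ∈ s, SchwartzMap.seminorm ℝ i.1 i.2 φ := by
  obtain ⟨s, C, -, h⟩ := Seminorm.bound_of_continuous (schwartz_withSeminorms ℝ E ℝ)
    ((normSeminorm ℝ ℝ).comp Λ.toLinearMap) (by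
      change Continuous fun φ => ‖Λ φ‖
      fun_prop)
  refine ⟨s, C, C.2, fun φ => (h φ).trans ?_⟩
  have h2 : s.sup (schwartzSeminormFamily ℝ E ℝ) φ
      ≤ (∑ i ∈ s, schwartzSeminormFamily ℝ E ℝ i) φ :=
    Seminorm.finset_sup_le_sum _ s φ
  have h3 : (∑ i ∈ s, schwartzSeminormFamily ℝ E ℝ i) φ
      = ∑ i ∈ s, SchwartzMap.seminorm ℝ i.1 i.2 φ := by
    simp [schwartzSeminormFamily]
  rw [h3] at h2
  exact mul_le_mul_of_nonneg_left h2 C.2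

lemma exists_translate_bound (Λ : 𝓢(E, ℝ) →L[ℝ] ℝ) (φ : 𝓢(E, ℝ)) :
    ∃ (C : ℝ) (k : ℕ), 0 ≤ C ∧ ∀ y, |Λ (translate y φ)| ≤ C * (1 + ‖y‖) ^ k := by
  obtain ⟨s, C, hC0, hC⟩ := exists_sum_seminorm_bound Λ
  choose D hD0 hD using fun i : ℕ × ℕ => seminorm_translate_le φ i.1 i.2
  refine ⟨C * ∑ i ∈ s, D i, s.sup Prod.fst,
    mul_nonneg hC0 (Finset.sum_nonneg fun i _ => hD0 i), fun y => (hC _).trans ?_⟩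
  rw [mul_assoc, Finset.sum_mul]
  gcongr with i hi
  refine (hD i y).trans (mul_le_mul_of_nonneg_left ?_ (hD0 i))
  exact pow_le_pow_right₀ (by linarith [norm_nonneg y]) (Finset.le_sup (f := Prod.fst) hi)

lemma exists_translate_sub_bound (Λ : 𝓢(E, ℝ) →L[ℝ] ℝ) (φ : 𝓢(E, ℝ)) :
    ∃ (C : ℝ) (k : ℕ), 0 ≤ C ∧ ∀ y y', |Λ (translate y φ) - Λ (translate y' φ)|
      ≤ C * (1 + ‖y‖ + ‖y'‖) ^ k * ‖y - y'‖ := by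
  obtain ⟨s, C, hC0, hC⟩ := exists_sum_seminorm_bound Λ
  choose D hD0 hD using fun i : ℕ × ℕ => seminorm_translate_sub_le φ i.1 i.2
  refine ⟨C * ∑ i ∈ s, D i, s.sup Prod.fst,
    mul_nonneg hC0 (Finset.sum_nonneg fun i _ => hD0 i), fun y y' => ?_⟩
  rw [← map_sub]
  refine (hC _).trans ?_
  rw [mul_assoc, mul_assoc, Finset.sum_mul]
  gcongr with i hi
  refine (hD i y y').trans ?_
  rw [mul_assoc]
  refine mul_le_mul_of_nonneg_left (mul_le_mul_of_nonneg_right ?_ (norm_nonneg _)) (hD0 i)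
  exact pow_le_pow_right₀ (by linarith [norm_nonneg y, norm_nonneg y'])
    (Finset.le_sup (f := Prod.fst) hi)

lemma continuous_of_local_lipschitz_bound {E : Type*} [SeminormedAddCommGroup E] {X : Type*} [SeminormedAddCommGroup X] {h : E → X}
    {C : ℝ} {k : ℕ} (hh : ∀ y y', ‖h y - h y'‖ ≤ C * (1 + ‖y‖ + ‖y'‖) ^ k * ‖y - y'‖) :
    Continuous h := by
  rw [continuous_iff_continuousAt]
  intro y'
  rw [ContinuousAt, tendsto_iff_norm_sub_tendsto_zero]
  have hlim : Filter.Tendsto (fun y => C * (1 + ‖y‖ + ‖y'‖) ^ k * ‖y - y'‖) (nhds y') (nhds 0) := by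
    have : Continuous fun y => C * (1 + ‖y‖ + ‖y'‖) ^ k * ‖y - y'‖ := by fun_prop
    simpa using this.tendsto y'
  exact squeeze_zero (fun _ => norm_nonneg _) (fun y => hh y y') hlim

lemma continuous_apply_translate (Λ : 𝓢(E, ℝ) →L[ℝ] ℝ) (φ : 𝓢(E, ℝ)) :
    Continuous fun y => Λ (translate y φ) := by
  obtain ⟨C, k, -, h⟩ := exists_translate_sub_bound Λ φ
  exact continuous_of_local_lipschitz_bound h

/-! ### Embedding Schwartz functions into Banach spaces of weighted derivatives -/

/-- Bounded continuous functions with values in the `n`-multilinear forms. -/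
def BoundedForms (E : Type*) [NormedAddCommGroup E] [NormedSpace ℝ E] (n : ℕ) : Type _ :=
  BoundedContinuousFunction E (E [×n]→L[ℝ] ℝ)

instance (n : ℕ) : NormedAddCommGroup (BoundedForms E n) :=
  inferInstanceAs (NormedAddCommGroup (BoundedContinuousFunction E (E [×n]→L[ℝ] ℝ)))

instance (n : ℕ) : NormedSpace ℝ (BoundedForms E n) :=
  inferInstanceAs (NormedSpace ℝ (BoundedContinuousFunction E (E [×n]→L[ℝ] ℝ)))

instance (n : ℕ) : CompleteSpace (BoundedForms E n) :=
  inferInstanceAs (CompleteSpace (BoundedContinuousFunction E (E [×n]→L[ℝ] ℝ)))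

/-- Evaluation at a point and at `n` vectors. -/
def BoundedForms.eval {n : ℕ} (z : E) (m : Fin n → E) : BoundedForms E n →L[ℝ] ℝ :=
  ((ContinuousMultilinearMap.apply ℝ (fun _ : Fin n => E) ℝ m) ∘L
    (BoundedContinuousFunction.evalCLM ℝ z) :
      BoundedContinuousFunction E (E [×n]→L[ℝ] ℝ) →L[ℝ] ℝ)

lemma BoundedForms.ext_eval {n : ℕ} {f g : BoundedForms E n}
    (h : ∀ z m, BoundedForms.eval z m f = BoundedForms.eval z m g) : f = g :=
  BoundedContinuousFunction.ext fun z => ContinuousMultilinearMap.ext fun m => h z m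

/-- The weighted derivative `z ↦ ‖z‖ᵏ Dⁿφ(z)`, as a bounded continuous function. -/
def weightedDeriv (k n : ℕ) :
    𝓢(E, ℝ) →ₗ[ℝ] BoundedForms E n where
  toFun φ := BoundedContinuousFunction.ofNormedAddCommGroup
    (fun z => ‖z‖ ^ k • iteratedFDeriv ℝ n φ z)
    ((continuous_norm.pow k).smul ((φ.smooth n).continuous_iteratedFDeriv le_rfl))
    (SchwartzMap.seminorm ℝ k n φ) fun z => by
      rw [norm_smul, norm_pow, norm_norm]
      exact SchwartzMap.le_seminorm ℝ k n φ z
  map_add' φ χ := by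
    refine BoundedContinuousFunction.ext fun z => ?_
    change ‖z‖ ^ k • iteratedFDeriv ℝ n (φ + χ : 𝓢(E, ℝ)) z
      = ‖z‖ ^ k • iteratedFDeriv ℝ n φ z + ‖z‖ ^ k • iteratedFDeriv ℝ n χ z
    rw [← smul_add]
    congr 1
    exact iteratedFDeriv_add_apply (φ.smooth n).contDiffAt (χ.smooth n).contDiffAt
  map_smul' c φ := by
    refine BoundedContinuousFunction.ext fun z => ?_
    change ‖z‖ ^ k • iteratedFDeriv ℝ n (c • φ : 𝓢(E, ℝ)) z = c • ‖z‖ ^ k • iteratedFDeriv ℝ n φ z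
    rw [smul_comm c]
    congr 1
    exact iteratedFDeriv_const_smul_apply (φ.smooth n).contDiffAt

lemma eval_weightedDeriv (k n : ℕ) (φ : 𝓢(E, ℝ)) (z : E) (m : Fin n → E) :
    BoundedForms.eval z m (weightedDeriv k n φ) = ‖z‖ ^ k * iteratedFDeriv ℝ n φ z m := rfl

lemma norm_weightedDeriv (k n : ℕ) (φ : 𝓢(E, ℝ)) :
    ‖weightedDeriv k n φ‖ = SchwartzMap.seminorm ℝ k n φ := by
  let f : BoundedContinuousFunction E (E [×n]→L[ℝ] ℝ) := weightedDeriv k n φ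
  have hf (z : E) : ‖f z‖ = ‖z‖ ^ k * ‖iteratedFDeriv ℝ n φ z‖ := by
    change ‖‖z‖ ^ k • iteratedFDeriv ℝ n φ z‖ = _
    rw [norm_smul, norm_pow, norm_norm]
  change ‖f‖ = _
  apply le_antisymm
  · refine (BoundedContinuousFunction.norm_le (apply_nonneg _ _)).2 fun z => ?_
    rw [hf]
    exact SchwartzMap.le_seminorm ℝ k n φ z
  · refine SchwartzMap.seminorm_le_bound ℝ k n φ (norm_nonneg f) fun z => ?_
    rw [← hf]
    exact f.norm_coe_le_norm z

/-- The bound forces Λ to vanish on the kernel of J, so Λ descends to a bounded functional on the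
range of J, and Hahn–Banach extends it. Thus Λ factors through a normed space, where Bochner
integrals and continuity are easy to handle. -/
lemma exists_extension_of_bound {V W : Type*} [AddCommGroup V] [Module ℝ V]
    [NormedAddCommGroup W] [NormedSpace ℝ W] (J : V →ₗ[ℝ] W) (Λ : V →ₗ[ℝ] ℝ) (C : ℝ)
    (h : ∀ φ, |Λ φ| ≤ C * ‖J φ‖) : ∃ L : W →L[ℝ] ℝ, ∀ φ, L (J φ) = Λ φ := by
  obtain ⟨g, hg⟩ := LinearMap.exists_rightInverse_of_surjective J.rangeRestrict
    (LinearMap.range_eq_top.2 J.surjective_rangeRestrict)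
  have hJg (w : LinearMap.range J) : J (g w) = w := by
    have := LinearMap.congr_fun hg w
    exact congrArg Subtype.val this
  let f₀ : LinearMap.range J →L[ℝ] ℝ := (Λ ∘ₗ g).mkContinuous C fun w => by
    have := h (g w)
    rw [hJg] at this
    exact this
  obtain ⟨L, hL, -⟩ := exists_extension_norm_eq (LinearMap.range J) f₀
  refine ⟨L, fun φ => ?_⟩
  have h1 : L (J φ) = Λ (g (J.rangeRestrict φ)) := hL (J.rangeRestrict φ)
  -- The section g is arbitrary; the bound applied to an element of the kernel shows that the choice
  -- does not affect Λ.
  have h2 := h (g (J.rangeRestrict φ) - φ)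
  rw [map_sub J, hJg] at h2
  have h3 : ((J.rangeRestrict φ : LinearMap.range J) : W) - J φ = 0 := sub_self _
  rw [h3, norm_zero, mul_zero, map_sub] at h2
  rw [h1]
  exact sub_eq_zero.1 (abs_nonpos_iff.1 h2)

end Schwartz

/-! ### Convolution of Schwartz functions through the Fourier transform -/

section Convolution

variable {E : Type*} [NormedAddCommGroup E] [InnerProductSpace ℝ E] [FiniteDimensional ℝ E]
  [MeasurableSpace E] [BorelSpace E]

/-- The convolution of real Schwartz functions. -/
def conv (p φ : 𝓢(E, ℝ)) : 𝓢(E, ℝ) :=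
  SchwartzMap.postcompCLM Complex.reCLM
    (SchwartzMap.convolution (ContinuousLinearMap.mul ℂ ℂ) (complexify p) (complexify φ))

lemma convolution_complexify_apply (p φ : 𝓢(E, ℝ)) (x : E) :
    SchwartzMap.convolution (ContinuousLinearMap.mul ℂ ℂ) (complexify p) (complexify φ) x
      = ((∫ y, p y * φ (x - y) : ℝ) : ℂ) := by
  rw [SchwartzMap.convolution_apply, MeasureTheory.convolution_def, ← integral_complex_ofReal]
  refine integral_congr_ae (Filter.Eventually.of_forall fun y => ?_)
  simp [complexify_apply]

lemma conv_apply (p φ : 𝓢(E, ℝ)) (x : E) : conv p φ x = ∫ y, p y * φ (x - y) := by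
  rw [conv, SchwartzMap.postcompCLM_apply, convolution_complexify_apply]
  simp

lemma complexify_conv (p φ : 𝓢(E, ℝ)) : complexify (conv p φ)
    = SchwartzMap.convolution (ContinuousLinearMap.mul ℂ ℂ) (complexify p) (complexify φ) := by
  ext x
  rw [complexify_apply, conv_apply, convolution_complexify_apply]

lemma conv_comm (p φ : 𝓢(E, ℝ)) : conv p φ = conv φ p := by
  ext x
  rw [conv_apply, conv_apply, ← integral_sub_left_eq_self _ _ x]
  refine integral_congr_ae (Filter.Eventually.of_forall fun y => ?_)
  simp [mul_comm]

lemma fourier_complexify_conv (p φ : 𝓢(E, ℝ)) (ξ : E) :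
    𝓕 (complexify (conv p φ)) ξ = 𝓕 (complexify p) ξ * 𝓕 (complexify φ) ξ := by
  rw [complexify_conv, SchwartzMap.fourier_convolution, SchwartzMap.pairing_apply_apply]
  rfl

lemma fourier_complexify_lineDerivOp (m : E) (φ : 𝓢(E, ℝ)) (ξ : E) :
    𝓕 (complexify (∂_{m} φ)) ξ
      = (2 * Real.pi * Complex.I) * ((inner ℝ ξ m : ℝ) : ℂ) * 𝓕 (complexify φ) ξ := by
  have hm : (inner ℝ · m : E → ℝ).HasTemperateGrowth :=
    ((innerSL ℝ).flip m).hasTemperateGrowth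
  rw [← lineDerivOp_complexify, SchwartzMap.fourier_lineDerivOp_eq]
  simp [SchwartzMap.smulLeftCLM_apply_apply hm, mul_assoc]

/-- The device behind the identities for convolutions and for the heat semigroup: both sides are
real Schwartz functions, and equality is read off from their symbols. -/
lemma fourier_complexify_injective {φ χ : 𝓢(E, ℝ)}
    (h : ∀ ξ, 𝓕 (complexify φ) ξ = 𝓕 (complexify χ) ξ) : φ = χ := by
  apply complexify_injective
  have : 𝓕 (complexify φ) = 𝓕 (complexify χ) := by ext ξ; exact h ξ
  have h' := congrArg (fun f : 𝓢(E, ℂ) => (𝓕⁻ f : 𝓢(E, ℂ))) this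
  simpa only [FourierTransform.fourierInv_fourier_eq] using h'

lemma lineDerivOp_conv (m : E) (p φ : 𝓢(E, ℝ)) : ∂_{m} (conv p φ) = conv p (∂_{m} φ) := by
  apply fourier_complexify_injective
  intro ξ
  rw [fourier_complexify_lineDerivOp, fourier_complexify_conv, fourier_complexify_conv,
    fourier_complexify_lineDerivOp]
  ring

lemma iteratedLineDerivOp_conv {n : ℕ} (m : Fin n → E) (p φ : 𝓢(E, ℝ)) :
    ∂^{m} (conv p φ) = conv p (∂^{m} φ) := by
  induction n with
  | zero => simp
  | succ n ih => rw [iteratedLineDerivOp_succ_left, iteratedLineDerivOp_succ_left, ih,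
      lineDerivOp_conv]

lemma integrable_one_add_norm_pow_mul (φ : 𝓢(E, ℝ)) (k : ℕ) :
    Integrable fun y => (1 + ‖y‖) ^ k * |φ y| := by
  have h : ∀ j ∈ Finset.range (k + 1),
      Integrable fun y : E => ((k.choose j : ℝ)) * (‖y‖ ^ j * ‖φ y‖) := fun j _ =>
    (φ.integrable_pow_mul volume j).const_mul _
  refine (integrable_finsetSum _ h).congr (Filter.Eventually.of_forall fun y => ?_)
  simp only
  rw [add_comm (1 : ℝ), add_pow, Finset.sum_mul]
  refine Finset.sum_congr rfl fun j _ => ?_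
  simp only [one_pow, mul_one, Real.norm_eq_abs]
  ring

lemma integrable_mul_of_poly_bound (φ : 𝓢(E, ℝ)) {X : Type*} [NormedAddCommGroup X]
    [NormedSpace ℝ X] {h : E → X} (hh : AEStronglyMeasurable h) {C : ℝ} {k : ℕ}
    (hb : ∀ y, ‖h y‖ ≤ C * (1 + ‖y‖) ^ k) : Integrable fun y => φ y • h y := by
  refine ((integrable_one_add_norm_pow_mul φ k).const_mul C).mono'
    (φ.continuous.aestronglyMeasurable.smul hh) (Filter.Eventually.of_forall fun y => ?_)
  rw [norm_smul, Real.norm_eq_abs]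
  calc |φ y| * ‖h y‖ ≤ |φ y| * (C * (1 + ‖y‖) ^ k) := by gcongr; exact hb y
    _ = _ := by ring

/-- A tempered distribution commutes with the integral that defines a convolution. -/
theorem apply_conv (Λ : 𝓢(E, ℝ) →L[ℝ] ℝ) (p φ : 𝓢(E, ℝ)) :
    Λ (conv p φ) = ∫ y, p y * Λ (translate y φ) := by
  obtain ⟨s, C, hC0, hC⟩ := exists_sum_seminorm_bound Λ
  let J : 𝓢(E, ℝ) →ₗ[ℝ] ((i : s) → BoundedForms E i.1.2) := LinearMap.pi fun i => weightedDeriv i.1.1 i.1.2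
  have hJ (φ : 𝓢(E, ℝ)) (i : s) : J φ i = weightedDeriv i.1.1 i.1.2 φ := rfl
  have hΛJ (φ : 𝓢(E, ℝ)) : |Λ φ| ≤ C * s.card * ‖J φ‖ := by
    refine (hC φ).trans ?_
    rw [mul_assoc]
    refine mul_le_mul_of_nonneg_left ?_ hC0
    rw [← nsmul_eq_mul]
    refine Finset.sum_le_card_nsmul _ _ _ fun i hi => ?_
    rw [← norm_weightedDeriv]
    exact norm_le_pi_norm (J φ) ⟨i, hi⟩
  -- Only the finitely many seminorms that control Λ are kept. Their product is a Banach space, so y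
  -- ↦ J(φ(· - y)) has a Bochner integral against p, and L commutes with it.
  obtain ⟨L, hL⟩ := exists_extension_of_bound (V := 𝓢(E, ℝ))
    (W := ((i : s) → BoundedForms E i.1.2)) J Λ.toLinearMap (C * s.card) hΛJ
  replace hL (φ : 𝓢(E, ℝ)) : L (J φ) = Λ φ := hL φ
  choose D hD0 hD using fun i : ℕ × ℕ => seminorm_translate_sub_le φ i.1 i.2
  choose D' hD'0 hD' using fun i : ℕ × ℕ => seminorm_translate_le φ i.1 i.2
  have hcont : Continuous fun y => J (translate y φ) := by
    refine continuous_pi fun i => continuous_of_local_lipschitz_bound (C := D i.1) (k := i.1.1)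
      fun y y' => ?_
    rw [hJ, hJ, ← map_sub, norm_weightedDeriv]
    exact hD i.1 y y'
  have hbound (y : E) : ‖J (translate y φ)‖
      ≤ (∑ i ∈ s, D' i) * (1 + ‖y‖) ^ (s.sup Prod.fst) := by
    have hy : (1 : ℝ) ≤ 1 + ‖y‖ := by linarith [norm_nonneg y]
    refine (pi_norm_le_iff_of_nonneg
      (mul_nonneg (Finset.sum_nonneg fun i _ => hD'0 i) (by positivity))).2 fun i => ?_
    rw [hJ, norm_weightedDeriv]
    refine (hD' i.1 y).trans (mul_le_mul ?_ ?_ (by positivity)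
      (Finset.sum_nonneg fun i _ => hD'0 i))
    · exact Finset.single_le_sum (f := D') (fun i _ => hD'0 i) i.2
    · exact pow_le_pow_right₀ hy (Finset.le_sup (f := Prod.fst) i.2)
  have hint : Integrable fun y => p y • J (translate y φ) :=
    integrable_mul_of_poly_bound p hcont.aestronglyMeasurable hbound
  have hJconv : J (conv p φ) = ∫ y, p y • J (translate y φ) := by
    funext i
    refine BoundedForms.ext_eval fun z m => ?_
    -- Evaluations at a point and at vectors are continuous and separate elements, so the
    -- vector-valued identity reduces to the pointwise formula for a derivative of a convolution.
    let ev : ((i : s) → BoundedForms E i.1.2) →L[ℝ] ℝ :=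
      BoundedForms.eval z m ∘L ContinuousLinearMap.proj i
    change ev (J (conv p φ)) = ev (∫ y, p y • J (translate y φ))
    rw [← ev.integral_comp_comm hint]
    have hev (χ : 𝓢(E, ℝ)) : ev (J χ) = ‖z‖ ^ i.1.1 * ∂^{m} χ z := by
      rw [SchwartzMap.iteratedLineDerivOp_eq_iteratedFDeriv]
      exact eval_weightedDeriv _ _ _ _ _
    simp only [map_smul, hev, smul_eq_mul]
    rw [iteratedLineDerivOp_conv, conv_apply, ← integral_const_mul]
    refine integral_congr_ae (Filter.Eventually.of_forall fun y => ?_)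
    simp only [SchwartzMap.iteratedLineDerivOp_eq_iteratedFDeriv, iteratedFDeriv_translate]
    ring
  rw [← hL, hJconv, ← L.integral_comp_comm hint]
  simp only [map_smul, hL, smul_eq_mul]

end Convolution

/-! ### The derivatives of the heat kernel -/

variable {d : ℕ}

lemma symbolG_nonneg (ξ : Spacetime d) : 0 ≤ symbolG ξ := by unfold symbolG; positivity

lemma symbolG_neg (ξ : Spacetime d) : symbolG (-ξ) = symbolG ξ := by simp [symbolG]

lemma continuous_symbolG : Continuous (symbolG : Spacetime d → ℝ) :=
  (symbolG_hasTemperateGrowth d).1.continuous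

lemma partialD_apply (i : Fin (d + 1)) (φ : 𝓢(Spacetime d, ℝ)) :
    partialD d i φ = ∂_{EuclideanSpace.single i (1 : ℝ)} φ := rfl

lemma fourier_partialD (i : Fin (d + 1)) (φ : 𝓢(Spacetime d, ℝ)) (ξ : Spacetime d) :
    𝓕 (complexify (partialD d i φ)) ξ
      = (2 * Real.pi * Complex.I) * (ξ i : ℂ) * 𝓕 (complexify φ) ξ := by
  rw [partialD_apply, fourier_complexify_lineDerivOp]
  simp [EuclideanSpace.inner_single_right]

lemma fourier_complexify_add (φ χ : 𝓢(Spacetime d, ℝ)) (ξ : Spacetime d) :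
    𝓕 (complexify (φ + χ)) ξ = 𝓕 (complexify φ) ξ + 𝓕 (complexify χ) ξ := by
  rw [map_add, FourierTransform.fourier_add]
  rfl

lemma fourier_complexify_sub (φ χ : 𝓢(Spacetime d, ℝ)) (ξ : Spacetime d) :
    𝓕 (complexify (φ - χ)) ξ = 𝓕 (complexify φ) ξ - 𝓕 (complexify χ) ξ := by
  have h := fourier_complexify_add (φ - χ) χ ξ
  rw [sub_add_cancel] at h
  rw [h, add_sub_cancel_right]

lemma fourier_complexify_sum {ι : Type*} (s : Finset ι) (φ : ι → 𝓢(Spacetime d, ℝ))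
    (ξ : Spacetime d) :
    𝓕 (complexify (∑ i ∈ s, φ i)) ξ = ∑ i ∈ s, 𝓕 (complexify (φ i)) ξ := by
  classical
  induction s using Finset.induction_on with
  | empty =>
    simp
  | insert i s hi ih => rw [Finset.sum_insert hi, fourier_complexify_add, ih, Finset.sum_insert hi]

lemma fourier_spatialLaplacian (φ : 𝓢(Spacetime d, ℝ)) (ξ : Spacetime d) :
    𝓕 (complexify (spatialLaplacian d φ)) ξ
      = -((∑ i : Fin d, (2 * Real.pi * ξ i.succ) ^ 2 : ℝ) : ℂ) * 𝓕 (complexify φ) ξ := by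
  have h : spatialLaplacian d φ = ∑ i : Fin d, partialD d i.succ (partialD d i.succ φ) := by
    simp [spatialLaplacian]
  rw [h, fourier_complexify_sum]
  push_cast
  rw [← Finset.sum_neg_distrib, Finset.sum_mul]
  refine Finset.sum_congr rfl fun i _ => ?_
  rw [fourier_partialD, fourier_partialD]
  ring_nf
  rw [Complex.I_sq]
  ring

lemma fourier_opG (φ : 𝓢(Spacetime d, ℝ)) (ξ : Spacetime d) :
    𝓕 (complexify (opG d φ)) ξ = ((-symbolG ξ : ℝ) : ℂ) * 𝓕 (complexify φ) ξ := by
  have h : opG d φ = partialD d 0 (partialD d 0 φ)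
      - spatialLaplacian d (spatialLaplacian d φ) := rfl
  rw [h, fourier_complexify_sub, fourier_partialD, fourier_partialD, fourier_spatialLaplacian,
    fourier_spatialLaplacian, symbolG]
  push_cast
  ring_nf
  rw [Complex.I_sq]
  ring

lemma fourier_opG_pow (j : ℕ) (φ : 𝓢(Spacetime d, ℝ)) (ξ : Spacetime d) :
    𝓕 (complexify ((opG d ^ j) φ)) ξ = (((-symbolG ξ) ^ j : ℝ) : ℂ) * 𝓕 (complexify φ) ξ := by
  induction j with
  | zero => simp
  | succ j ih =>
    have h : (opG d ^ (j + 1)) φ = opG d ((opG d ^ j) φ) := by rw [pow_succ']; rfl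
    rw [h, fourier_opG, ih]
    push_cast
    ring

/-- `𝒢ʲ pₜ`. -/
def heatDeriv (d j : ℕ) (t : ℝ) : 𝓢(Spacetime d, ℝ) := (opG d ^ j) (heatKernel d t)

lemma heatKernel_of_nonpos {t : ℝ} (ht : t ≤ 0) : heatKernel d t = 0 := by
  rw [heatKernel, dif_neg ht.not_gt]

lemma heatDeriv_of_nonpos {t : ℝ} (ht : t ≤ 0) (j : ℕ) : heatDeriv d j t = 0 := by
  rw [heatDeriv, heatKernel_of_nonpos ht, map_zero]

/-- Conjugation amounts to ξ ↦ -ξ in the integral. For the heat symbol this shows that no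
information is lost by the real part in the definition of the kernel. -/
lemma fourierInv_even_real {f : Spacetime d → ℝ} (hf : ∀ ξ, f (-ξ) = f ξ) (x : Spacetime d) :
    (starRingEnd ℂ) (𝓕⁻ (fun ξ => (f ξ : ℂ)) x) = 𝓕⁻ (fun ξ => (f ξ : ℂ)) x := by
  rw [Real.fourierInv_eq', ← integral_conj, ← integral_neg_eq_self]
  refine integral_congr_ae (Filter.Eventually.of_forall fun ξ => ?_)
  simp only [smul_eq_mul, map_mul, Complex.conj_ofReal, hf, ← Complex.exp_conj, Complex.conj_I]
  congr 2
  simp [inner_neg_left]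

lemma fourier_heatKernel {t : ℝ} (ht : 0 < t) (ξ : Spacetime d) :
    𝓕 (complexify (heatKernel d t)) ξ = (Real.exp (-t * symbolG ξ) : ℂ) := by
  have h : complexify (heatKernel d t) = (𝓕⁻ (complexify (heatSymbol d t ht)) : 𝓢(Spacetime d, ℂ)) := by
    ext x
    have hx : (starRingEnd ℂ) ((𝓕⁻ (complexify (heatSymbol d t ht)) : 𝓢(Spacetime d, ℂ)) x)
        = (𝓕⁻ (complexify (heatSymbol d t ht)) : 𝓢(Spacetime d, ℂ)) x := by
      rw [SchwartzMap.fourierInv_coe]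
      refine fourierInv_even_real (f := heatSymbol d t ht) (fun ξ => ?_) x
      change Real.exp (-t * symbolG (-ξ)) = Real.exp (-t * symbolG ξ)
      rw [symbolG_neg]
    rw [complexify_apply, heatKernel, dif_pos ht]
    exact Complex.conj_eq_iff_re.1 hx
  rw [h, FourierTransform.fourier_fourierInv_eq]
  rfl

lemma fourier_heatDeriv (j : ℕ) {t : ℝ} (ht : 0 < t) (ξ : Spacetime d) :
    𝓕 (complexify (heatDeriv d j t)) ξ
      = (((-symbolG ξ) ^ j * Real.exp (-t * symbolG ξ) : ℝ) : ℂ) := by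
  rw [heatDeriv, fourier_opG_pow, fourier_heatKernel ht]
  push_cast
  rfl

/-- Semigroup property. -/
lemma conv_heatDeriv (i j : ℕ) {s t : ℝ} (hs : 0 < s) (ht : 0 < t) :
    conv (heatDeriv d i s) (heatDeriv d j t) = heatDeriv d (i + j) (s + t) := by
  apply fourier_complexify_injective
  intro ξ
  rw [fourier_complexify_conv, fourier_heatDeriv _ hs, fourier_heatDeriv _ ht,
    fourier_heatDeriv _ (add_pos hs ht), ← Complex.ofReal_mul]
  congr 1
  have : -(s + t) * symbolG ξ = -s * symbolG ξ + -t * symbolG ξ := by ring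
  rw [this, Real.exp_add, pow_add]
  ring

/-! ### Cosine integrals: evenness, measurability and the heat equation -/

/-- The value of `𝒢ʲ pₜ` as a Fourier integral. -/
def heatFun (d j : ℕ) (t : ℝ) (y : Spacetime d) : ℝ :=
  ∫ ξ : Spacetime d,
    Real.cos (2 * Real.pi * inner ℝ ξ y) * ((-symbolG ξ) ^ j * Real.exp (-t * symbolG ξ))

lemma integrable_symbol (j : ℕ) {t : ℝ} (ht : 0 < t) :
    Integrable fun ξ : Spacetime d => symbolG ξ ^ j * Real.exp (-t * symbolG ξ) := by
  have h := ((𝓕 (complexify (heatDeriv d j t)) : 𝓢(Spacetime d, ℂ)).integrable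
    (μ := volume)).norm
  refine h.congr (Filter.Eventually.of_forall fun ξ => ?_)
  simp only
  rw [fourier_heatDeriv j ht, Complex.norm_real, Real.norm_eq_abs, abs_mul, abs_pow, abs_neg,
    abs_of_nonneg (symbolG_nonneg ξ), abs_of_nonneg (Real.exp_pos _).le]

lemma integrable_symbol_complex (j : ℕ) {t : ℝ} (ht : 0 < t) (y : Spacetime d) :
    Integrable fun ξ : Spacetime d =>
      Complex.exp (((2 * Real.pi * inner ℝ ξ y : ℝ) : ℂ) * Complex.I)
        • (((-symbolG ξ) ^ j * Real.exp (-t * symbolG ξ) : ℝ) : ℂ) := by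
  have hc := continuous_symbolG (d := d)
  refine (integrable_symbol j ht).mono' ?_ (Filter.Eventually.of_forall fun ξ => ?_)
  · apply Continuous.aestronglyMeasurable
    fun_prop
  · rw [norm_smul, Complex.norm_exp_ofReal_mul_I, one_mul, Complex.norm_real, Real.norm_eq_abs,
      abs_mul, abs_pow, abs_neg, abs_of_nonneg (symbolG_nonneg ξ),
      abs_of_nonneg (Real.exp_pos _).le]

lemma heatDeriv_apply (j : ℕ) {t : ℝ} (ht : 0 < t) (y : Spacetime d) :
    heatDeriv d j t y = heatFun d j t y := by
  have h1 : complexify (heatDeriv d j t) y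
      = 𝓕⁻ (fun ξ => (((-symbolG ξ) ^ j * Real.exp (-t * symbolG ξ) : ℝ) : ℂ)) y := by
    have h2 : complexify (heatDeriv d j t)
        = (𝓕⁻ (𝓕 (complexify (heatDeriv d j t)) : 𝓢(Spacetime d, ℂ)) : 𝓢(Spacetime d, ℂ)) :=
      (FourierTransform.fourierInv_fourier_eq _).symm
    have h4 : ((𝓕 (complexify (heatDeriv d j t)) : 𝓢(Spacetime d, ℂ)) : Spacetime d → ℂ)
        = fun ξ => (((-symbolG ξ) ^ j * Real.exp (-t * symbolG ξ) : ℝ) : ℂ) :=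
      funext (fourier_heatDeriv j ht)
    rw [h2, SchwartzMap.fourierInv_coe, h4]
  have h3 := congrArg Complex.re h1
  rw [complexify_apply, Complex.ofReal_re, Real.fourierInv_eq'] at h3
  rw [h3, heatFun]
  have hint := integrable_symbol_complex j ht y
  have := (Complex.reCLM.integral_comp_comm hint).symm
  simp only [Complex.reCLM_apply] at this
  rw [this]
  refine integral_congr_ae (Filter.Eventually.of_forall fun ξ => ?_)
  simp only [smul_eq_mul, Complex.re_mul_ofReal, Complex.exp_ofReal_mul_I_re]

lemma heatFun_neg (j : ℕ) (t : ℝ) (y : Spacetime d) : heatFun d j t (-y) = heatFun d j t y := by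
  simp [heatFun, inner_neg_right]

lemma heatDeriv_neg (j : ℕ) (t : ℝ) (y : Spacetime d) :
    heatDeriv d j t (-y) = heatDeriv d j t y := by
  rcases le_or_gt t 0 with ht | ht
  · simp [heatDeriv_of_nonpos ht]
  · rw [heatDeriv_apply j ht, heatDeriv_apply j ht, heatFun_neg]

lemma measurable_heatDeriv (j : ℕ) :
    Measurable fun p : ℝ × Spacetime d => heatDeriv d j p.1 p.2 := by
  have h1 : Measurable fun p : ℝ × Spacetime d => heatFun d j p.1 p.2 := by
    have hc := continuous_symbolG (d := d)
    have hm : StronglyMeasurable fun q : (ℝ × Spacetime d) × Spacetime d =>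
        Real.cos (2 * Real.pi * inner ℝ q.2 q.1.2)
          * ((-symbolG q.2) ^ j * Real.exp (-q.1.1 * symbolG q.2)) := by
      apply Continuous.stronglyMeasurable
      fun_prop
    exact (hm.integral_prod_right' (ν := volume)).measurable
  -- The kernel is set to zero for nonpositive times, where the cosine integral need not agree with
  -- it.
  have h2 : (fun p : ℝ × Spacetime d => heatDeriv d j p.1 p.2)
      = {p : ℝ × Spacetime d | 0 < p.1}.indicator fun p => heatFun d j p.1 p.2 := by
    funext p
    by_cases hp : 0 < p.1
    · rw [Set.indicator_of_mem (by exact hp), heatDeriv_apply j hp]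
    · rw [Set.indicator_of_notMem (by exact hp), heatDeriv_of_nonpos (not_lt.1 hp)]
      rfl
  rw [h2]
  exact h1.indicator (measurableSet_lt measurable_const measurable_fst)

/-- The heat equation. -/
lemma hasDerivAt_heatDeriv (j : ℕ) {t : ℝ} (ht : 0 < t) (y : Spacetime d) :
    HasDerivAt (fun s => heatDeriv d j s y) (heatDeriv d (j + 1) t y) t := by
  have hc := continuous_symbolG (d := d)
  have hev : (fun s => heatDeriv d j s y) =ᶠ[nhds t] fun s => heatFun d j s y := by
    filter_upwards [lt_mem_nhds ht] with s hs
    exact heatDeriv_apply j hs y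
  rw [heatDeriv_apply _ ht]
  refine HasDerivAt.congr_of_eventuallyEq ?_ hev
  have hcos (ξ : Spacetime d) : |Real.cos (2 * Real.pi * inner ℝ ξ y)| ≤ 1 := Real.abs_cos_le_one _
  have hbd (i : ℕ) (s : ℝ) (ξ : Spacetime d) : ‖Real.cos (2 * Real.pi * inner ℝ ξ y)
      * ((-symbolG ξ) ^ i * Real.exp (-s * symbolG ξ))‖
        ≤ symbolG ξ ^ i * Real.exp (-s * symbolG ξ) := by
    rw [Real.norm_eq_abs, abs_mul, abs_mul, abs_pow, abs_neg, abs_of_nonneg (symbolG_nonneg ξ),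
      abs_of_nonneg (Real.exp_pos _).le]
    exact mul_le_of_le_one_left
      (mul_nonneg (pow_nonneg (symbolG_nonneg ξ) _) (Real.exp_pos _).le) (hcos ξ)
  refine (hasDerivAt_integral_of_dominated_loc_of_deriv_le (𝕜 := ℝ)
    (F := fun s ξ => Real.cos (2 * Real.pi * inner ℝ ξ y)
      * ((-symbolG ξ) ^ j * Real.exp (-s * symbolG ξ)))
    (F' := fun s ξ => Real.cos (2 * Real.pi * inner ℝ ξ y)
      * ((-symbolG ξ) ^ (j + 1) * Real.exp (-s * symbolG ξ)))
    (bound := fun ξ => symbolG ξ ^ (j + 1) * Real.exp (-(t / 2) * symbolG ξ))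
    -- Staying above time t / 2 gives one integrable majorant for all nearby times.
    (Ioi_mem_nhds (half_lt_self ht)) ?_ ?_ ?_ ?_ ?_ ?_).2
  · refine Filter.Eventually.of_forall fun s => ?_
    apply Continuous.aestronglyMeasurable
    fun_prop
  · refine (integrable_symbol j ht).mono' ?_ (Filter.Eventually.of_forall fun ξ => hbd j t ξ)
    apply Continuous.aestronglyMeasurable
    fun_prop
  · apply Continuous.aestronglyMeasurable
    fun_prop
  · refine Filter.Eventually.of_forall fun ξ s hs => (hbd (j + 1) s ξ).trans ?_
    have hs' : t / 2 < s := hs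
    have h0 := symbolG_nonneg ξ
    gcongr
  · exact integrable_symbol _ (half_pos ht)
  · refine Filter.Eventually.of_forall fun ξ s _ => ?_
    have h1 : HasDerivAt (fun s : ℝ => Real.exp (-s * symbolG ξ))
        (Real.exp (-s * symbolG ξ) * (-1 * symbolG ξ)) s :=
      ((hasDerivAt_neg s).mul_const (symbolG ξ)).exp
    refine ((h1.const_mul ((-symbolG ξ) ^ j)).const_mul
      (Real.cos (2 * Real.pi * inner ℝ ξ y))).congr_deriv ?_
    ring

lemma integral_heatKernel {t : ℝ} (ht : 0 < t) : ∫ y, heatKernel d t y = 1 := by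
  have h := fourier_heatKernel (d := d) ht 0
  rw [SchwartzMap.fourier_coe, Real.fourier_eq'] at h
  simp only [inner_zero_right, mul_zero, Complex.ofReal_zero, zero_mul, Complex.exp_zero,
    one_smul, complexify_apply] at h
  rw [integral_complex_ofReal] at h
  have h0 : symbolG (0 : Spacetime d) = 0 := by simp [symbolG]
  rw [h0, mul_zero, Real.exp_zero] at h
  exact_mod_cast h

lemma opG_translate (x : Spacetime d) (φ : 𝓢(Spacetime d, ℝ)) :
    opG d (translate x φ) = translate x (opG d φ) := by
  have hp (i : Fin (d + 1)) (φ : 𝓢(Spacetime d, ℝ)) :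
      partialD d i (translate x φ) = translate x (partialD d i φ) := lineDerivOp_translate _ x φ
  have hl (φ : 𝓢(Spacetime d, ℝ)) :
      spatialLaplacian d (translate x φ) = translate x (spatialLaplacian d φ) := by
    simp only [spatialLaplacian, sum_apply, ContinuousLinearMap.comp_apply, hp, map_sum]
  simp only [opG, sub_apply, ContinuousLinearMap.comp_apply, hp, hl, map_sub]

lemma opG_pow_translate (j : ℕ) (x : Spacetime d) (φ : 𝓢(Spacetime d, ℝ)) :
    (opG d ^ j) (translate x φ) = translate x ((opG d ^ j) φ) := by
  induction j with
  | zero => simp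
  | succ j ih =>
    have h (φ : 𝓢(Spacetime d, ℝ)) : (opG d ^ (j + 1)) φ = opG d ((opG d ^ j) φ) := by
      rw [pow_succ']; rfl
    rw [h, h, ih, opG_translate]

lemma opG_pow_heatAt (j : ℕ) (t : ℝ) (x : Spacetime d) :
    (opG d ^ j) (heatAt t x) = translate x (heatDeriv d j t) :=
  opG_pow_translate j x _

lemma QAt_eq (N : ℕ) (t : ℝ) (x : Spacetime d) :
    QAt N t x = (-t) ^ N • translate x (heatDeriv d N t) := by
  rw [QAt, smul_pow, ← opG_pow_heatAt]
  rfl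

lemma abs_integral_le_of_abs_le {X : Type*} [MeasurableSpace X] {μ : Measure X} {f g : X → ℝ}
    (hg : Integrable g μ) (h : ∀ y, |f y| ≤ g y) : |∫ y, f y ∂μ| ≤ ∫ y, g y ∂μ :=
  norm_integral_le_of_norm_le (f := f) hg (Filter.Eventually.of_forall h)

/-! ### Parabolic scaling and moments of the heat kernel -/

/-- The parabolic size `√|y₀| + |y'|` of a vector. -/
def pnorm (y : Spacetime d) : ℝ :=
  Real.sqrt |y 0| + Real.sqrt (∑ i : Fin d, y i.succ ^ 2)

lemma pdist_eq (x y : Spacetime d) : pdist x y = pnorm (x - y) := by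
  simp [pdist, pnorm]

lemma pnorm_nonneg (y : Spacetime d) : 0 ≤ pnorm y := by unfold pnorm; positivity

lemma pnorm_neg (y : Spacetime d) : pnorm (-y) = pnorm y := by simp [pnorm]

lemma continuous_pnorm : Continuous (pnorm : Spacetime d → ℝ) := by
  unfold pnorm
  fun_prop

lemma norm_sq_eq (y : Spacetime d) : ‖y‖ ^ 2 = y 0 ^ 2 + ∑ i : Fin d, y i.succ ^ 2 := by
  rw [EuclideanSpace.norm_sq_eq, Fin.sum_univ_succ]
  simp

lemma pnorm_le (y : Spacetime d) : pnorm y ≤ 2 * (1 + ‖y‖) := by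
  have h := norm_sq_eq y
  have hs : 0 ≤ ∑ i : Fin d, y i.succ ^ 2 := Finset.sum_nonneg fun i _ => sq_nonneg _
  have h0 : |y 0| ≤ ‖y‖ := abs_le_of_sq_le_sq (by linarith) (norm_nonneg _)
  have h1 : Real.sqrt |y 0| ≤ 1 + ‖y‖ := by
    rw [Real.sqrt_le_left (by positivity)]
    nlinarith [norm_nonneg y]
  have h2 : Real.sqrt (∑ i : Fin d, y i.succ ^ 2) ≤ 1 + ‖y‖ := by
    rw [Real.sqrt_le_left (by positivity)]
    nlinarith [norm_nonneg y, sq_nonneg (y 0)]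
  unfold pnorm
  linarith

/-- Time counts twice in the parabolic scale, hence the square. This converts Euclidean polynomial
weights into parabolic moments, which scale exactly. -/
lemma norm_le_pnorm (y : Spacetime d) : ‖y‖ ≤ pnorm y ^ 2 + pnorm y := by
  have h := norm_sq_eq y
  have hs : 0 ≤ ∑ i : Fin d, y i.succ ^ 2 := Finset.sum_nonneg fun i _ => sq_nonneg _
  set a := Real.sqrt |y 0| with ha
  set b := Real.sqrt (∑ i : Fin d, y i.succ ^ 2) with hb
  have ha2 : a ^ 2 = |y 0| := Real.sq_sqrt (abs_nonneg _)
  have hb2 : b ^ 2 = ∑ i : Fin d, y i.succ ^ 2 := Real.sq_sqrt hs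
  have ha0 : 0 ≤ a := Real.sqrt_nonneg _
  have hb0 : 0 ≤ b := Real.sqrt_nonneg _
  have h1 : ‖y‖ ≤ a ^ 2 + b := by
    refine abs_le_of_sq_le_sq' ?_ (by positivity) |>.2
    rw [h, ← hb2, ← sq_abs (y 0), ← ha2]
    nlinarith [mul_nonneg (sq_nonneg a) hb0]
  have hp : pnorm y = a + b := rfl
  rw [hp]
  nlinarith [mul_nonneg ha0 hb0, sq_nonneg b]

/-- The parabolic dilation `(y₀, y') ↦ (r² y₀, r y')`. -/
def dil (d : ℕ) (r : ℝ) : Spacetime d →ₗ[ℝ] Spacetime d where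
  toFun y := WithLp.toLp 2 (Fin.cons (r ^ 2 * y 0) fun i : Fin d => r * y i.succ)
  map_add' x y := by
    ext i
    refine Fin.cases ?_ (fun i => ?_) i <;> simp [mul_add]
  map_smul' c y := by
    ext i
    refine Fin.cases ?_ (fun i => ?_) i <;> simp [mul_left_comm]

lemma dil_zero_coord (r : ℝ) (y : Spacetime d) : dil d r y 0 = r ^ 2 * y 0 := rfl

lemma dil_succ_coord (r : ℝ) (y : Spacetime d) (i : Fin d) :
    dil d r y i.succ = r * y i.succ := rfl

lemma dil_comp_dil {r r' : ℝ} (h : r * r' = 1) : dil d r ∘ₗ dil d r' = LinearMap.id := by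
  refine LinearMap.ext fun y => ?_
  ext i
  refine Fin.cases ?_ (fun i => ?_) i
  · rw [LinearMap.comp_apply, dil_zero_coord, dil_zero_coord, ← mul_assoc, ← mul_pow, h]
    simp
  · rw [LinearMap.comp_apply, dil_succ_coord, dil_succ_coord, ← mul_assoc, h]
    simp

lemma dil_dil {r r' : ℝ} (h : r * r' = 1) (y : Spacetime d) : dil d r (dil d r' y) = y :=
  LinearMap.congr_fun (dil_comp_dil h) y

lemma symbolG_dil (r : ℝ) (ξ : Spacetime d) : symbolG (dil d r ξ) = r ^ 4 * symbolG ξ := by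
  simp only [symbolG, dil_zero_coord, dil_succ_coord]
  have : ∑ i : Fin d, (2 * Real.pi * (r * ξ i.succ)) ^ 2
      = r ^ 2 * ∑ i : Fin d, (2 * Real.pi * ξ i.succ) ^ 2 := by
    rw [Finset.mul_sum]
    exact Finset.sum_congr rfl fun i _ => by ring
  rw [this]
  ring

lemma inner_dil (r : ℝ) (ξ y : Spacetime d) :
    (inner ℝ (dil d r ξ) y : ℝ) = inner ℝ ξ (dil d r y) := by
  simp only [PiLp.inner_apply, Fin.sum_univ_succ, dil_zero_coord, dil_succ_coord]
  simp only [RCLike.inner_apply, conj_trivial]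
  congr 1
  · ring
  · exact Finset.sum_congr rfl fun i _ => by ring

lemma pnorm_dil {r : ℝ} (hr : 0 ≤ r) (y : Spacetime d) : pnorm (dil d r y) = r * pnorm y := by
  simp only [pnorm, dil_zero_coord, dil_succ_coord]
  have : ∑ i : Fin d, (r * y i.succ) ^ 2 = r ^ 2 * ∑ i : Fin d, y i.succ ^ 2 := by
    rw [Finset.mul_sum]
    exact Finset.sum_congr rfl fun i _ => by ring
  rw [this, abs_mul, abs_of_nonneg (sq_nonneg r), Real.sqrt_mul (sq_nonneg r),
    Real.sqrt_mul (sq_nonneg r), Real.sqrt_sq hr]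
  ring

lemma det_dil_mul {r r' : ℝ} (h : r * r' = 1) :
    LinearMap.det (dil d r) * LinearMap.det (dil d r') = 1 := by
  rw [← LinearMap.det_comp, dil_comp_dil h, LinearMap.det_id]

/-- The value of the determinant is never needed: in the moment formula the Jacobian from the
Fourier side cancels the one from physical space. -/
lemma integral_comp_dil {r : ℝ} (hr : 0 < r) (f : Spacetime d → ℝ) :
    ∫ y, f (dil d r y) = |(LinearMap.det (dil d r))⁻¹| * ∫ y, f y := by
  have h1 := dil_comp_dil (d := d) (mul_inv_cancel₀ hr.ne')
  have h2 := dil_comp_dil (d := d) (inv_mul_cancel₀ hr.ne')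
  have hdet : LinearMap.det (dil d r) ≠ 0 := by
    intro h
    have := det_dil_mul (d := d) (mul_inv_cancel₀ hr.ne')
    rw [h, zero_mul] at this
    exact zero_ne_one this
  let e : Spacetime d ≃ₜ Spacetime d :=
    { toFun := dil d r
      invFun := dil d r⁻¹
      left_inv := dil_dil (inv_mul_cancel₀ hr.ne')
      right_inv := dil_dil (mul_inv_cancel₀ hr.ne')
      continuous_toFun := (dil d r).continuous_of_finiteDimensional
      continuous_invFun := (dil d r⁻¹).continuous_of_finiteDimensional }
  have h3 := e.measurableEmbedding.integral_map (μ := volume) f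
  have h4 : Measure.map e volume
      = ENNReal.ofReal |(LinearMap.det (dil d r))⁻¹| • (volume : Measure (Spacetime d)) :=
    Measure.map_linearMap_addHaar_eq_smul_addHaar volume hdet
  rw [h4, integral_smul_measure, ENNReal.toReal_ofReal (abs_nonneg _)] at h3
  exact h3.symm

lemma heatFun_scaling (j : ℕ) {r : ℝ} (hr : 0 < r) (y : Spacetime d) :
    heatFun d j (r ^ 4) y
      = |(LinearMap.det (dil d r))⁻¹| * ((r ^ 4)⁻¹ ^ j * heatFun d j 1 (dil d r⁻¹ y)) := by
  have h := integral_comp_dil hr (fun η : Spacetime d => (r ^ 4)⁻¹ ^ j *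
    (Real.cos (2 * Real.pi * inner ℝ η (dil d r⁻¹ y))
      * ((-symbolG η) ^ j * Real.exp (-1 * symbolG η))))
  rw [heatFun, heatFun, ← integral_const_mul, ← h]
  refine integral_congr_ae (Filter.Eventually.of_forall fun ξ => ?_)
  simp only
  rw [inner_dil, dil_dil (mul_inv_cancel₀ hr.ne'), symbolG_dil]
  have hr4 : (r ^ 4)⁻¹ ^ j * (-(r ^ 4 * symbolG ξ)) ^ j = (-symbolG ξ) ^ j := by
    rw [← mul_pow]
    congr 1
    field_simp
  rw [← hr4]
  ring_nf

/-- The moments of `𝒢ʲ p₁`. -/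
def heatMoment (d j : ℕ) (a : ℝ) : ℝ := ∫ y, |heatDeriv d j 1 y| * pnorm y ^ a

lemma heatMoment_nonneg (j : ℕ) (a : ℝ) : 0 ≤ heatMoment d j a :=
  integral_nonneg fun y => mul_nonneg (abs_nonneg _) (Real.rpow_nonneg (pnorm_nonneg y) a)

/-- The symbol is homogeneous of degree 4 under the parabolic dilation, so with r = t^(1/4) the
kernel at time t is a rescaling of the one at time 1. All powers of t in the estimates come from
here. -/
lemma integral_heatDeriv_pnorm (j : ℕ) (a : ℝ) {t : ℝ} (ht : 0 < t) :
    ∫ y, |heatDeriv d j t y| * pnorm y ^ a = heatMoment d j a * t ^ (a / 4 - j) := by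
  set r := t ^ (1 / 4 : ℝ) with hrdef
  have hr : 0 < r := Real.rpow_pos_of_pos ht _
  have hr4 : r ^ 4 = t := by
    rw [hrdef, ← Real.rpow_natCast, ← Real.rpow_mul ht.le]
    norm_num
  have hra : r ^ a = t ^ (a / 4) := by
    rw [hrdef, ← Real.rpow_mul ht.le]
    congr 1
    ring
  have hpt (y : Spacetime d) : |heatDeriv d j t y| * pnorm y ^ a
      = |(LinearMap.det (dil d r))⁻¹| * (t⁻¹ ^ j * r ^ a)
        * (|heatDeriv d j 1 (dil d r⁻¹ y)| * pnorm (dil d r⁻¹ y) ^ a) := by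
    have h1 : pnorm y = r * pnorm (dil d r⁻¹ y) := by
      rw [← pnorm_dil hr.le, dil_dil (mul_inv_cancel₀ hr.ne')]
    rw [heatDeriv_apply j ht, heatDeriv_apply j one_pos, ← hr4, heatFun_scaling j hr, abs_mul,
      abs_mul, abs_abs, h1, Real.mul_rpow hr.le (pnorm_nonneg _), abs_of_nonneg (a := _ ^ j)]
    · ring
    · positivity
  simp_rw [hpt]
  rw [integral_const_mul, integral_comp_dil (inv_pos.2 hr)
    fun y => |heatDeriv d j 1 y| * pnorm y ^ a]
  change _ * (_ * heatMoment d j a) = _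
  have hdet : |(LinearMap.det (dil d r))⁻¹| * |(LinearMap.det (dil d r⁻¹))⁻¹| = 1 := by
    rw [← abs_mul, ← mul_inv, det_dil_mul (mul_inv_cancel₀ hr.ne')]
    simp
  have ht' : t ^ (a / 4 - j) = t⁻¹ ^ j * r ^ a := by
    rw [Real.rpow_sub ht, Real.rpow_natCast, hra, inv_pow]
    field_simp
  rw [ht']
  linear_combination (t⁻¹ ^ j * r ^ a * heatMoment d j a) * hdet

lemma pnorm_rpow_le {a : ℝ} (ha : 0 ≤ a) (y : Spacetime d) :
    pnorm y ^ a ≤ 2 ^ ⌈a⌉₊ * (1 + ‖y‖) ^ ⌈a⌉₊ := by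
  have h1 : (1 : ℝ) ≤ 2 * (1 + ‖y‖) := by linarith [norm_nonneg y]
  calc pnorm y ^ a ≤ (2 * (1 + ‖y‖)) ^ a :=
        Real.rpow_le_rpow (pnorm_nonneg y) (pnorm_le y) ha
    _ ≤ (2 * (1 + ‖y‖)) ^ (⌈a⌉₊ : ℝ) := Real.rpow_le_rpow_of_exponent_le h1 (Nat.le_ceil a)
    _ = _ := by rw [Real.rpow_natCast, mul_pow]

lemma continuous_pnorm_rpow {a : ℝ} (ha : 0 ≤ a) :
    Continuous fun y : Spacetime d => pnorm y ^ a :=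
  continuous_pnorm.rpow_const fun _ => Or.inr ha

lemma integrable_mul_pnorm_rpow (φ : 𝓢(Spacetime d, ℝ)) {a : ℝ} (ha : 0 ≤ a) :
    Integrable fun y => |φ y| * pnorm y ^ a := by
  have h := (integrable_mul_of_poly_bound φ (h := fun y => pnorm y ^ a)
    (continuous_pnorm_rpow ha).aestronglyMeasurable (fun y => by
      rw [Real.norm_of_nonneg (Real.rpow_nonneg (pnorm_nonneg y) a)]
      exact pnorm_rpow_le ha y)).norm
  refine h.congr (Filter.Eventually.of_forall fun y => ?_)
  simp [abs_of_nonneg (Real.rpow_nonneg (pnorm_nonneg y) a)]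

/-! ### Convolution of a Schwartz function with a function of polynomial growth -/

/-- Measurable functions of polynomial growth. -/
def PolyBdd (v : Spacetime d → ℝ) : Prop :=
  Measurable v ∧ ∃ (C : ℝ) (k : ℕ), ∀ y, |v y| ≤ C * (1 + ‖y‖) ^ k

/-- The function `χ ⋆ v`. -/
def sconv (χ : 𝓢(Spacetime d, ℝ)) (v : Spacetime d → ℝ) (x : Spacetime d) : ℝ :=
  ∫ y, χ (x - y) * v y

lemma PolyBdd.of_bounded {v : Spacetime d → ℝ} (hv : Measurable v) {C : ℝ}
    (h : ∀ y, |v y| ≤ C) : PolyBdd v := ⟨hv, C, 0, by simpa using h⟩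

lemma polyBdd_apply_heatAt (Λ : TempDist d) (t : ℝ) : PolyBdd fun y => Λ (heatAt t y) := by
  obtain ⟨C, k, -, h⟩ := exists_translate_bound Λ (heatKernel d t)
  exact ⟨(continuous_apply_translate Λ _).measurable, C, k, h⟩

/-- The reflected translate `y ↦ χ (x - y)`. -/
def reflect (x : Spacetime d) (χ : 𝓢(Spacetime d, ℝ)) : 𝓢(Spacetime d, ℝ) :=
  translate x (SchwartzMap.compCLMOfContinuousLinearEquiv ℝ (ContinuousLinearEquiv.neg ℝ) χ)

lemma reflect_apply (x : Spacetime d) (χ : 𝓢(Spacetime d, ℝ)) (y : Spacetime d) :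
    reflect x χ y = χ (x - y) := by
  rw [reflect, translate_apply, SchwartzMap.compCLMOfContinuousLinearEquiv_apply]
  simp

lemma PolyBdd.integrable_mul {v : Spacetime d → ℝ} (hv : PolyBdd v) (χ : 𝓢(Spacetime d, ℝ)) :
    Integrable fun y => χ y * v y := by
  obtain ⟨hvm, C, k, hC⟩ := hv
  exact integrable_mul_of_poly_bound χ hvm.aestronglyMeasurable hC

lemma PolyBdd.integrable_sconv {v : Spacetime d → ℝ} (hv : PolyBdd v) (χ : 𝓢(Spacetime d, ℝ))
    (x : Spacetime d) : Integrable fun y => χ (x - y) * v y := by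
  simpa only [reflect_apply] using hv.integrable_mul (reflect x χ)

lemma sconv_add {v w : Spacetime d → ℝ} (hv : PolyBdd v) (hw : PolyBdd w)
    (χ : 𝓢(Spacetime d, ℝ)) (x : Spacetime d) :
    sconv χ (fun y => v y + w y) x = sconv χ v x + sconv χ w x := by
  simp only [sconv, mul_add]
  exact integral_add (hv.integrable_sconv χ x) (hw.integrable_sconv χ x)

lemma sconv_sub {v w : Spacetime d → ℝ} (hv : PolyBdd v) (hw : PolyBdd w)
    (χ : 𝓢(Spacetime d, ℝ)) (x : Spacetime d) :
    sconv χ (fun y => v y - w y) x = sconv χ v x - sconv χ w x := by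
  simp only [sconv, mul_sub]
  exact integral_sub (hv.integrable_sconv χ x) (hw.integrable_sconv χ x)

lemma sconv_const_mul (c : ℝ) (v : Spacetime d → ℝ) (χ : 𝓢(Spacetime d, ℝ)) (x : Spacetime d) :
    sconv χ (fun y => c * v y) x = c * sconv χ v x := by
  simp only [sconv, ← integral_const_mul]
  exact integral_congr_ae (Filter.Eventually.of_forall fun y => by ring)

lemma abs_sconv_le {v : Spacetime d → ℝ} {C : ℝ} (h : ∀ y, |v y| ≤ C)
    (χ : 𝓢(Spacetime d, ℝ)) (x : Spacetime d) : |sconv χ v x| ≤ C * ∫ y, |χ y| := by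
  have h1 : Integrable fun y => C * |χ (x - y)| :=
    (((reflect x χ).integrable (μ := volume)).norm.const_mul C).congr
      (Filter.Eventually.of_forall fun y => by simp [reflect_apply])
  rw [← integral_sub_left_eq_self (fun y => |χ y|) volume x, ← integral_const_mul]
  refine abs_integral_le_of_abs_le h1 fun y => ?_
  rw [abs_mul, mul_comm]
  exact mul_le_mul_of_nonneg_right (h y) (abs_nonneg _)

lemma measurable_sconv {v : Spacetime d → ℝ} (hv : Measurable v) (χ : 𝓢(Spacetime d, ℝ)) :
    Measurable (sconv χ v) := by
  have h : StronglyMeasurable fun q : Spacetime d × Spacetime d => χ (q.1 - q.2) * v q.2 :=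
    ((χ.continuous.measurable.comp (measurable_fst.sub measurable_snd)).mul
      (hv.comp measurable_snd)).stronglyMeasurable
  exact (h.integral_prod_right' (ν := volume)).measurable

/-- Fubini. The growth of v is distributed over the two kernels by 1 + |z| ≤ (1 + |x|)(1 + |x -
y|)(1 + |y - z|), and each kernel absorbs its factor. -/
lemma sconv_sconv {v : Spacetime d → ℝ} (hv : PolyBdd v) (χ₁ χ₂ : 𝓢(Spacetime d, ℝ))
    (x : Spacetime d) : sconv χ₁ (sconv χ₂ v) x = sconv (conv χ₁ χ₂) v x := by
  obtain ⟨hvm, C, k, hC⟩ := hv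
  have hint : Integrable (fun p : Spacetime d × Spacetime d =>
      χ₁ (x - p.2) * χ₂ (p.2 - p.1) * v p.1) (volume.prod volume) := by
    have h1 : Integrable fun y => (1 + ‖x - y‖) ^ k * |χ₁ (x - y)| :=
      (integrable_one_add_norm_pow_mul χ₁ k).comp_sub_left x
    have h2 : Integrable fun y : Spacetime d => (1 + ‖-y‖) ^ k * |χ₂ (-y)| :=
      (integrable_one_add_norm_pow_mul χ₂ k).comp_neg
    have h3 := (h1.convolution_integrand (ContinuousLinearMap.mul ℝ ℝ) h2).const_mul
      (C * (1 + ‖x‖) ^ k)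
    refine h3.mono' ?_ (Filter.Eventually.of_forall fun p => ?_)
    · refine (Measurable.mul (Measurable.mul ?_ ?_) (hvm.comp measurable_fst)).aestronglyMeasurable
      · exact χ₁.continuous.measurable.comp (measurable_const.sub measurable_snd)
      · exact χ₂.continuous.measurable.comp (measurable_snd.sub measurable_fst)
    · obtain ⟨z, y⟩ := p
      simp only [ContinuousLinearMap.mul_apply', neg_sub, Real.norm_eq_abs, abs_mul]
      have hz : 1 + ‖z‖ ≤ (1 + ‖x‖) * ((1 + ‖x - y‖) * (1 + ‖y - z‖)) := by
        have h4 : ‖z‖ ≤ ‖x‖ + (‖x - y‖ + ‖y - z‖) := by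
          have e : z = x - ((x - y) + (y - z)) := by abel
          calc ‖z‖ = ‖x - ((x - y) + (y - z))‖ := by rw [← e]
            _ ≤ ‖x‖ + ‖(x - y) + (y - z)‖ := norm_sub_le _ _
            _ ≤ _ := by gcongr; exact norm_add_le _ _
        have h5 : 1 + (‖x - y‖ + ‖y - z‖) ≤ (1 + ‖x - y‖) * (1 + ‖y - z‖) := by
          nlinarith [mul_nonneg (norm_nonneg (x - y)) (norm_nonneg (y - z))]
        have h6 : 0 ≤ ‖x - y‖ + ‖y - z‖ := by positivity
        nlinarith [norm_nonneg x]
      have hC0 : 0 ≤ C := by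
        have := (abs_nonneg _).trans (hC 0)
        simpa using this
      calc |χ₁ (x - y)| * |χ₂ (y - z)| * |v z|
          ≤ |χ₁ (x - y)| * |χ₂ (y - z)| *
            (C * ((1 + ‖x‖) * ((1 + ‖x - y‖) * (1 + ‖y - z‖))) ^ k) := by
              gcongr
              exact (hC z).trans (by gcongr)
        _ = _ := by rw [mul_pow, mul_pow]; ring
  have hconv (z : Spacetime d) :
      conv χ₁ χ₂ (x - z) * v z = ∫ y, χ₁ (x - y) * χ₂ (y - z) * v z := by
    rw [conv_apply, integral_mul_const, ← integral_sub_left_eq_self _ _ x]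
    congr 2
    funext y
    congr 2
    abel
  simp only [sconv, hconv, ← integral_const_mul]
  rw [integral_integral_swap]
  · simp only [mul_assoc]
  · convert hint.swap using 1
    funext p
    simp [Function.uncurry, mul_assoc]

lemma heatDeriv_sub_comm (j : ℕ) (t : ℝ) (x y : Spacetime d) :
    heatDeriv d j t (x - y) = heatDeriv d j t (y - x) := by
  rw [← heatDeriv_neg, neg_sub]

lemma conv_translate (x : Spacetime d) (p φ : 𝓢(Spacetime d, ℝ)) :
    conv (translate x p) φ = translate x (conv p φ) := by
  ext z
  rw [translate_apply, conv_apply, conv_apply,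
    ← integral_add_right_eq_self _ x]
  refine integral_congr_ae (Filter.Eventually.of_forall fun y => ?_)
  simp only [translate_apply, add_sub_cancel_right]
  congr 2
  abel

/-- The semigroup property passed through Λ: convolving the functions y ↦ ⟨Λ, p_s(y,·)⟩ replaces
testing Λ against kernels at later times, so the remaining estimates concern functions only. -/
lemma apply_translate_heatDeriv (Λ : TempDist d) (j : ℕ) {t s : ℝ} (ht : 0 < t) (hs : 0 < s)
    (x : Spacetime d) : Λ (translate x (heatDeriv d j (t + s)))
      = sconv (heatDeriv d j t) (fun y => Λ (heatAt s y)) x := by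
  have h := conv_heatDeriv (d := d) j 0 ht hs
  rw [add_zero] at h
  rw [← h, ← conv_translate, apply_conv]
  refine integral_congr_ae (Filter.Eventually.of_forall fun y => ?_)
  simp only [translate_apply, heatDeriv_sub_comm j t x y]
  rfl

lemma apply_heatAt_add (Λ : TempDist d) {t s : ℝ} (ht : 0 < t) (hs : 0 < s)
    (x : Spacetime d) : Λ (heatAt (t + s) x)
      = sconv (heatDeriv d 0 t) (fun y => Λ (heatAt s y)) x :=
  apply_translate_heatDeriv Λ 0 ht hs x

lemma heatAt_of_nonpos {t : ℝ} (ht : t ≤ 0) (x : Spacetime d) : heatAt t x = 0 := by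
  rw [heatAt, heatKernel_of_nonpos ht, map_zero]

/-- Joint measurability of a convolution with the heat kernel. -/
lemma measurable_sconv_heatDeriv {X : Type*} [MeasurableSpace X] (j : ℕ) {τ : X → ℝ}
    (hτ : Measurable τ) {x : X → Spacetime d} (hx : Measurable x) {v : X → Spacetime d → ℝ}
    (hv : Measurable (Function.uncurry v)) :
    Measurable fun p => sconv (heatDeriv d j (τ p)) (v p) (x p) := by
  have h : StronglyMeasurable fun q : X × Spacetime d =>
      heatDeriv d j (τ q.1) (x q.1 - q.2) * v q.1 q.2 := by
    refine Measurable.stronglyMeasurable (Measurable.mul ?_ hv)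
    exact (measurable_heatDeriv j).comp ((hτ.comp measurable_fst).prodMk
      ((hx.comp measurable_fst).sub measurable_snd))
  exact (h.integral_prod_right' (ν := volume)).measurable

/-- By the semigroup property the value at time t > 0 equals p_{t-ε} ⋆ ⟨Λ, p_ε⟩ for every ε < t, and
for fixed ε this is jointly measurable since the kernel is. The approximating sequence is eventually
constant at each point. -/
lemma measurable_apply_heatAt (Λ : TempDist d) :
    Measurable fun p : ℝ × Spacetime d => Λ (heatAt p.1 p.2) := by
  let s (n : ℕ) : ℝ := 1 / ((n : ℝ) + 1)
  have hs (n : ℕ) : 0 < s n := Nat.one_div_pos_of_nat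
  have hm (n : ℕ) : Measurable fun p : ℝ × Spacetime d =>
      sconv (heatDeriv d 0 (p.1 - s n)) (fun y => Λ (heatAt (s n) y)) p.2 :=
    measurable_sconv_heatDeriv 0 (measurable_fst.sub_const _) measurable_snd
      ((polyBdd_apply_heatAt Λ (s n)).1.comp measurable_snd)
  refine measurable_of_tendsto_metrizable hm (tendsto_pi_nhds.2 fun p => ?_)
  rcases le_or_gt p.1 0 with hp | hp
  · rw [heatAt_of_nonpos hp, map_zero]
    refine tendsto_const_nhds.congr fun n => ?_
    rw [heatDeriv_of_nonpos (by linarith [hs n])]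
    simp [sconv]
  · refine tendsto_const_nhds.congr' ?_
    have hlim : Filter.Tendsto s Filter.atTop (nhds 0) := tendsto_one_div_add_atTop_nhds_zero_nat
    filter_upwards [hlim.eventually (gt_mem_nhds hp)] with n hn
    rw [← apply_heatAt_add Λ (sub_pos.2 hn) (hs n), sub_add_cancel]

/-! ### Uniqueness from heat averages -/

/-- A distribution that vanishes on heat kernels, in the limit of small times, is zero. -/
lemma eq_zero_of_heatAt_small (Λ : TempDist d) {C c : ℝ} (hc : 0 < c)
    (h : ∀ t : ℝ, 0 < t → t ≤ 1 → ∀ x, |Λ (heatAt t x)| ≤ C * t ^ c) : Λ = 0 := by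
  ext φ
  obtain ⟨D, k, hD0, hD⟩ := exists_translate_sub_bound Λ φ
  have hIoc : Set.Ioc (0 : ℝ) 1 ∈ nhdsWithin (0 : ℝ) (Set.Ioi 0) :=
    Ioc_mem_nhdsGT one_pos
  -- Both exponents on the right are positive, so the corresponding moments of p_t tend to zero with
  -- t.
  have hp (y : Spacetime d) : (1 + ‖y‖) ^ k * ‖y‖
      ≤ 2 * 3 ^ k * (pnorm y ^ (1 : ℝ) + pnorm y ^ ((2 * k + 2 : ℕ) : ℝ)) := by
    have hy := norm_le_pnorm y
    rw [Real.rpow_one, Real.rpow_natCast]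
    set p := pnorm y
    have hp0 : 0 ≤ p := pnorm_nonneg y
    rcases le_total p 1 with hp1 | hp1
    · have h1 : ‖y‖ ≤ 2 * p := by nlinarith
      have h2 : 1 + ‖y‖ ≤ 3 := by linarith
      calc (1 + ‖y‖) ^ k * ‖y‖ ≤ 3 ^ k * (2 * p) := by gcongr
        _ ≤ 2 * 3 ^ k * (p + p ^ (2 * k + 2)) := by
          have : 0 ≤ p ^ (2 * k + 2) := by positivity
          nlinarith [pow_pos (show (0 : ℝ) < 3 by norm_num) k]
    · have h1 : ‖y‖ ≤ 2 * p ^ 2 := by nlinarith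
      have h2 : 1 + ‖y‖ ≤ 3 * p ^ 2 := by nlinarith
      calc (1 + ‖y‖) ^ k * ‖y‖ ≤ (3 * p ^ 2) ^ k * (2 * p ^ 2) := by gcongr
        _ = 2 * 3 ^ k * p ^ (2 * k + 2) := by rw [mul_pow, ← pow_mul]; ring
        _ ≤ _ := by gcongr; linarith
  have h1 : ∀ t ∈ Set.Ioc (0 : ℝ) 1, |Λ φ| ≤ C * t ^ c * (∫ y, |φ y|)
      + D * (2 * 3 ^ k) * (heatMoment d 0 1 * t ^ ((1 : ℝ) / 4)
        + heatMoment d 0 ((2 * k + 2 : ℕ) : ℝ) * t ^ (((2 * k + 2 : ℕ) : ℝ) / 4)) := by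
    rintro t ⟨ht0, ht1⟩
    -- The value of Λ on φ ⋆ p_t is written in two ways: one is small by hypothesis, the other is
    -- close to Λ φ because p_t is an approximate identity.
    have e1 : Λ (conv φ (heatKernel d t)) = ∫ y, φ y * Λ (heatAt t y) := apply_conv Λ _ _
    have e2 : Λ (conv φ (heatKernel d t)) = ∫ y, heatKernel d t y * Λ (translate y φ) := by
      rw [conv_comm, apply_conv]
    have e3 : |Λ (conv φ (heatKernel d t))| ≤ C * t ^ c * ∫ y, |φ y| := by
      rw [e1, ← integral_const_mul]
      refine abs_integral_le_of_abs_le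
        ((φ.integrable (μ := volume)).norm.const_mul (C * t ^ c)) fun y => ?_
      rw [abs_mul, mul_comm]
      exact mul_le_mul_of_nonneg_right (h t ht0 ht1 y) (abs_nonneg _)
    have e4 : |Λ (conv φ (heatKernel d t)) - Λ φ| ≤ D * (2 * 3 ^ k) *
        (heatMoment d 0 1 * t ^ ((1 : ℝ) / 4)
        + heatMoment d 0 ((2 * k + 2 : ℕ) : ℝ) * t ^ (((2 * k + 2 : ℕ) : ℝ) / 4)) := by
      obtain ⟨C', k', -, hC'⟩ := exists_translate_bound Λ φ
      have i1 : Integrable fun y => heatKernel d t y * Λ (translate y φ) :=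
        PolyBdd.integrable_mul ⟨(continuous_apply_translate Λ φ).measurable, C', k', hC'⟩ _
      have i2 : Integrable fun y => heatKernel d t y * Λ φ :=
        ((heatKernel d t).integrable (μ := volume)).mul_const _
      have e5 : Λ φ = ∫ y, heatKernel d t y * Λ φ := by
        rw [integral_mul_const, integral_heatKernel ht0, one_mul]
      have i3 := integrable_mul_pnorm_rpow (heatDeriv d 0 t) (zero_le_one (α := ℝ))
      have i4 := integrable_mul_pnorm_rpow (heatDeriv d 0 t)
        (Nat.cast_nonneg (α := ℝ) (2 * k + 2))
      have m1 := integral_heatDeriv_pnorm (d := d) 0 1 ht0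
      have m2 := integral_heatDeriv_pnorm (d := d) 0 ((2 * k + 2 : ℕ) : ℝ) ht0
      rw [Nat.cast_zero, sub_zero] at m1 m2
      rw [e2]
      nth_rewrite 1 [e5]
      rw [← integral_sub i1 i2, ← m1, ← m2, ← integral_add i3 i4, ← integral_const_mul]
      refine abs_integral_le_of_abs_le ((i3.add i4).const_mul _) fun y => ?_
      have h0 := hD y 0
      have hz : translate (0 : Spacetime d) φ = φ := by
        ext z; rw [translate_apply, sub_zero]
      rw [hz, norm_zero, add_zero, sub_zero] at h0
      rw [← mul_sub, abs_mul]
      change |heatKernel d t y| * _ ≤ D * (2 * 3 ^ k) * (|heatKernel d t y| * _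
        + |heatKernel d t y| * _)
      calc |heatKernel d t y| * |Λ (translate y φ) - Λ φ|
          ≤ |heatKernel d t y| * (D * (1 + ‖y‖) ^ k * ‖y‖) := by gcongr
        _ = |heatKernel d t y| * D * ((1 + ‖y‖) ^ k * ‖y‖) := by ring
        _ ≤ |heatKernel d t y| * D *
          (2 * 3 ^ k * (pnorm y ^ (1 : ℝ) + pnorm y ^ ((2 * k + 2 : ℕ) : ℝ))) :=
            mul_le_mul_of_nonneg_left (hp y) (mul_nonneg (abs_nonneg _) hD0)
        _ = _ := by ring
    have e6 := abs_sub_abs_le_abs_sub (Λ φ) (Λ (conv φ (heatKernel d t)))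
    rw [abs_sub_comm] at e6
    linarith
  have hlim (c : ℝ) (hc : 0 < c) :
      Filter.Tendsto (fun t : ℝ => t ^ c) (nhdsWithin 0 (Set.Ioi 0)) (nhds 0) := by
    have : ContinuousAt (fun t : ℝ => t ^ c) 0 := Real.continuousAt_rpow_const _ _ (Or.inr hc.le)
    have h2 := this.tendsto
    rw [Real.zero_rpow hc.ne'] at h2
    exact h2.mono_left nhdsWithin_le_nhds
  have hl := (((hlim c hc).const_mul C).mul_const (∫ y, |φ y|)).add
    ((((hlim (1 / 4) (by norm_num)).const_mul (heatMoment d 0 1)).add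
      ((hlim (((2 * k + 2 : ℕ) : ℝ) / 4) (by positivity)).const_mul
        (heatMoment d 0 ((2 * k + 2 : ℕ) : ℝ)))).const_mul (D * (2 * 3 ^ k)))
  simp only [mul_zero, zero_mul, add_zero] at hl
  have h0 : |Λ φ| ≤ 0 := ge_of_tendsto hl (Filter.eventually_of_mem hIoc h1)
  simpa using h0

/-! ### Taylor expansion in time -/

/-- The coefficients `(-1)ʲ / j!`. -/
def taylorCoeff (j : ℕ) : ℝ := (-1) ^ j / (j.factorial : ℝ)

/-- The weight `(-s)ⁿ / n!` of the integral remainder. -/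
def taylorWeight (n : ℕ) (s : ℝ) : ℝ := (-s) ^ n / (n.factorial : ℝ)

lemma continuous_taylorWeight (n : ℕ) : Continuous (taylorWeight n) := by
  unfold taylorWeight
  fun_prop

lemma abs_taylorWeight_le (n : ℕ) {s : ℝ} (hs : 0 ≤ s) : |taylorWeight n s| ≤ s ^ n := by
  rw [taylorWeight, abs_div, abs_pow, abs_neg, abs_of_nonneg hs, Nat.abs_cast]
  exact div_le_self (by positivity) (by exact_mod_cast n.factorial_pos)

lemma hasDerivAt_taylorWeight (n : ℕ) (s : ℝ) :
    HasDerivAt (taylorWeight (n + 1)) (-taylorWeight n s) s := by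
  have h := ((hasDerivAt_neg s).pow (n + 1)).div_const ((n + 1).factorial : ℝ)
  refine h.congr_deriv ?_
  have h1 : (n.factorial : ℝ) ≠ 0 := by positivity
  rw [taylorWeight, Nat.factorial_succ]
  push_cast
  have h2 : (n : ℝ) + 1 ≠ 0 := by positivity
  field_simp

/-- The sum telescopes: differentiating the weight of index j + 1 cancels the term in which the heat
equation raises the order of the kernel of index j, and only the last term survives. Integrating
from s = 0 to s = 1 gives Taylor's formula. -/
lemma hasDerivAt_sum_taylor (n : ℕ) {t s : ℝ} (h : 0 < t + s) (y : Spacetime d) :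
    HasDerivAt (fun s => ∑ j ∈ Finset.range (n + 1), taylorWeight j s * heatDeriv d j (t + s) y)
      (taylorWeight n s * heatDeriv d (n + 1) (t + s) y) s := by
  have hk (j : ℕ) : HasDerivAt (fun s => heatDeriv d j (t + s) y)
      (heatDeriv d (j + 1) (t + s) y) s := by
    simpa using (hasDerivAt_heatDeriv j h y).comp_const_add t s
  induction n with
  | zero =>
    have h0 : taylorWeight 0 = fun _ => (1 : ℝ) := by
      funext s
      simp [taylorWeight]
    simpa [h0] using hk 0
  | succ n ih =>
    simp_rw [Finset.sum_range_succ _ (n + 1)]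
    refine (ih.add ((hasDerivAt_taylorWeight n s).mul (hk (n + 1)))).congr_deriv ?_
    ring

lemma continuousOn_heatDeriv (j : ℕ) {t : ℝ} (ht : 0 < t) (y : Spacetime d) :
    ContinuousOn (fun s => heatDeriv d j (t + s) y) (Set.Icc 0 1) := fun s hs => by
  have h : 0 < t + s := by linarith [hs.1]
  exact ((hasDerivAt_heatDeriv j h y).comp_const_add t s).continuousAt.continuousWithinAt

lemma heatDeriv_taylor (n : ℕ) {t : ℝ} (ht : 0 < t) (y : Spacetime d) :
    heatDeriv d 0 t y
      = ∑ j ∈ Finset.range (n + 1), taylorCoeff j * heatDeriv d j (t + 1) y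
        - ∫ s in Set.Ioc (0 : ℝ) 1, taylorWeight n s * heatDeriv d (n + 1) (t + s) y := by
  have h := intervalIntegral.integral_eq_sub_of_hasDerivAt (a := 0) (b := 1)
    (f := fun s => ∑ j ∈ Finset.range (n + 1), taylorWeight j s * heatDeriv d j (t + s) y)
    (f' := fun s => taylorWeight n s * heatDeriv d (n + 1) (t + s) y)
    (fun s hs => by
      rw [Set.uIcc_of_le zero_le_one] at hs
      exact hasDerivAt_sum_taylor n (by linarith [hs.1]) y)
    (ContinuousOn.intervalIntegrable (by
      rw [Set.uIcc_of_le zero_le_one]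
      exact (continuous_taylorWeight n).continuousOn.mul (continuousOn_heatDeriv _ ht y)))
  rw [intervalIntegral.integral_of_le zero_le_one] at h
  have h0 : ∑ j ∈ Finset.range (n + 1), taylorWeight j 0 * heatDeriv d j (t + 0) y
      = heatDeriv d 0 t y := by
    rw [Finset.sum_eq_single 0]
    · simp [taylorWeight]
    · intro j _ hj
      simp [taylorWeight, hj]
    · simp
  rw [h, h0]
  simp only [taylorCoeff, taylorWeight]
  ring

/-! ### Caloric families -/

lemma one_add_norm_pow_le (k : ℕ) (y : Spacetime d) :
    (1 + ‖y‖) ^ k ≤ 3 ^ k * (pnorm y ^ (0 : ℝ) + pnorm y ^ ((2 * k : ℕ) : ℝ)) := by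
  have hy := norm_le_pnorm y
  rw [Real.rpow_zero, Real.rpow_natCast]
  set p := pnorm y
  have hp0 : 0 ≤ p := pnorm_nonneg y
  rcases le_total p 1 with hp1 | hp1
  · have h2 : 1 + ‖y‖ ≤ 3 := by nlinarith
    calc (1 + ‖y‖) ^ k ≤ 3 ^ k := by gcongr
      _ ≤ _ := le_mul_of_one_le_right (by positivity) (by linarith [pow_nonneg hp0 (2 * k)])
  · have h2 : 1 + ‖y‖ ≤ 3 * p ^ 2 := by nlinarith
    calc (1 + ‖y‖) ^ k ≤ (3 * p ^ 2) ^ k := by gcongr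
      _ = 3 ^ k * p ^ (2 * k) := by rw [mul_pow, ← pow_mul]
      _ ≤ _ := by gcongr; linarith

lemma rpow_le_endpoints {a b τ : ℝ} (ha : 0 < a) (h1 : a ≤ τ) (h2 : τ ≤ b) (e : ℝ) :
    τ ^ e ≤ a ^ e + b ^ e := by
  have hτ : 0 < τ := ha.trans_le h1
  rcases le_total 0 e with he | he
  · exact (Real.rpow_le_rpow hτ.le h2 he).trans
      (le_add_of_nonneg_left (Real.rpow_nonneg ha.le e))
  · exact (Real.rpow_le_rpow_of_nonpos ha h1 he).trans
      (le_add_of_nonneg_right (Real.rpow_nonneg (hτ.le.trans h2) e))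

/-- The moments are powers of τ whose exponents may have either sign, so on [a, b] they are bounded
by the sum of the values at the two endpoints. Uniformity in τ is what Fubini in (s, y) requires. -/
lemma exists_integral_heatDeriv_poly_le (j k : ℕ) {a b : ℝ} (ha : 0 < a) :
    ∃ C : ℝ, ∀ τ, a ≤ τ → τ ≤ b → ∫ y, (1 + ‖y‖) ^ k * |heatDeriv d j τ y| ≤ C := by
  refine ⟨3 ^ k * (heatMoment d j 0 * (a ^ ((0 : ℝ) / 4 - j) + b ^ ((0 : ℝ) / 4 - j))
    + heatMoment d j ((2 * k : ℕ) : ℝ)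
      * (a ^ (((2 * k : ℕ) : ℝ) / 4 - j) + b ^ (((2 * k : ℕ) : ℝ) / 4 - j))),
    fun τ h1 h2 => ?_⟩
  have hτ : 0 < τ := ha.trans_le h1
  have i1 := integrable_mul_pnorm_rpow (heatDeriv d j τ) (le_refl (0 : ℝ))
  have i2 := integrable_mul_pnorm_rpow (heatDeriv d j τ) (Nat.cast_nonneg (α := ℝ) (2 * k))
  calc ∫ y, (1 + ‖y‖) ^ k * |heatDeriv d j τ y|
      ≤ ∫ y, 3 ^ k * (|heatDeriv d j τ y| * pnorm y ^ (0 : ℝ)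
          + |heatDeriv d j τ y| * pnorm y ^ ((2 * k : ℕ) : ℝ)) := by
        refine integral_mono (integrable_one_add_norm_pow_mul _ k)
          ((i1.add i2).const_mul _) fun y => ?_
        calc (1 + ‖y‖) ^ k * |heatDeriv d j τ y|
            ≤ 3 ^ k * (pnorm y ^ (0 : ℝ) + pnorm y ^ ((2 * k : ℕ) : ℝ)) * |heatDeriv d j τ y| :=
              mul_le_mul_of_nonneg_right (one_add_norm_pow_le k y) (abs_nonneg _)
          _ = _ := by ring
    _ = 3 ^ k * (heatMoment d j 0 * τ ^ ((0 : ℝ) / 4 - j)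
        + heatMoment d j ((2 * k : ℕ) : ℝ) * τ ^ (((2 * k : ℕ) : ℝ) / 4 - j)) := by
        rw [integral_const_mul, integral_add i1 i2, integral_heatDeriv_pnorm _ _ hτ,
          integral_heatDeriv_pnorm _ _ hτ]
    _ ≤ _ := by
        have := heatMoment_nonneg (d := d) j 0
        have := heatMoment_nonneg (d := d) j ((2 * k : ℕ) : ℝ)
        gcongr <;> exact rpow_le_endpoints ha h1 h2 _

/-- Families of functions that are propagated by the heat semigroup. -/
structure IsCaloric (v : ℝ → Spacetime d → ℝ) : Prop where
  polyBdd : ∀ s, 0 < s → PolyBdd (v s)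
  propagate : ∀ t s, 0 < t → 0 < s → ∀ x, v (t + s) x = sconv (heatDeriv d 0 t) (v s) x

lemma isCaloric_apply_heatAt (Λ : TempDist d) : IsCaloric fun s y => Λ (heatAt s y) :=
  ⟨fun s _ => polyBdd_apply_heatAt Λ s, fun _ _ ht hs x => apply_heatAt_add Λ ht hs x⟩

lemma sconv_heatDeriv_sconv (i j : ℕ) {r t : ℝ} (hr : 0 < r) (ht : 0 < t)
    {v : Spacetime d → ℝ} (hv : PolyBdd v) (x : Spacetime d) :
    sconv (heatDeriv d i r) (sconv (heatDeriv d j t) v) x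
      = sconv (heatDeriv d (i + j) (r + t)) v x := by
  rw [sconv_sconv hv, conv_heatDeriv i j hr ht]

lemma IsCaloric.sconv_heatDeriv {v : ℝ → Spacetime d → ℝ} (hv : IsCaloric v) (j : ℕ)
    {r t s : ℝ} (hr : 0 < r) (ht : 0 < t) (hs : 0 < s) (x : Spacetime d) :
    sconv (heatDeriv d j (r + t)) (v s) x = sconv (heatDeriv d j r) (v (t + s)) x := by
  have h : v (t + s) = sconv (heatDeriv d 0 t) (v s) := funext (hv.propagate t s ht hs)
  rw [h, sconv_heatDeriv_sconv j 0 hr ht (hv.polyBdd s hs), add_zero]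

lemma measurable_heatDeriv_comp {X : Type*} [MeasurableSpace X] (j : ℕ) {τ : X → ℝ}
    (hτ : Measurable τ) {x : X → Spacetime d} (hx : Measurable x) :
    Measurable fun p => heatDeriv d j (τ p) (x p) :=
  (measurable_heatDeriv j).comp (hτ.prodMk hx)

lemma integrable_taylor_prod (n : ℕ) {t : ℝ} (ht : 0 < t) {v : Spacetime d → ℝ}
    (hv : PolyBdd v) (x : Spacetime d) :
    Integrable (fun p : ℝ × Spacetime d =>
      taylorWeight n p.1 * heatDeriv d (n + 1) (t + p.1) (x - p.2) * v p.2)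
      ((volume.restrict (Set.Ioc (0 : ℝ) 1)).prod volume) := by
  obtain ⟨hvm, C, k, hC⟩ := hv
  have hC0 : 0 ≤ C := by simpa using (abs_nonneg _).trans (hC 0)
  obtain ⟨D, hD⟩ := exists_integral_heatDeriv_poly_le (d := d) (n + 1) k (b := t + 1) ht
  have hmeas : AEStronglyMeasurable (fun p : ℝ × Spacetime d =>
      taylorWeight n p.1 * heatDeriv d (n + 1) (t + p.1) (x - p.2) * v p.2)
      ((volume.restrict (Set.Ioc (0 : ℝ) 1)).prod volume) := by
    have hw : Measurable fun p : ℝ × Spacetime d => taylorWeight n p.1 :=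
      (continuous_taylorWeight n).measurable.comp measurable_fst
    have hk : Measurable fun p : ℝ × Spacetime d => heatDeriv d (n + 1) (t + p.1) (x - p.2) :=
      measurable_heatDeriv_comp (n + 1) (measurable_const.add measurable_fst)
        (measurable_const.sub measurable_snd)
    exact ((hw.mul hk).mul (hvm.comp measurable_snd)).aestronglyMeasurable
  rw [integrable_prod_iff hmeas]
  refine ⟨Filter.Eventually.of_forall fun s => ?_, ?_⟩
  · have := (PolyBdd.integrable_sconv ⟨hvm, C, k, hC⟩ (heatDeriv d (n + 1) (t + s)) x).const_mul
      (taylorWeight n s)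
    simpa only [mul_assoc] using this
  · refine Integrable.of_bound hmeas.norm.integral_prod_right' (C * (1 + ‖x‖) ^ k * D) ?_
    filter_upwards [ae_restrict_mem measurableSet_Ioc] with s hs
    have hw : |taylorWeight n s| ≤ 1 :=
      (abs_taylorWeight_le n hs.1.le).trans (pow_le_one₀ hs.1.le hs.2)
    rw [Real.norm_of_nonneg (integral_nonneg fun y => norm_nonneg _)]
    have i1 := (integrable_one_add_norm_pow_mul (heatDeriv d (n + 1) (t + s)) k).comp_sub_left x
    calc ∫ y, ‖taylorWeight n s * heatDeriv d (n + 1) (t + s) (x - y) * v y‖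
        ≤ ∫ y, C * (1 + ‖x‖) ^ k *
          ((1 + ‖x - y‖) ^ k * |heatDeriv d (n + 1) (t + s) (x - y)|) := by
          refine integral_mono_of_nonneg (Filter.Eventually.of_forall fun y => norm_nonneg _)
            (i1.const_mul _) (Filter.Eventually.of_forall fun y => ?_)
          have hy : 1 + ‖y‖ ≤ (1 + ‖x‖) * (1 + ‖x - y‖) := by
            have h4 : ‖y‖ ≤ ‖x‖ + ‖x - y‖ := by
              calc ‖y‖ = ‖x - (x - y)‖ := by rw [sub_sub_cancel]
                _ ≤ _ := norm_sub_le _ _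
            nlinarith [mul_nonneg (norm_nonneg x) (norm_nonneg (x - y))]
          simp only [norm_mul, Real.norm_eq_abs]
          calc |taylorWeight n s| * |heatDeriv d (n + 1) (t + s) (x - y)| * |v y|
              ≤ 1 * |heatDeriv d (n + 1) (t + s) (x - y)|
                * (C * ((1 + ‖x‖) * (1 + ‖x - y‖)) ^ k) := by
                gcongr
                exact (hC y).trans (by gcongr)
            _ = _ := by rw [mul_pow]; ring
      _ = C * (1 + ‖x‖) ^ k * ∫ y, (1 + ‖y‖) ^ k * |heatDeriv d (n + 1) (t + s) y| := by
          rw [integral_const_mul, integral_sub_left_eq_self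
            (fun y => (1 + ‖y‖) ^ k * |heatDeriv d (n + 1) (t + s) y|) volume x]
      _ ≤ _ := by
          gcongr
          exact hD _ (by linarith [hs.1]) (by linarith [hs.2])

/-- Taylor expansion of a caloric family, with integral remainder. -/
lemma IsCaloric.taylor {v : ℝ → Spacetime d → ℝ} (hv : IsCaloric v) (n : ℕ) {t : ℝ}
    (ht : 0 < t) (x : Spacetime d) :
    IntegrableOn (fun s => taylorWeight n s * sconv (heatDeriv d (n + 1) t) (v s) x)
      (Set.Ioc 0 1) ∧
    v t x = ∑ j ∈ Finset.range (n + 1), taylorCoeff j * sconv (heatDeriv d j t) (v 1) x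
      - ∫ s in Set.Ioc (0 : ℝ) 1,
          taylorWeight n s * sconv (heatDeriv d (n + 1) t) (v s) x := by
  -- Half of the time is left in v. The kernels then run at times t/2 + s, bounded away from zero,
  -- against the fixed function v_{t/2}, so Fubini needs no bound on v_s as s tends to 0. Afterwards
  -- `hswap` moves the time s from the kernel back to v.
  have ht2 : 0 < t / 2 := half_pos ht
  have hv2 := hv.polyBdd _ ht2
  have hprod := integrable_taylor_prod n ht2 hv2 x
  have hswap (j : ℕ) {s : ℝ} (hs : 0 < s) :
      sconv (heatDeriv d j (t / 2 + s)) (v (t / 2)) x = sconv (heatDeriv d j t) (v s) x := by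
    rw [hv.sconv_heatDeriv j ht2 hs ht2, add_comm s, ← hv.sconv_heatDeriv j ht2 ht2 hs,
      add_halves]
  have hinner (s : ℝ) : ∫ y, taylorWeight n s * heatDeriv d (n + 1) (t / 2 + s) (x - y)
      * v (t / 2) y = taylorWeight n s * sconv (heatDeriv d (n + 1) (t / 2 + s)) (v (t / 2)) x := by
    simp only [mul_assoc, sconv, integral_const_mul]
  have hcongr : ∀ s ∈ Set.Ioc (0 : ℝ) 1,
      taylorWeight n s * sconv (heatDeriv d (n + 1) (t / 2 + s)) (v (t / 2)) x
        = taylorWeight n s * sconv (heatDeriv d (n + 1) t) (v s) x := fun s hs => by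
    rw [hswap _ hs.1]
  have hint : IntegrableOn
      (fun s => taylorWeight n s * sconv (heatDeriv d (n + 1) (t / 2 + s)) (v (t / 2)) x)
      (Set.Ioc 0 1) := by
    have := hprod.integral_prod_left
    simp only [hinner] at this
    exact this
  refine ⟨hint.congr_fun hcongr measurableSet_Ioc, ?_⟩
  have hvt : v t x = ∫ y, heatDeriv d 0 (t / 2) (x - y) * v (t / 2) y := by
    have := hv.propagate (t / 2) (t / 2) ht2 ht2 x
    rwa [add_halves] at this
  have hexp (y : Spacetime d) : heatDeriv d 0 (t / 2) (x - y) * v (t / 2) y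
      = ∑ j ∈ Finset.range (n + 1),
          taylorCoeff j * (heatDeriv d j (t / 2 + 1) (x - y) * v (t / 2) y)
        - ∫ s in Set.Ioc (0 : ℝ) 1,
          taylorWeight n s * heatDeriv d (n + 1) (t / 2 + s) (x - y) * v (t / 2) y := by
    rw [heatDeriv_taylor n ht2, sub_mul, Finset.sum_mul, integral_mul_const]
    simp only [mul_assoc]
  have hsum (j : ℕ) : Integrable fun y =>
      taylorCoeff j * (heatDeriv d j (t / 2 + 1) (x - y) * v (t / 2) y) :=
    (hv2.integrable_sconv _ x).const_mul _
  rw [hvt]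
  simp only [hexp]
  rw [integral_sub (integrable_finsetSum _ fun j _ => hsum j) hprod.integral_prod_right,
    integral_finsetSum _ fun j _ => hsum j]
  congr 1
  · refine Finset.sum_congr rfl fun j _ => ?_
    rw [integral_const_mul, ← hswap j one_pos, sconv]
  · rw [integral_integral_swap (f := fun y s => taylorWeight n s
      * heatDeriv d (n + 1) (t / 2 + s) (x - y) * v (t / 2) y) hprod.swap]
    simp only [hinner]
    exact setIntegral_congr_fun measurableSet_Ioc hcongr

/-! ### The distribution defined by a family of functions -/

/-- The bounded measurable functions. -/
def boundedMeasurable (d : ℕ) : Submodule ℝ (Spacetime d → ℝ) where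
  carrier := {h | Measurable h ∧ ∃ C : ℝ, ∀ y, |h y| ≤ C}
  add_mem' := by
    rintro a b ⟨ha, C, hC⟩ ⟨hb, D, hD⟩
    exact ⟨ha.add hb, C + D, fun y => (abs_add_le _ _).trans (add_le_add (hC y) (hD y))⟩
  zero_mem' := ⟨measurable_const, 0, fun y => by simp⟩
  smul_mem' := by
    rintro c a ⟨ha, C, hC⟩
    refine ⟨ha.const_smul c, |c| * C, fun y => ?_⟩
    rw [Pi.smul_apply, smul_eq_mul, abs_mul]
    exact mul_le_mul_of_nonneg_left (hC y) (abs_nonneg c)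

lemma integrable_of_mem_boundedMeasurable {h : Spacetime d → ℝ} (hh : h ∈ boundedMeasurable d)
    (φ : 𝓢(Spacetime d, ℝ)) : Integrable fun y => φ y * h y := by
  obtain ⟨hm, C, hC⟩ := hh
  exact (PolyBdd.of_bounded hm hC).integrable_mul φ

/-- Integration against a bounded measurable function. -/
def distOf (h : boundedMeasurable d) : TempDist d where
  toFun φ := ∫ y, φ y * h.1 y
  map_add' φ χ := by
    simp only [add_apply, add_mul]
    exact integral_add (integrable_of_mem_boundedMeasurable h.2 φ)
      (integrable_of_mem_boundedMeasurable h.2 χ)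
  map_smul' c φ := by
    simp only [smul_apply, smul_eq_mul, mul_assoc, integral_const_mul, RingHom.id_apply]
  cont := by
    obtain ⟨-, C, hC⟩ := h.2
    let A : 𝓢(Spacetime d, ℝ) →ₗ[ℝ] ℝ :=
      { toFun := fun φ => ∫ y, φ y * h.1 y
        map_add' := fun φ χ => by
          simp only [add_apply, add_mul]
          exact integral_add (integrable_of_mem_boundedMeasurable h.2 φ)
            (integrable_of_mem_boundedMeasurable h.2 χ)
        map_smul' := fun c φ => by
          simp only [smul_apply, smul_eq_mul, mul_assoc, integral_const_mul, RingHom.id_apply] }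
    -- Continuity on Schwartz functions is inherited from L¹, since the functional is bounded by C
    -- times the L¹ norm.
    obtain ⟨L, hL⟩ := exists_extension_of_bound
      (SchwartzMap.toLpCLM ℝ ℝ 1 (volume : Measure (Spacetime d))).toLinearMap A C fun φ => by
        have h1 : ‖SchwartzMap.toLpCLM ℝ ℝ 1 (volume : Measure (Spacetime d)) φ‖
            = ∫ y, ‖φ y‖ := SchwartzMap.norm_toLp_one
        change |∫ y, φ y * h.1 y| ≤ C * ‖SchwartzMap.toLpCLM ℝ ℝ 1 volume φ‖
        rw [h1, ← integral_const_mul]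
        refine abs_integral_le_of_abs_le
          ((φ.integrable (μ := volume)).norm.const_mul C) fun y => ?_
        rw [abs_mul, mul_comm]
        exact mul_le_mul_of_nonneg_right (hC y) (abs_nonneg _)
    have : (fun φ : 𝓢(Spacetime d, ℝ) => ∫ y, φ y * h.1 y)
        = fun φ => L (SchwartzMap.toLpCLM ℝ ℝ 1 (volume : Measure (Spacetime d)) φ) :=
      funext fun φ => (hL φ).symm
    change Continuous fun φ : 𝓢(Spacetime d, ℝ) => ∫ y, φ y * h.1 y
    rw [this]
    exact L.continuous.comp (SchwartzMap.toLpCLM ℝ ℝ 1 volume).continuous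

lemma distOf_apply (h : boundedMeasurable d) (φ : 𝓢(Spacetime d, ℝ)) :
    distOf h φ = ∫ y, φ y * h.1 y := rfl

/-- The families of functions `(G_s)`, `0 < s ≤ 1`, that are bounded by a multiple of
`s ^ (α / 4)`. -/
def familySpace (d : ℕ) (α : ℝ) : Submodule ℝ (ℝ → Spacetime d → ℝ) where
  carrier := {G | Measurable (Function.uncurry G) ∧
    ∃ C : ℝ, ∀ s, 0 < s → s ≤ 1 → ∀ y, |G s y| ≤ C * s ^ (α / 4)}
  add_mem' := by
    rintro a b ⟨ha, C, hC⟩ ⟨hb, D, hD⟩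
    refine ⟨ha.add hb, C + D, fun s h0 h1 y => (abs_add_le _ _).trans ?_⟩
    rw [add_mul]
    exact add_le_add (hC s h0 h1 y) (hD s h0 h1 y)
  zero_mem' := ⟨measurable_const, 0, fun s _ _ y => by simp⟩
  smul_mem' := by
    rintro c a ⟨ha, C, hC⟩
    refine ⟨ha.const_smul c, |c| * C, fun s h0 h1 y => ?_⟩
    rw [Pi.smul_apply, Pi.smul_apply, smul_eq_mul, abs_mul, mul_assoc]
    exact mul_le_mul_of_nonneg_left (hC s h0 h1 y) (abs_nonneg c)

lemma measurable_slice {G : ℝ → Spacetime d → ℝ} (hG : Measurable (Function.uncurry G)) (s : ℝ) :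
    Measurable (G s) := hG.comp measurable_prodMk_left

section Family

variable {α : ℝ} {n : ℕ}

/-- The order n of the expansion is chosen so that the weight, of size at most s^n, absorbs the
singularity s^(α/4) of the family at s = 0. -/
lemma abs_weight_mul_le (hn : 0 ≤ n + α / 4) {G : ℝ → Spacetime d → ℝ} {C : ℝ}
    (hC : ∀ s, 0 < s → s ≤ 1 → ∀ y, |G s y| ≤ C * s ^ (α / 4)) {s : ℝ}
    (hs : s ∈ Set.Ioc (0 : ℝ) 1) (y : Spacetime d) : |taylorWeight n s * G s y| ≤ |C| := by
  have h1 : s ^ n * s ^ (α / 4) ≤ 1 := by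
    rw [← Real.rpow_natCast, ← Real.rpow_add hs.1]
    exact Real.rpow_le_one hs.1.le hs.2 hn
  have h0 : 0 ≤ s ^ (α / 4) := Real.rpow_nonneg hs.1.le _
  rw [abs_mul]
  calc |taylorWeight n s| * |G s y| ≤ s ^ n * (|C| * s ^ (α / 4)) := by
        refine mul_le_mul (abs_taylorWeight_le n hs.1.le) ((hC s hs.1 hs.2 y).trans ?_)
          (abs_nonneg _) (pow_nonneg hs.1.le n)
        exact mul_le_mul_of_nonneg_right (le_abs_self C) h0
    _ = |C| * (s ^ n * s ^ (α / 4)) := by ring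
    _ ≤ |C| := mul_le_of_le_one_right (abs_nonneg C) h1

lemma integrable_weight_mul (hn : 0 ≤ n + α / 4) (G : familySpace d α) (y : Spacetime d) :
    IntegrableOn (fun s => taylorWeight n s * G.1 s y) (Set.Ioc 0 1) := by
  obtain ⟨hm, C, hC⟩ := G.2
  refine Integrable.of_bound (Measurable.aestronglyMeasurable ?_) |C| ?_
  · exact (continuous_taylorWeight n).measurable.mul (hm.comp measurable_prodMk_right)
  · filter_upwards [ae_restrict_mem measurableSet_Ioc] with s hs
    exact abs_weight_mul_le hn hC hs y

/-- The value at time `1` of a family. -/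
def familyAtOne (α : ℝ) : familySpace d α →ₗ[ℝ] boundedMeasurable d where
  toFun G := ⟨G.1 1, measurable_slice G.2.1 1, by
    obtain ⟨-, C, hC⟩ := G.2
    exact ⟨C, fun y => by simpa using hC 1 one_pos le_rfl y⟩⟩
  map_add' _ _ := rfl
  map_smul' _ _ := rfl

/-- The weighted integral in time of a family. -/
def familyIntegral (hn : 0 ≤ n + α / 4) : familySpace d α →ₗ[ℝ] boundedMeasurable d where
  toFun G := ⟨fun y => ∫ s in Set.Ioc (0 : ℝ) 1, taylorWeight n s * G.1 s y, by
    obtain ⟨hm, C, hC⟩ := G.2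
    refine ⟨?_, |C|, fun y => ?_⟩
    · have h : StronglyMeasurable fun q : Spacetime d × ℝ => taylorWeight n q.2 * G.1 q.2 q.1 :=
        (((continuous_taylorWeight n).measurable.comp measurable_snd).mul
          (hm.comp measurable_swap)).stronglyMeasurable
      exact (h.integral_prod_right' (ν := volume.restrict (Set.Ioc (0 : ℝ) 1))).measurable
    · have := norm_setIntegral_le_of_norm_le_const (μ := volume) (s := Set.Ioc (0 : ℝ) 1)
        (f := fun s => taylorWeight n s * G.1 s y) (C := |C|) (by simp)
        fun s hs => abs_weight_mul_le hn hC hs y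
      simpa using this⟩
  map_add' G G' := by
    ext y
    change ∫ s in Set.Ioc (0 : ℝ) 1, taylorWeight n s * (G.1 s y + G'.1 s y) = _
    simp only [mul_add]
    exact integral_add (integrable_weight_mul hn G y) (integrable_weight_mul hn G' y)
  map_smul' c G := by
    ext y
    change ∫ s in Set.Ioc (0 : ℝ) 1, taylorWeight n s * (c * G.1 s y)
      = c * ∫ s in Set.Ioc (0 : ℝ) 1, taylorWeight n s * G.1 s y
    rw [← integral_const_mul]
    exact integral_congr_ae (Filter.Eventually.of_forall fun s => by ring)

/-- The distribution whose Taylor expansion in time is given by a family of functions. -/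
def familyDist (hn : 0 ≤ n + α / 4) : familySpace d α →ₗ[ℝ] TempDist d where
  toFun G := ∑ j ∈ Finset.range (n + 1), taylorCoeff j • (distOf (familyAtOne α G) ∘L (opG d ^ j))
    - distOf (familyIntegral hn G) ∘L (opG d ^ (n + 1))
  map_add' G G' := by
    have hd (h h' : boundedMeasurable d) : distOf (h + h') = distOf h + distOf h' := by
      ext φ
      rw [add_apply, distOf_apply, distOf_apply, distOf_apply,
        ← integral_add (integrable_of_mem_boundedMeasurable h.2 φ)
          (integrable_of_mem_boundedMeasurable h'.2 φ)]
      exact integral_congr_ae (Filter.Eventually.of_forall fun y => mul_add _ _ _)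
    rw [map_add, map_add, hd, hd]
    simp only [ContinuousLinearMap.add_comp, smul_add, Finset.sum_add_distrib]
    abel
  map_smul' c G := by
    have hd (h : boundedMeasurable d) : distOf (c • h) = c • distOf h := by
      ext φ
      rw [smul_apply, distOf_apply, distOf_apply, smul_eq_mul, ← integral_const_mul]
      refine integral_congr_ae (Filter.Eventually.of_forall fun y => ?_)
      change φ y * (c * h.1 y) = c * (φ y * h.1 y)
      ring
    rw [map_smul, map_smul, hd, hd]
    simp only [ContinuousLinearMap.smul_comp, RingHom.id_apply, smul_sub, Finset.smul_sum,
      smul_comm c]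

lemma integral_translate_heatDeriv_mul (j : ℕ) (t : ℝ) (x : Spacetime d) (h : Spacetime d → ℝ) :
    ∫ y, translate x (heatDeriv d j t) y * h y = sconv (heatDeriv d j t) h x := by
  simp only [translate_apply, sconv, heatDeriv_sub_comm j t x]

/-- The powers of 𝒢 in the definition fall on p_t(x,·) and the time integral comes out by Fubini.
The result is the right side of Taylor's formula, with G not required to be caloric. -/
lemma familyDist_heatAt (hn : 0 ≤ n + α / 4) (G : familySpace d α) (t : ℝ) (x : Spacetime d) :
    IntegrableOn (fun s => taylorWeight n s * sconv (heatDeriv d (n + 1) t) (G.1 s) x)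
      (Set.Ioc 0 1) ∧
    familyDist hn G (heatAt t x)
      = ∑ j ∈ Finset.range (n + 1), taylorCoeff j * sconv (heatDeriv d j t) (G.1 1) x
        - ∫ s in Set.Ioc (0 : ℝ) 1,
            taylorWeight n s * sconv (heatDeriv d (n + 1) t) (G.1 s) x := by
  obtain ⟨hm, C, hC⟩ := G.2
  have hprod : Integrable (fun p : ℝ × Spacetime d =>
      heatDeriv d (n + 1) t (x - p.2) * (taylorWeight n p.1 * G.1 p.1 p.2))
      ((volume.restrict (Set.Ioc (0 : ℝ) 1)).prod volume) := by
    have h1 : Integrable (fun p : ℝ × Spacetime d => |C| * |heatDeriv d (n + 1) t (x - p.2)|)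
        ((volume.restrict (Set.Ioc (0 : ℝ) 1)).prod volume) := by
      have h2 : Integrable fun y => |heatDeriv d (n + 1) t (x - y)| :=
        ((heatDeriv d (n + 1) t).integrable (μ := volume)).norm.comp_sub_left x
      exact (h2.comp_snd _).const_mul _
    refine h1.mono' (Measurable.aestronglyMeasurable ?_) ?_
    · refine Measurable.mul ?_ (Measurable.mul ?_ hm)
      · exact (heatDeriv d (n + 1) t).continuous.measurable.comp
          (measurable_const.sub measurable_snd)
      · exact (continuous_taylorWeight n).measurable.comp measurable_fst
    · have hmem : ∀ᵐ p : ℝ × Spacetime d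
          ∂((volume.restrict (Set.Ioc (0 : ℝ) 1)).prod volume), p.1 ∈ Set.Ioc (0 : ℝ) 1 :=
        Measure.quasiMeasurePreserving_fst.ae (ae_restrict_mem measurableSet_Ioc)
      filter_upwards [hmem] with p hp
      rw [Real.norm_eq_abs, abs_mul, mul_comm]
      exact mul_le_mul_of_nonneg_right (abs_weight_mul_le hn hC hp p.2) (abs_nonneg _)
  have hinner (s : ℝ) : ∫ y, heatDeriv d (n + 1) t (x - y) * (taylorWeight n s * G.1 s y)
      = taylorWeight n s * sconv (heatDeriv d (n + 1) t) (G.1 s) x :=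
    sconv_const_mul (taylorWeight n s) (G.1 s) (heatDeriv d (n + 1) t) x
  have hint := hprod.integral_prod_left
  simp only [hinner] at hint
  refine ⟨hint, ?_⟩
  have hval : familyDist hn G (heatAt t x)
      = ∑ j ∈ Finset.range (n + 1), taylorCoeff j *
          distOf (familyAtOne α G) ((opG d ^ j) (heatAt t x))
        - distOf (familyIntegral hn G) ((opG d ^ (n + 1)) (heatAt t x)) := by
    change (∑ j ∈ Finset.range (n + 1),
      taylorCoeff j • (distOf (familyAtOne α G) ∘L (opG d ^ j))
        - distOf (familyIntegral hn G) ∘L (opG d ^ (n + 1))) (heatAt t x) = _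
    simp only [sub_apply, sum_apply, smul_apply, smul_eq_mul, ContinuousLinearMap.comp_apply]
  rw [hval]
  simp only [opG_pow_heatAt, distOf_apply, integral_translate_heatDeriv_mul]
  congr 1
  change ∫ y, heatDeriv d (n + 1) t (x - y)
    * ∫ s in Set.Ioc (0 : ℝ) 1, taylorWeight n s * G.1 s y = _
  simp only [← integral_const_mul]
  rw [integral_integral_swap (f := fun y s => heatDeriv d (n + 1) t (x - y)
    * (taylorWeight n s * G.1 s y)) hprod.swap]
  simp only [hinner]

lemma familyDist_heatAt_of_isCaloric (hn : 0 ≤ n + α / 4) (G : familySpace d α)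
    (hG : IsCaloric G.1) {t : ℝ} (ht : 0 < t) (x : Spacetime d) :
    familyDist hn G (heatAt t x) = G.1 t x := by
  rw [(familyDist_heatAt hn G t x).2, (hG.taylor n ht x).2]

end Family

/-! ### Reconstruction of coherent germs -/

section Germ

variable {ι : Type*} [Fintype ι]

/-- The values `⟨Λ_y, p_s(y, ·)⟩` of a germ of distributions. -/
def germVal (Λ : Spacetime d → TempDist d) (s : ℝ) (y : Spacetime d) : ℝ := Λ y (heatAt s y)

/-- A coherent germ of distributions, with exponents `β`, `γ`, `α` and constants `A`, `B`. -/
structure IsGerm (β : ι → ℝ) (γ α A B : ℝ) (Λ : Spacetime d → TempDist d) : Prop where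
  measurable : Measurable (Function.uncurry (germVal Λ))
  coherent : ∀ s, 0 < s → s ≤ 1 → ∀ x y,
    |(Λ y - Λ x) (heatAt s y)| ≤ A * ∑ i, s ^ (β i / 4) * pdist y x ^ (γ - β i)
  bounded : ∀ s, 0 < s → s ≤ 1 → ∀ y, |germVal Λ s y| ≤ B * s ^ (α / 4)

/-- The space of coherent germs. -/
def germSpace (d : ℕ) (β : ι → ℝ) (γ α : ℝ) : Submodule ℝ (Spacetime d → TempDist d) where
  carrier := {Λ | ∃ A B : ℝ, IsGerm β γ α A B Λ}
  add_mem' := by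
    rintro Λ Λ' ⟨A, B, h⟩ ⟨A', B', h'⟩
    refine ⟨A + A', B + B', h.measurable.add h'.measurable, fun s h0 h1 x y => ?_,
      fun s h0 h1 y => ?_⟩
    · have e : ((Λ + Λ') y - (Λ + Λ') x) (heatAt s y)
          = (Λ y - Λ x) (heatAt s y) + (Λ' y - Λ' x) (heatAt s y) := by
        simp only [Pi.add_apply, sub_apply, add_apply]
        ring
      rw [e, add_mul]
      exact (abs_add_le _ _).trans (add_le_add (h.coherent s h0 h1 x y) (h'.coherent s h0 h1 x y))
    · have e : germVal (Λ + Λ') s y = germVal Λ s y + germVal Λ' s y := rfl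
      rw [e, add_mul]
      exact (abs_add_le _ _).trans (add_le_add (h.bounded s h0 h1 y) (h'.bounded s h0 h1 y))
  zero_mem' := ⟨0, 0, measurable_const, fun s _ _ x y => by simp, fun s _ _ y => by simp [germVal]⟩
  smul_mem' := by
    rintro c Λ ⟨A, B, h⟩
    refine ⟨|c| * A, |c| * B, h.measurable.const_smul c, fun s h0 h1 x y => ?_,
      fun s h0 h1 y => ?_⟩
    · have e : ((c • Λ) y - (c • Λ) x) (heatAt s y) = c * (Λ y - Λ x) (heatAt s y) := by
        simp only [Pi.smul_apply, sub_apply, smul_apply, smul_eq_mul]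
        ring
      rw [e, abs_mul, mul_assoc]
      exact mul_le_mul_of_nonneg_left (h.coherent s h0 h1 x y) (abs_nonneg c)
    · have e : germVal (c • Λ) s y = c * germVal Λ s y := rfl
      rw [e, abs_mul, mul_assoc]
      exact mul_le_mul_of_nonneg_left (h.bounded s h0 h1 y) (abs_nonneg c)

variable {β : ι → ℝ} {γ α A B : ℝ} {Λ : Spacetime d → TempDist d}

lemma IsGerm.measurable_germVal (h : IsGerm β γ α A B Λ) (s : ℝ) : Measurable (germVal Λ s) :=
  measurable_slice h.measurable s

lemma IsGerm.polyBdd (h : IsGerm β γ α A B Λ) {s : ℝ} (h0 : 0 < s) (h1 : s ≤ 1) :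
    PolyBdd (germVal Λ s) :=
  PolyBdd.of_bounded (h.measurable_germVal s) (h.bounded s h0 h1)

lemma integral_abs_heatDeriv (j : ℕ) {t : ℝ} (ht : 0 < t) :
    ∫ y, |heatDeriv d j t y| = heatMoment d j 0 * t ^ (-(j : ℝ)) := by
  have h := integral_heatDeriv_pnorm (d := d) j 0 ht
  simpa using h

/-- The main estimate on coherent germs. -/
lemma IsGerm.abs_sconv_sub_le (h : IsGerm β γ α A B Λ) (hβ : ∀ i, β i < γ) (j : ℕ) {r s : ℝ}
    (hr : 0 < r) (h0 : 0 < s) (h1 : s ≤ 1) (x : Spacetime d) :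
    |sconv (heatDeriv d j r) (fun y => germVal Λ s y - Λ x (heatAt s y)) x|
      ≤ A * ∑ i, heatMoment d j (γ - β i) * (s ^ (β i / 4) * r ^ ((γ - β i) / 4 - j)) := by
  have hint (i : ι) : Integrable fun y =>
      s ^ (β i / 4) * (|heatDeriv d j r (x - y)| * pnorm (x - y) ^ (γ - β i)) :=
    ((integrable_mul_pnorm_rpow (heatDeriv d j r)
      (sub_nonneg.2 (hβ i).le)).comp_sub_left x).const_mul _
  calc |sconv (heatDeriv d j r) (fun y => germVal Λ s y - Λ x (heatAt s y)) x|
      ≤ ∫ y, A * ∑ i, s ^ (β i / 4) *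
          (|heatDeriv d j r (x - y)| * pnorm (x - y) ^ (γ - β i)) := by
        refine abs_integral_le_of_abs_le
          ((integrable_finsetSum _ fun i _ => hint i).const_mul A) fun y => ?_
        have hc := h.coherent s h0 h1 x y
        rw [abs_mul]
        calc |heatDeriv d j r (x - y)| * |germVal Λ s y - Λ x (heatAt s y)|
            ≤ |heatDeriv d j r (x - y)| *
              (A * ∑ i, s ^ (β i / 4) * pdist y x ^ (γ - β i)) := by
              gcongr
              exact hc
          _ = _ := by
              rw [pdist_eq, ← neg_sub, pnorm_neg, mul_left_comm, Finset.mul_sum]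
              congr 1
              exact Finset.sum_congr rfl fun i _ => by ring
    _ = _ := by
        rw [integral_const_mul, integral_finsetSum _ fun i _ => hint i]
        congr 1
        refine Finset.sum_congr rfl fun i _ => ?_
        rw [integral_const_mul, integral_sub_left_eq_self
          (fun y => |heatDeriv d j r y| * pnorm y ^ (γ - β i)) volume x,
          integral_heatDeriv_pnorm _ _ hr]
        ring

/-! #### Positive exponent -/

/-- The dyadic times `2⁻ⁿ`. -/
def dyadic (n : ℕ) : ℝ := (1 / 2) ^ n

lemma dyadic_pos (n : ℕ) : 0 < dyadic n := by unfold dyadic; positivity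

lemma dyadic_le_one (n : ℕ) : dyadic n ≤ 1 := pow_le_one₀ (by norm_num) (by norm_num)

lemma dyadic_succ (n : ℕ) : dyadic (n + 1) + dyadic (n + 1) = dyadic n := by
  unfold dyadic; ring

lemma dyadic_antitone : Antitone dyadic :=
  pow_right_anti₀ (by norm_num) (by norm_num)

/-- The approximations `p_{s - 2⁻ⁿ} ⋆ F_{2⁻ⁿ}`. -/
def approx (Λ : Spacetime d → TempDist d) (n : ℕ) (s : ℝ) (x : Spacetime d) : ℝ :=
  sconv (heatDeriv d 0 (s - dyadic n)) (germVal Λ (dyadic n)) x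

/-- The limit of the approximations. -/
def approxLim (Λ : Spacetime d → TempDist d) (s : ℝ) (x : Spacetime d) : ℝ :=
  Filter.limUnder Filter.atTop fun n => approx Λ n s x

/-- The constant of one step of the approximation. -/
def stepConst (d : ℕ) (β : ι → ℝ) (γ : ℝ) : ℝ :=
  heatMoment d 0 0 * ∑ i, heatMoment d 0 (γ - β i)

lemma stepConst_nonneg : 0 ≤ stepConst d β γ :=
  mul_nonneg (heatMoment_nonneg _ _) (Finset.sum_nonneg fun _ _ => heatMoment_nonneg _ _)

lemma IsGerm.abs_approx_sub_le (h : IsGerm β γ α A B Λ) (hβ : ∀ i, β i < γ) {n : ℕ} {s : ℝ}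
    (hs : dyadic n < s) (x : Spacetime d) :
    |approx Λ n s x - approx Λ (n + 1) s x|
      ≤ stepConst d β γ * A * dyadic (n + 1) ^ (γ / 4) := by
  set ε := dyadic (n + 1) with hε
  have hε0 : 0 < ε := dyadic_pos _
  have hε1 : ε ≤ 1 := dyadic_le_one _
  have hεε : ε + ε = dyadic n := dyadic_succ n
  have hF := h.polyBdd hε0 hε1
  -- With ε = 2^(-n-1), the difference of consecutive approximations is p_{s-2ε} applied to F_{2ε} -
  -- p_ε ⋆ F_ε. In `hstep` the distribution is frozen at y, so F_{2ε}(y) becomes p_ε ⋆ ⟨Λ_y, p_ε⟩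
  -- and the main estimate applies at r = s = ε; the powers combine to ε^(γ/4) for every i.
  have hF2 := h.polyBdd (dyadic_pos n) (dyadic_le_one n)
  have hstep (y : Spacetime d) :
      |germVal Λ (dyadic n) y - sconv (heatDeriv d 0 ε) (germVal Λ ε) y|
        ≤ A * (∑ i, heatMoment d 0 (γ - β i)) * ε ^ (γ / 4) := by
    have e1 : germVal Λ (dyadic n) y = sconv (heatDeriv d 0 ε) (fun z => Λ y (heatAt ε z)) y := by
      rw [← apply_heatAt_add (Λ y) hε0 hε0, hεε]
      rfl
    rw [e1, abs_sub_comm, ← sconv_sub hF (polyBdd_apply_heatAt (Λ y) ε)]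
    refine (h.abs_sconv_sub_le hβ 0 hε0 hε0 hε1 y).trans (le_of_eq ?_)
    rw [mul_assoc, Finset.sum_mul]
    congr 1
    refine Finset.sum_congr rfl fun i _ => ?_
    rw [← Real.rpow_add hε0]
    congr 2
    push_cast
    ring
  have e2 : approx Λ (n + 1) s x
      = sconv (heatDeriv d 0 (s - dyadic n)) (sconv (heatDeriv d 0 ε) (germVal Λ ε)) x := by
    rw [sconv_heatDeriv_sconv 0 0 (sub_pos.2 hs) hε0 hF, approx]
    congr 2
    rw [← hε, ← hεε]
    ring
  have hG : PolyBdd (sconv (heatDeriv d 0 ε) (germVal Λ ε)) :=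
    PolyBdd.of_bounded (measurable_sconv hF.1 _) (abs_sconv_le (h.bounded ε hε0 hε1) _)
  rw [e2, approx, ← sconv_sub hF2 hG]
  refine (abs_sconv_le hstep _ x).trans (le_of_eq ?_)
  rw [integral_abs_heatDeriv 0 (sub_pos.2 hs), stepConst]
  simp
  ring

lemma approx_of_nonpos (Λ : Spacetime d → TempDist d) (n : ℕ) {s : ℝ} (hs : s ≤ 0)
    (x : Spacetime d) : approx Λ n s x = 0 := by
  rw [approx, heatDeriv_of_nonpos (by linarith [dyadic_pos n])]
  simp [sconv]

/-- The constant of the approximation of the limit. -/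
def limConst (d : ℕ) (β : ι → ℝ) (γ : ℝ) : ℝ :=
  stepConst d β γ / (1 - (1 / 2 : ℝ) ^ (γ / 4))

lemma half_rpow_lt_one (hγ : 0 < γ) : (1 / 2 : ℝ) ^ (γ / 4) < 1 :=
  Real.rpow_lt_one (by norm_num) (by norm_num) (by linarith)

lemma limConst_nonneg (hγ : 0 < γ) : 0 ≤ limConst d β γ :=
  div_nonneg stepConst_nonneg (sub_nonneg.2 (half_rpow_lt_one hγ).le)

lemma dyadic_rpow (n : ℕ) (e : ℝ) : dyadic n ^ e = ((1 / 2 : ℝ) ^ e) ^ n := by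
  rw [dyadic, ← Real.rpow_natCast, ← Real.rpow_natCast, ← Real.rpow_mul (by norm_num),
    ← Real.rpow_mul (by norm_num), mul_comm]

lemma IsGerm.approx_tendsto_of_lt (h : IsGerm β γ α A B Λ) (hβ : ∀ i, β i < γ) (hγ : 0 < γ)
    {n : ℕ} {s : ℝ} (hs : dyadic n < s) (x : Spacetime d) :
    Filter.Tendsto (fun k => approx Λ k s x) Filter.atTop (nhds (approxLim Λ s x)) ∧
      |approx Λ n s x - approxLim Λ s x| ≤ limConst d β γ * A * dyadic n ^ (γ / 4) := by
  set q := (1 / 2 : ℝ) ^ (γ / 4) with hq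
  have hq1 : q < 1 := half_rpow_lt_one hγ
  have hq0 : 0 < q := Real.rpow_pos_of_pos (by norm_num) _
  set M := stepConst d β γ * A * q ^ (n + 1) with hM
  have hstep (k : ℕ) : dist (approx Λ (k + n) s x) (approx Λ (k + 1 + n) s x) ≤ M * q ^ k := by
    have hk : dyadic (k + n) < s := (dyadic_antitone (Nat.le_add_left n k)).trans_lt hs
    have h2 := h.abs_approx_sub_le hβ hk x
    rw [dyadic_rpow, ← hq] at h2
    rw [Real.dist_eq, add_right_comm]
    refine h2.trans (le_of_eq ?_)
    rw [hM, mul_assoc, mul_assoc _ _ (q ^ k), ← pow_add]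
    ring_nf
  have hcauchy : CauchySeq fun k => approx Λ (k + n) s x :=
    cauchySeq_of_le_geometric q M hq1 hstep
  obtain ⟨l, hl⟩ := cauchySeq_tendsto_of_complete hcauchy
  have hl' : Filter.Tendsto (fun k => approx Λ k s x) Filter.atTop (nhds l) :=
    (Filter.tendsto_add_atTop_iff_nat n).1 hl
  have hlim : approxLim Λ s x = l := hl'.limUnder_eq
  rw [hlim]
  refine ⟨hl', ?_⟩
  have h3 := dist_le_of_le_geometric_of_tendsto₀ q M hq1 hstep hl
  rw [zero_add, Real.dist_eq] at h3
  refine h3.trans ?_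
  rw [dyadic_rpow, ← hq, hM, limConst, ← hq, pow_succ]
  -- The sign of A is not assumed; it is recovered in this product from the step bound, whose left
  -- side is nonnegative. It permits dropping one factor q.
  have h4 : 0 ≤ stepConst d β γ * A * q ^ n := by
    have h5 := (abs_nonneg _).trans (h.abs_approx_sub_le hβ hs x)
    rw [dyadic_rpow, ← hq, pow_succ, ← mul_assoc] at h5
    exact nonneg_of_mul_nonneg_left h5 hq0
  rw [div_mul_eq_mul_div, div_mul_eq_mul_div]
  refine div_le_div_of_nonneg_right ?_ (sub_nonneg.2 hq1.le)
  rw [← mul_assoc]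
  exact mul_le_of_le_one_right h4 hq1.le

lemma exists_dyadic_lt {s : ℝ} (hs : 0 < s) : ∃ n, dyadic n < s :=
  exists_pow_lt_of_lt_one hs (by norm_num)

lemma IsGerm.approx_tendsto (h : IsGerm β γ α A B Λ) (hβ : ∀ i, β i < γ) (hγ : 0 < γ)
    (s : ℝ) (x : Spacetime d) :
    Filter.Tendsto (fun k => approx Λ k s x) Filter.atTop (nhds (approxLim Λ s x)) := by
  rcases le_or_gt s 0 with hs | hs
  · have h0 : (fun k => approx Λ k s x) = fun _ => (0 : ℝ) :=
      funext fun k => approx_of_nonpos Λ k hs x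
    have h1 : approxLim Λ s x = 0 := by
      rw [approxLim, h0]
      exact tendsto_const_nhds.limUnder_eq
    rw [h0, h1]
    exact tendsto_const_nhds
  · obtain ⟨n, hn⟩ := exists_dyadic_lt hs
    exact (h.approx_tendsto_of_lt hβ hγ hn x).1

lemma IsGerm.measurable_approxLim (h : IsGerm β γ α A B Λ) (hβ : ∀ i, β i < γ) (hγ : 0 < γ) :
    Measurable (Function.uncurry (approxLim Λ)) := by
  have hm (n : ℕ) : Measurable fun p : ℝ × Spacetime d => approx Λ n p.1 p.2 :=
    measurable_sconv_heatDeriv 0 (measurable_fst.sub_const _) measurable_snd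
      ((h.measurable_germVal (dyadic n)).comp measurable_snd)
  exact measurable_of_tendsto_metrizable hm
    (tendsto_pi_nhds.2 fun p => h.approx_tendsto hβ hγ p.1 p.2)

/-- Once 2⁻ⁿ < s, each approximation satisfies the semigroup identity exactly, and the convergence
is uniform in space, so convolution with p_t passes to the limit. -/
lemma IsGerm.isCaloric_approxLim (h : IsGerm β γ α A B Λ) (hβ : ∀ i, β i < γ) (hγ : 0 < γ) :
    IsCaloric (approxLim Λ) := by
  have hpoly (s : ℝ) (hs : 0 < s) : PolyBdd (approxLim Λ s) := by
    obtain ⟨n, hn⟩ := exists_dyadic_lt hs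
    refine PolyBdd.of_bounded (measurable_slice (h.measurable_approxLim hβ hγ) s)
      (C := B * dyadic n ^ (α / 4) * (∫ y, |heatDeriv d 0 (s - dyadic n) y|)
        + limConst d β γ * A * dyadic n ^ (γ / 4)) fun y => ?_
    have h1 := (h.approx_tendsto_of_lt hβ hγ hn y).2
    have h2 : |approx Λ n s y| ≤ _ :=
      abs_sconv_le (h.bounded _ (dyadic_pos n) (dyadic_le_one n)) _ y
    have h3 := abs_sub_abs_le_abs_sub (approxLim Λ s y) (approx Λ n s y)
    rw [abs_sub_comm] at h3
    linarith
  refine ⟨hpoly, fun t s ht hs x => ?_⟩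
  refine tendsto_nhds_unique (h.approx_tendsto hβ hγ (t + s) x) ?_
  obtain ⟨N, hN⟩ := exists_dyadic_lt hs
  have hclose : ∀ n ≥ N, |approx Λ n (t + s) x - sconv (heatDeriv d 0 t) (approxLim Λ s) x|
      ≤ limConst d β γ * A * dyadic n ^ (γ / 4) * ∫ y, |heatDeriv d 0 t y| := by
    intro n hn
    have hns : dyadic n < s := (dyadic_antitone hn).trans_lt hN
    have hF := h.polyBdd (dyadic_pos n) (dyadic_le_one n)
    have e1 : approx Λ n (t + s) x = sconv (heatDeriv d 0 t) (approx Λ n s) x := by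
      have := sconv_heatDeriv_sconv 0 0 ht (sub_pos.2 hns) hF x
      rw [approx, add_sub_assoc]
      exact this.symm
    have hG : PolyBdd (approx Λ n s) :=
      PolyBdd.of_bounded (measurable_sconv hF.1 _)
        (abs_sconv_le (h.bounded _ (dyadic_pos n) (dyadic_le_one n)) _)
    rw [e1, ← sconv_sub hG (hpoly s hs)]
    exact abs_sconv_le (fun y => (h.approx_tendsto_of_lt hβ hγ hns y).2) _ x
  have hlim : Filter.Tendsto (fun n => limConst d β γ * A * dyadic n ^ (γ / 4)
      * ∫ y, |heatDeriv d 0 t y|) Filter.atTop (nhds 0) := by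
    have h1 : Filter.Tendsto (fun n => dyadic n ^ (γ / 4)) Filter.atTop (nhds 0) := by
      simp only [dyadic_rpow]
      exact tendsto_pow_atTop_nhds_zero_of_lt_one (Real.rpow_nonneg (by norm_num) _)
        (half_rpow_lt_one hγ)
    simpa using (h1.const_mul (limConst d β γ * A)).mul_const (∫ y, |heatDeriv d 0 t y|)
  rw [tendsto_iff_norm_sub_tendsto_zero]
  refine squeeze_zero' (Filter.Eventually.of_forall fun n => norm_nonneg _) ?_ hlim
  filter_upwards [Filter.eventually_ge_atTop N] with n hn
  exact hclose n hn

/-- The constant of the reconstruction bound for positive exponent. -/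
def posConst (d : ℕ) (β : ι → ℝ) (γ : ℝ) : ℝ :=
  limConst d β γ + ∑ i, heatMoment d 0 (γ - β i) * 4 ^ |β i / 4|

lemma rpow_le_of_quarter_le {ε t : ℝ} (ht : 0 < t) (h1 : t / 4 ≤ ε) (h2 : ε ≤ t) (e : ℝ) :
    ε ^ e ≤ 4 ^ |e| * t ^ e := by
  have hε : 0 < ε := by linarith
  rcases le_total 0 e with he | he
  · exact (Real.rpow_le_rpow hε.le h2 he).trans (le_mul_of_one_le_left (Real.rpow_nonneg ht.le e)
      (Real.one_le_rpow (by norm_num) (abs_nonneg e)))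
  · refine (Real.rpow_le_rpow_of_nonpos (by positivity) h1 he).trans (le_of_eq ?_)
    rw [Real.div_rpow ht.le (by norm_num), abs_of_nonpos he, Real.rpow_neg (by norm_num)]
    ring

lemma IsGerm.abs_approxLim_sub_le (h : IsGerm β γ α A B Λ) (hA : 0 ≤ A) (hβ : ∀ i, β i < γ)
    (hγ : 0 < γ) {t : ℝ} (ht : 0 < t) (ht1 : t ≤ 1) (x : Spacetime d) :
    |approxLim Λ t x - germVal Λ t x| ≤ posConst d β γ * A * t ^ (γ / 4) := by
  -- The dyadic time ε = 2^(-n-1) satisfies t/4 ≤ ε < t/2. The lower bound makes ε^(β_i/4)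
  -- comparable to t^(β_i/4) even for negative β_i, whence the factor 4^|β_i/4|; the upper bound
  -- leaves the positive time t - ε for the convolution.
  obtain ⟨n, hn1, hn2⟩ := exists_nat_pow_near_of_lt_one (half_pos ht) (by linarith : t / 2 ≤ 1)
    (by norm_num : (0 : ℝ) < 1 / 2) (by norm_num : (1 / 2 : ℝ) < 1)
  change dyadic (n + 1) < t / 2 at hn1
  change t / 2 ≤ dyadic n at hn2
  rw [← dyadic_succ n] at hn2
  set ε := dyadic (n + 1) with hε
  have hε0 : 0 < ε := dyadic_pos _
  have hε1 : ε ≤ 1 := dyadic_le_one _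
  have hεt : ε < t := by linarith
  have h1 := (h.approx_tendsto_of_lt hβ hγ hεt x).2
  have hr : 0 < t - ε := by linarith
  have e1 : germVal Λ t x = sconv (heatDeriv d 0 (t - ε)) (fun z => Λ x (heatAt ε z)) x := by
    rw [← apply_heatAt_add (Λ x) hr hε0, sub_add_cancel]
    rfl
  have h2 : |approx Λ (n + 1) t x - germVal Λ t x|
      ≤ A * (∑ i, heatMoment d 0 (γ - β i) * 4 ^ |β i / 4|) * t ^ (γ / 4) := by
    rw [e1, approx, ← hε, ← sconv_sub (h.polyBdd hε0 hε1) (polyBdd_apply_heatAt (Λ x) ε)]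
    refine (h.abs_sconv_sub_le hβ 0 hr hε0 hε1 x).trans ?_
    rw [mul_assoc, Finset.sum_mul]
    refine mul_le_mul_of_nonneg_left (Finset.sum_le_sum fun i _ => ?_) hA
    rw [mul_assoc]
    refine mul_le_mul_of_nonneg_left ?_ (heatMoment_nonneg _ _)
    have h3 : t ^ (γ / 4) = t ^ (β i / 4) * t ^ ((γ - β i) / 4) := by
      rw [← Real.rpow_add ht]
      congr 1
      ring
    rw [Nat.cast_zero, sub_zero, h3, ← mul_assoc]
    refine mul_le_mul (rpow_le_of_quarter_le ht (by linarith) hεt.le _) ?_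
      (Real.rpow_nonneg hr.le _) (mul_nonneg (by positivity) (Real.rpow_nonneg ht.le _))
    exact Real.rpow_le_rpow hr.le (by linarith) (by linarith [hβ i])
  have h4 : limConst d β γ * A * ε ^ (γ / 4) ≤ limConst d β γ * A * t ^ (γ / 4) :=
    mul_le_mul_of_nonneg_left (Real.rpow_le_rpow hε0.le hεt.le (by linarith))
      (mul_nonneg (limConst_nonneg hγ) hA)
  have h5 := abs_sub_le (approxLim Λ t x) (approx Λ (n + 1) t x) (germVal Λ t x)
  rw [abs_sub_comm (approxLim Λ t x) (approx Λ (n + 1) t x)] at h5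
  rw [← hε] at h1
  calc |approxLim Λ t x - germVal Λ t x|
      ≤ limConst d β γ * A * t ^ (γ / 4)
        + A * (∑ i, heatMoment d 0 (γ - β i) * 4 ^ |β i / 4|) * t ^ (γ / 4) := by linarith
    _ = _ := by rw [posConst]; ring

end Germ

section Germ

variable {ι : Type*} [Fintype ι] {β : ι → ℝ} {γ α A B : ℝ} {Λ : Spacetime d → TempDist d}

lemma rpow_le_rpow_of_le_one {t a b : ℝ} (ht : 0 < t) (ht1 : t ≤ 1) (h : a ≤ b) :
    t ^ b ≤ t ^ a := Real.rpow_le_rpow_of_exponent_ge ht ht1 h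

lemma IsGerm.abs_const (h : IsGerm β γ α A B Λ) : IsGerm β γ α |A| B Λ := by
  refine ⟨h.measurable, fun s h0 h1 x y => (h.coherent s h0 h1 x y).trans ?_, h.bounded⟩
  refine mul_le_mul_of_nonneg_right (le_abs_self A) (Finset.sum_nonneg fun i _ => ?_)
  rw [pdist_eq]
  exact mul_nonneg (Real.rpow_nonneg h0.le _) (Real.rpow_nonneg (pnorm_nonneg _) _)

lemma posConst_nonneg (hγ : 0 < γ) : 0 ≤ posConst d β γ :=
  add_nonneg (limConst_nonneg hγ) (Finset.sum_nonneg fun _ _ =>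
    mul_nonneg (heatMoment_nonneg _ _) (by positivity))

/-- The limit differs from F_s by O(s^(γ/4)), and since α ≤ 0 < γ and s ≤ 1 this error is absorbed
in s^(α/4). -/
lemma IsGerm.approxLim_mem (h : IsGerm β γ α A B Λ) (hβ : ∀ i, β i < γ) (hγ : 0 < γ)
    (hα : α ≤ 0) : approxLim Λ ∈ familySpace d α := by
  refine ⟨h.measurable_approxLim hβ hγ, posConst d β γ * |A| + B, fun s h0 h1 y => ?_⟩
  have e1 := h.abs_const.abs_approxLim_sub_le (abs_nonneg A) hβ hγ h0 h1 y
  have e2 := h.bounded s h0 h1 y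
  have e4 : posConst d β γ * |A| * s ^ (γ / 4) ≤ posConst d β γ * |A| * s ^ (α / 4) :=
    mul_le_mul_of_nonneg_left (rpow_le_rpow_of_le_one h0 h1 (by linarith))
      (mul_nonneg (posConst_nonneg hγ) (abs_nonneg A))
  rw [add_mul]
  have e5 : |approxLim Λ s y| ≤ |approxLim Λ s y - germVal Λ s y| + |germVal Λ s y| := by
    have := abs_add_le (approxLim Λ s y - germVal Λ s y) (germVal Λ s y)
    rwa [sub_add_cancel] at this
  exact e5.trans (add_le_add (e1.trans e4) e2)

lemma IsGerm.approxLim_add {A' B' A'' B'' : ℝ} {Λ' : Spacetime d → TempDist d}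
    (h : IsGerm β γ α A B Λ) (h' : IsGerm β γ α A' B' Λ')
    (h'' : IsGerm β γ α A'' B'' (Λ + Λ')) (hβ : ∀ i, β i < γ) (hγ : 0 < γ) :
    approxLim (Λ + Λ') = approxLim Λ + approxLim Λ' := by
  funext s x
  have e1 := h''.approx_tendsto hβ hγ s x
  have e2 := (h.approx_tendsto hβ hγ s x).add (h'.approx_tendsto hβ hγ s x)
  have e3 : (fun n => approx Λ n s x + approx Λ' n s x) = fun n => approx (Λ + Λ') n s x :=
    funext fun n => (sconv_add (h.polyBdd (dyadic_pos n) (dyadic_le_one n))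
      (h'.polyBdd (dyadic_pos n) (dyadic_le_one n)) (heatDeriv d 0 (s - dyadic n)) x).symm
  rw [e3] at e2
  exact tendsto_nhds_unique e1 e2

lemma IsGerm.approxLim_smul {A'' B'' : ℝ} (c : ℝ) (h : IsGerm β γ α A B Λ)
    (h'' : IsGerm β γ α A'' B'' (c • Λ)) (hβ : ∀ i, β i < γ) (hγ : 0 < γ) :
    approxLim (c • Λ) = c • approxLim Λ := by
  funext s x
  have e1 := h''.approx_tendsto hβ hγ s x
  have e2 := (h.approx_tendsto hβ hγ s x).const_mul c
  have e3 : (fun n => c * approx Λ n s x) = fun n => approx (c • Λ) n s x :=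
    funext fun n => (sconv_const_mul c _ _ x).symm
  rw [e3] at e2
  exact tendsto_nhds_unique e1 e2

/-- The limits of the approximations, as an element of the space of families. -/
def approxFamily (hβ : ∀ i, β i < γ) (hγ : 0 < γ) (hα : α ≤ 0) :
    germSpace d β γ α →ₗ[ℝ] familySpace d α where
  toFun Λ := ⟨approxLim Λ.1, Λ.2.choose_spec.choose_spec.approxLim_mem hβ hγ hα⟩
  map_add' Λ Λ' := Subtype.ext (Λ.2.choose_spec.choose_spec.approxLim_add
    Λ'.2.choose_spec.choose_spec (Λ + Λ').2.choose_spec.choose_spec hβ hγ)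
  map_smul' c Λ := Subtype.ext (Λ.2.choose_spec.choose_spec.approxLim_smul c
    (c • Λ).2.choose_spec.choose_spec hβ hγ)

/-- Reconstruction for a positive exponent. -/
lemma exists_reconstruction_of_pos (hβ : ∀ i, β i < γ) (hγ : 0 < γ) (hα : α ≤ 0) :
    ∃ (C : ℝ) (R : germSpace d β γ α →ₗ[ℝ] TempDist d),
      ∀ (Λ : germSpace d β γ α) (A B : ℝ), 0 ≤ A → IsGerm β γ α A B Λ.1 →
        ∀ (x : Spacetime d) (t : ℝ), 0 < t → t ≤ 1 →
          |(R Λ - Λ.1 x) (heatAt t x)| ≤ C * A * t ^ (γ / 4) := by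
  -- The order depends on α only, so the same operator serves all germs.
  obtain ⟨n, hn⟩ := exists_nat_ge (-(α / 4))
  have hn' : 0 ≤ n + α / 4 := by linarith
  refine ⟨posConst d β γ, familyDist hn' ∘ₗ approxFamily hβ hγ hα,
    fun Λ A B hA h x t ht ht1 => ?_⟩
  rw [sub_apply, LinearMap.comp_apply, familyDist_heatAt_of_isCaloric hn' _
    (h.isCaloric_approxLim hβ hγ) ht]
  exact h.abs_approxLim_sub_le hA hβ hγ ht ht1 x

/-! #### Negative exponent -/

/-- The functions `p_{s/2} ⋆ F_{s/2}`. -/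
def halfFamily (α : ℝ) : germSpace d β γ α →ₗ[ℝ] familySpace d α where
  -- Germs are controlled only at times at most 1. The cut-off makes linearity hold at every real s;
  -- only 0 < s ≤ 1 matters afterwards.
  toFun Λ := ⟨fun s x => sconv (heatDeriv d 0 (min s 1 / 2)) (germVal Λ.1 (min s 1 / 2)) x, by
    obtain ⟨A, B, h⟩ := Λ.2
    have hτ : Measurable fun p : ℝ × Spacetime d => min p.1 1 / 2 :=
      (measurable_fst.min measurable_const).div_const 2
    refine ⟨measurable_sconv_heatDeriv 0 hτ measurable_snd
      (v := fun p y => germVal Λ.1 (min p.1 1 / 2) y)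
      (h.measurable.comp ((hτ.comp measurable_fst).prodMk measurable_snd)),
      B * heatMoment d 0 0 * (1 / 2) ^ (α / 4), fun s h0 h1 y => ?_⟩
    change |sconv (heatDeriv d 0 (min s 1 / 2)) (germVal Λ.1 (min s 1 / 2)) y| ≤ _
    rw [min_eq_left h1]
    have hs : 0 < s / 2 := half_pos h0
    refine (abs_sconv_le (h.bounded _ hs (by linarith)) _ y).trans (le_of_eq ?_)
    rw [integral_abs_heatDeriv 0 hs, div_eq_mul_one_div s 2,
      Real.mul_rpow h0.le (by norm_num)]
    simp
    ring⟩
  map_add' Λ Λ' := by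
    obtain ⟨A, B, h⟩ := Λ.2
    obtain ⟨A', B', h'⟩ := Λ'.2
    refine Subtype.ext (funext fun s => funext fun x => ?_)
    rcases le_or_gt s 0 with hs | hs
    · have h0 : min s 1 / 2 ≤ 0 := by linarith [min_le_left s 1]
      change sconv _ _ _ = sconv _ _ _ + sconv _ _ _
      simp [heatDeriv_of_nonpos h0, sconv]
    · have h0 : 0 < min s 1 / 2 := half_pos (lt_min hs one_pos)
      have h1 : min s 1 / 2 ≤ 1 := by linarith [min_le_right s 1]
      exact sconv_add (h.polyBdd h0 h1) (h'.polyBdd h0 h1) _ x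
  map_smul' c Λ := by
    refine Subtype.ext (funext fun s => funext fun x => ?_)
    exact sconv_const_mul c _ _ x

lemma halfFamily_apply (Λ : germSpace d β γ α) {s : ℝ} (hs : s ≤ 1) (x : Spacetime d) :
    (halfFamily α Λ).1 s x = sconv (heatDeriv d 0 (s / 2)) (germVal Λ.1 (s / 2)) x := by
  change sconv (heatDeriv d 0 (min s 1 / 2)) (germVal Λ.1 (min s 1 / 2)) x = _
  rw [min_eq_left hs]

/-- The reason for the extra factor p_{s/2}: the kernel acts at time t + s/2 instead of t, so the
main estimate carries a power of t + s/2, which dominates s/2 and can absorb the powers of s. -/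
lemma IsGerm.sconv_halfFamily_sub {Λ : germSpace d β γ α} (h : IsGerm β γ α A B Λ.1) (j : ℕ)
    {t s : ℝ} (ht : 0 < t) (hs : 0 < s) (hs1 : s ≤ 1) (x : Spacetime d) :
    sconv (heatDeriv d j t) ((halfFamily α Λ).1 s) x
        - sconv (heatDeriv d j t) (fun y => Λ.1 x (heatAt s y)) x
      = sconv (heatDeriv d j (t + s / 2))
        (fun y => germVal Λ.1 (s / 2) y - Λ.1 x (heatAt (s / 2) y)) x := by
  have hs2 : 0 < s / 2 := half_pos hs
  have hF := h.polyBdd hs2 (by linarith)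
  have hv := polyBdd_apply_heatAt (Λ.1 x) (s / 2)
  have e1 : (halfFamily α Λ).1 s = sconv (heatDeriv d 0 (s / 2)) (germVal Λ.1 (s / 2)) :=
    funext (halfFamily_apply Λ hs1)
  have e2 : (fun y => Λ.1 x (heatAt s y))
      = sconv (heatDeriv d 0 (s / 2)) fun y => Λ.1 x (heatAt (s / 2) y) := by
    funext y
    rw [← apply_heatAt_add (Λ.1 x) hs2 hs2, add_halves]
  rw [e1, e2, sconv_heatDeriv_sconv j 0 ht hs2 hF, sconv_heatDeriv_sconv j 0 ht hs2 hv,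
    add_zero, sconv_sub hF hv]

/-- The constant of the boundary terms for negative exponent. -/
def boundaryConst (d : ℕ) (β : ι → ℝ) (γ : ℝ) (j : ℕ) : ℝ :=
  ∑ i, heatMoment d j (γ - β i) * ((1 / 2) ^ (β i / 4) *
    ((1 / 2) ^ ((γ - β i) / 4 - j) + (3 / 2) ^ ((γ - β i) / 4 - j)))

/-- The constant of the reconstruction bound for negative exponent. -/
def negConst (d : ℕ) (β : ι → ℝ) (γ : ℝ) (n : ℕ) : ℝ :=
  ∑ j ∈ Finset.range (n + 1), |taylorCoeff j| * boundaryConst d β γ j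
    + (∑ i, heatMoment d (n + 1) (γ - β i)) * 2 ^ n * (8 / (-γ))

lemma integral_half_rpow_le (hγ : γ < 0) {t : ℝ} (ht : 0 < t) :
    IntegrableOn (fun s : ℝ => (t + s / 2) ^ (γ / 4 - 1)) (Set.Ioc 0 1) ∧
      ∫ s in Set.Ioc (0 : ℝ) 1, (t + s / 2) ^ (γ / 4 - 1) ≤ 8 / (-γ) * t ^ (γ / 4) := by
  have hcont : ContinuousOn (fun s : ℝ => (t + s / 2) ^ (γ / 4 - 1)) (Set.Icc 0 1) := by
    intro s hs
    have hpos : t + s / 2 ≠ 0 := by linarith [hs.1]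
    exact ((continuousAt_const.add (continuousAt_id.div_const 2)).rpow_const
      (Or.inl hpos)).continuousWithinAt
  refine ⟨(hcont.integrableOn_Icc).mono_set Set.Ioc_subset_Icc_self, ?_⟩
  have hderiv : ∀ s ∈ Set.uIcc (0 : ℝ) 1,
      HasDerivAt (fun s : ℝ => 8 / γ * (t + s / 2) ^ (γ / 4)) ((t + s / 2) ^ (γ / 4 - 1)) s := by
    intro s hs
    rw [Set.uIcc_of_le zero_le_one] at hs
    have hpos : t + s / 2 ≠ 0 := by linarith [hs.1]
    have h1 : HasDerivAt (fun s : ℝ => t + s / 2) (1 / 2) s :=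
      ((hasDerivAt_id s).div_const 2).const_add t
    have hγ0 : γ ≠ 0 := hγ.ne
    refine ((h1.rpow_const (p := γ / 4) (Or.inl hpos)).const_mul (8 / γ)).congr_deriv ?_
    field_simp
    ring
  have h2 := intervalIntegral.integral_eq_sub_of_hasDerivAt hderiv
    (ContinuousOn.intervalIntegrable (by rwa [Set.uIcc_of_le zero_le_one]))
  rw [intervalIntegral.integral_of_le zero_le_one] at h2
  rw [h2, zero_div, add_zero]
  have h3 : 0 ≤ (t + 1 / 2) ^ (γ / 4) := Real.rpow_nonneg (by linarith) _
  have h4 : 0 ≤ 8 / (-γ) * (t + 1 / 2) ^ (γ / 4) :=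
    mul_nonneg (div_nonneg (by norm_num) (by linarith)) h3
  rw [div_neg] at h4 ⊢
  linarith

/-- Reconstruction for a negative exponent. -/
lemma exists_reconstruction_of_neg (hβ : ∀ i, β i < γ) (hγ : γ < 0) :
    ∃ (C : ℝ) (R : germSpace d β γ α →ₗ[ℝ] TempDist d),
      ∀ (Λ : germSpace d β γ α) (A B : ℝ), 0 ≤ A → IsGerm β γ α A B Λ.1 →
        ∀ (x : Spacetime d) (t : ℝ), 0 < t → t ≤ 1 →
          |(R Λ - Λ.1 x) (heatAt t x)| ≤ C * A * t ^ (γ / 4) := by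
  -- One order large enough for `familyDist` to be defined and for every exponent n + β_i/4 to be
  -- nonnegative, which is what replaces s/2 by t + s/2 below.
  obtain ⟨n, hn⟩ := exists_nat_ge (|α / 4| + ∑ i, |β i / 4|)
  have hsum0 : 0 ≤ ∑ i, |β i / 4| := Finset.sum_nonneg fun i _ => abs_nonneg _
  have hnα : 0 ≤ n + α / 4 := by linarith [neg_abs_le (α / 4)]
  have hnβ (i : ι) : 0 ≤ n + β i / 4 := by
    have := Finset.single_le_sum (f := fun i => |β i / 4|) (fun i _ => abs_nonneg _)
      (Finset.mem_univ i)
    have := neg_abs_le (β i / 4)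
    have := abs_nonneg (α / 4)
    linarith
  refine ⟨negConst d β γ n, familyDist hnα ∘ₗ halfFamily α,
    fun Λ A B hA h x t ht ht1 => ?_⟩
  obtain ⟨i1, e1⟩ := familyDist_heatAt hnα (halfFamily α Λ) t x
  obtain ⟨i2, e2⟩ := (isCaloric_apply_heatAt (Λ.1 x)).taylor n ht x
  -- The boundary terms at s = 1 are only bounded by constants, and a constant is admissible because
  -- γ < 0 and t ≤ 1.
  have htγ : 1 ≤ t ^ (γ / 4) := Real.one_le_rpow_of_pos_of_le_one_of_nonpos ht ht1 (by linarith)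
  have hbdry (j : ℕ) : |sconv (heatDeriv d j t) ((halfFamily α Λ).1 1) x
      - sconv (heatDeriv d j t) (fun y => Λ.1 x (heatAt 1 y)) x|
      ≤ boundaryConst d β γ j * A * t ^ (γ / 4) := by
    rw [h.sconv_halfFamily_sub j ht one_pos le_rfl]
    have h1 := h.abs_sconv_sub_le hβ j (by linarith : 0 < t + 1 / 2)
      (by norm_num : (0 : ℝ) < 1 / 2) (by norm_num) x
    have h2 : A * ∑ i, heatMoment d j (γ - β i) *
        ((1 / 2) ^ (β i / 4) * (t + 1 / 2) ^ ((γ - β i) / 4 - j)) ≤ boundaryConst d β γ j * A := by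
      rw [mul_comm, boundaryConst]
      gcongr with i _
      · exact heatMoment_nonneg _ _
      · exact rpow_le_endpoints (by norm_num) (by linarith) (by linarith) _
    have h0 := (abs_nonneg _).trans (h1.trans h2)
    exact (h1.trans h2).trans (le_mul_of_one_le_right h0 htγ)
  have hrem : |∫ s in Set.Ioc (0 : ℝ) 1, (taylorWeight n s *
        sconv (heatDeriv d (n + 1) t) ((halfFamily α Λ).1 s) x
      - taylorWeight n s * sconv (heatDeriv d (n + 1) t) (fun y => Λ.1 x (heatAt s y)) x)|
      ≤ (∑ i, heatMoment d (n + 1) (γ - β i)) * 2 ^ n * (8 / (-γ)) * A * t ^ (γ / 4) := by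
    obtain ⟨j1, j2⟩ := integral_half_rpow_le hγ ht
    set M := A * (∑ i, heatMoment d (n + 1) (γ - β i)) * 2 ^ n with hM
    have hM0 : 0 ≤ M := mul_nonneg (mul_nonneg hA
      (Finset.sum_nonneg fun i _ => heatMoment_nonneg _ _)) (by positivity)
    have hle : ∀ s ∈ Set.Ioc (0 : ℝ) 1, ‖taylorWeight n s *
        sconv (heatDeriv d (n + 1) t) ((halfFamily α Λ).1 s) x
      - taylorWeight n s * sconv (heatDeriv d (n + 1) t) (fun y => Λ.1 x (heatAt s y)) x‖
      ≤ M * (t + s / 2) ^ (γ / 4 - 1) := by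
      rintro s ⟨hs0, hs1⟩
      have hs2 : 0 < s / 2 := half_pos hs0
      have hts : 0 < t + s / 2 := by linarith
      rw [← mul_sub, h.sconv_halfFamily_sub (n + 1) ht hs0 hs1, Real.norm_eq_abs, abs_mul]
      have h1 := h.abs_sconv_sub_le hβ (n + 1) hts hs2 (by linarith) x
      calc _ ≤ s ^ n * (A * ∑ i, heatMoment d (n + 1) (γ - β i) *
            ((s / 2) ^ (β i / 4) * (t + s / 2) ^ ((γ - β i) / 4 - ((n + 1 : ℕ) : ℝ)))) := by
            refine mul_le_mul (abs_taylorWeight_le n hs0.le) h1 (abs_nonneg _) (by positivity)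
        _ = A * ∑ i, heatMoment d (n + 1) (γ - β i) * (2 ^ n *
            ((s / 2) ^ (n + β i / 4) * (t + s / 2) ^ ((γ - β i) / 4 - ((n + 1 : ℕ) : ℝ)))) := by
            rw [mul_left_comm, Finset.mul_sum]
            congr 1
            refine Finset.sum_congr rfl fun i _ => ?_
            rw [Real.rpow_add hs2, Real.rpow_natCast, div_pow]
            field_simp
        _ ≤ A * ∑ i, heatMoment d (n + 1) (γ - β i) * (2 ^ n * (t + s / 2) ^ (γ / 4 - 1)) := by
            refine mul_le_mul_of_nonneg_left (Finset.sum_le_sum fun i _ => ?_) hA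
            refine mul_le_mul_of_nonneg_left (mul_le_mul_of_nonneg_left ?_ (by positivity))
              (heatMoment_nonneg _ _)
            calc _ ≤ (t + s / 2) ^ (n + β i / 4)
                * (t + s / 2) ^ ((γ - β i) / 4 - ((n + 1 : ℕ) : ℝ)) := by
                  refine mul_le_mul_of_nonneg_right ?_ (Real.rpow_nonneg hts.le _)
                  exact Real.rpow_le_rpow hs2.le (by linarith) (hnβ i)
              _ = _ := by
                  rw [← Real.rpow_add hts]
                  congr 1
                  push_cast
                  ring
        _ = _ := by rw [← Finset.sum_mul, hM]; ring
    refine (norm_integral_le_of_norm_le (j1.const_mul M)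
      (by filter_upwards [ae_restrict_mem measurableSet_Ioc] with s hs; exact hle s hs)).trans ?_
    rw [integral_const_mul]
    refine (mul_le_mul_of_nonneg_left j2 hM0).trans (le_of_eq ?_)
    rw [hM]
    ring
  -- Both distributions have expansions of the same order n, so they are compared term by term.
  have hval : (familyDist hnα (halfFamily α Λ) - Λ.1 x) (heatAt t x)
      = ∑ j ∈ Finset.range (n + 1), taylorCoeff j *
        (sconv (heatDeriv d j t) ((halfFamily α Λ).1 1) x
          - sconv (heatDeriv d j t) (fun y => Λ.1 x (heatAt 1 y)) x)
        - ∫ s in Set.Ioc (0 : ℝ) 1, (taylorWeight n s *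
          sconv (heatDeriv d (n + 1) t) ((halfFamily α Λ).1 s) x
      - taylorWeight n s * sconv (heatDeriv d (n + 1) t) (fun y => Λ.1 x (heatAt s y)) x) := by
    rw [sub_apply, e1, integral_sub i1 i2]
    rw [e2]
    simp only [mul_sub, Finset.sum_sub_distrib]
    ring
  rw [LinearMap.comp_apply, hval]
  refine (abs_sub _ _).trans ((add_le_add (Finset.abs_sum_le_sum_abs _ _) hrem).trans ?_)
  rw [negConst, add_mul, add_mul]
  refine add_le_add ?_ le_rfl
  rw [Finset.sum_mul, Finset.sum_mul]
  refine Finset.sum_le_sum fun j _ => ?_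
  rw [abs_mul, mul_assoc |taylorCoeff j|, mul_assoc |taylorCoeff j|]
  exact mul_le_mul_of_nonneg_left (hbdry j) (abs_nonneg _)

/-- Reconstruction of coherent germs. -/
theorem exists_reconstruction (d : ℕ) (hβ : ∀ i, β i < γ) (hγ : γ ≠ 0) (hα : α ≤ 0) :
    ∃ (C : ℝ) (R : germSpace d β γ α →ₗ[ℝ] TempDist d),
      ∀ (Λ : germSpace d β γ α) (A B : ℝ), 0 ≤ A → IsGerm β γ α A B Λ.1 →
        ∀ (x : Spacetime d) (t : ℝ), 0 < t → t ≤ 1 →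
          |(R Λ - Λ.1 x) (heatAt t x)| ≤ C * A * t ^ (γ / 4) := by
  rcases lt_or_gt_of_ne hγ with h | h
  · exact exists_reconstruction_of_neg hβ h
  · exact exists_reconstruction_of_pos hβ h hα

end Germ

/-! ### Hölder bounds -/

/-- Splitting t into two halves puts 𝒢^N on one kernel, of L¹ norm proportional to t^(-N), which
cancels the prefactor t^N. Hence a bound on p_t alone controls the Hölder norm. -/
lemma abs_apply_QAt_le {Λ : TempDist d} {α D : ℝ}
    (h : ∀ (x : Spacetime d) (t : ℝ), 0 < t → t ≤ 1 → |Λ (heatAt t x)| ≤ D * t ^ (α / 4))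
    (N : ℕ) {t : ℝ} (ht : 0 < t) (ht1 : t ≤ 1) (x : Spacetime d) :
    |Λ (QAt N t x)|
      ≤ heatMoment d N 0 * 2 ^ N * (1 / 2) ^ (α / 4) * D * t ^ (α / 4) := by
  have ht2 : 0 < t / 2 := half_pos ht
  have e := apply_translate_heatDeriv Λ N ht2 ht2 x
  rw [add_halves] at e
  rw [QAt_eq, map_smul, e, smul_eq_mul, abs_mul, abs_pow, abs_neg, abs_of_pos ht]
  have h1 := abs_sconv_le (fun y => h y (t / 2) ht2 (by linarith)) (heatDeriv d N (t / 2)) x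
  rw [integral_abs_heatDeriv N ht2] at h1
  refine (mul_le_mul_of_nonneg_left h1 (by positivity)).trans (le_of_eq ?_)
  have h2 : (t / 2) ^ (α / 4) = t ^ (α / 4) * (1 / 2) ^ (α / 4) := by
    rw [div_eq_mul_one_div, Real.mul_rpow ht.le (by norm_num)]
  rw [h2, Real.rpow_neg ht2.le, Real.rpow_natCast, div_pow]
  field_simp

/-- The constant in the bound of the Hölder norm. -/
def holderConst (d N : ℕ) (α : ℝ) : ℝ :=
  ∑ k ∈ Finset.range N, ((N - 1).factorial : ℝ) / (k.factorial : ℝ)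
      * (heatMoment d k 0 * 2 ^ k * (1 / 2) ^ (α / 4))
    + heatMoment d N 0 * 2 ^ N * (1 / 2) ^ (α / 4)

lemma holderENorm_le {Λ : TempDist d} {α D : ℝ} (hD : 0 ≤ D)
    (h : ∀ (x : Spacetime d) (t : ℝ), 0 < t → t ≤ 1 → |Λ (heatAt t x)| ≤ D * t ^ (α / 4))
    (N : ℕ) : holderENorm N α Λ ≤ ENNReal.ofReal (holderConst d N α * D) := by
  have hm (k : ℕ) : 0 ≤ heatMoment d k 0 * 2 ^ k * (1 / 2 : ℝ) ^ (α / 4) :=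
    mul_nonneg (mul_nonneg (heatMoment_nonneg _ _) (by positivity)) (by positivity)
  have hs : 0 ≤ ∑ k ∈ Finset.range N, ((N - 1).factorial : ℝ) / (k.factorial : ℝ)
      * (heatMoment d k 0 * 2 ^ k * (1 / 2) ^ (α / 4)) :=
    Finset.sum_nonneg fun k _ => mul_nonneg (by positivity) (hm k)
  rw [holderConst, add_mul, ENNReal.ofReal_add (mul_nonneg hs hD) (mul_nonneg (hm N) hD)]
  refine add_le_add (iSup_le fun x => ?_) (iSup₂_le fun t ht => ?_)
  · rw [← ofReal_norm, Real.norm_eq_abs]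
    refine ENNReal.ofReal_le_ofReal ?_
    rw [PAt, map_sum, Finset.sum_mul]
    refine (Finset.abs_sum_le_sum_abs _ _).trans (Finset.sum_le_sum fun k _ => ?_)
    rw [map_smul, smul_eq_mul, abs_mul, abs_of_nonneg (by positivity), mul_assoc]
    refine mul_le_mul_of_nonneg_left ?_ (by positivity)
    have := abs_apply_QAt_le h k one_pos le_rfl x
    simpa using this
  · rw [ENNReal.mul_iSup]
    refine iSup_le fun x => ?_
    rw [← ofReal_norm, Real.norm_eq_abs, ← ENNReal.ofReal_mul (Real.rpow_nonneg ht.1.le _)]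
    refine ENNReal.ofReal_le_ofReal ?_
    have h1 := abs_apply_QAt_le h N ht.1 ht.2 x
    have h2 : t ^ (-α / 4) * t ^ (α / 4) = 1 := by
      rw [← Real.rpow_add ht.1, neg_div, neg_add_cancel, Real.rpow_zero]
    calc t ^ (-α / 4) * |Λ (QAt N t x)|
        ≤ t ^ (-α / 4) * (heatMoment d N 0 * 2 ^ N * (1 / 2) ^ (α / 4) * D * t ^ (α / 4)) :=
          mul_le_mul_of_nonneg_left h1 (Real.rpow_nonneg ht.1.le _)
      _ = heatMoment d N 0 * 2 ^ N * (1 / 2) ^ (α / 4) * D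
          * (t ^ (-α / 4) * t ^ (α / 4)) := by ring
      _ = _ := by rw [h2, mul_one]

/-! ### Characters and the structure group -/

section Algebra

variable {Tp T Bp B : Type*} [Ring Tp] [Bialgebra ℝ Tp] [AddCommGroup T] [Module ℝ T]

lemma gradedPart_le_ker {V I W : Type*} [AddCommGroup V] [Module ℝ V] [AddCommGroup W]
    [Module ℝ W] (b : Module.Basis I ℝ V) (deg : I → ℝ) (α : ℝ) (ℓ : V →ₗ[ℝ] W)
    (h : ∀ i, deg i = α → ℓ (b i) = 0) : gradedPart b deg α ≤ LinearMap.ker ℓ := by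
  refine Submodule.span_le.2 ?_
  rintro _ ⟨i, hi, rfl⟩
  exact h i hi

lemma range_mapIncl_le_ker {V W X : Type*} [AddCommGroup V] [Module ℝ V] [AddCommGroup W]
    [Module ℝ W] [AddCommGroup X] [Module ℝ X] (p : Submodule ℝ V) (q : Submodule ℝ W)
    (Φ : V ⊗[ℝ] W →ₗ[ℝ] X) (h : ∀ v ∈ p, ∀ w ∈ q, Φ (v ⊗ₜ w) = 0) :
    LinearMap.range (TensorProduct.mapIncl p q) ≤ LinearMap.ker Φ := by
  rw [LinearMap.range_le_ker_iff]
  refine TensorProduct.ext' fun v w => ?_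
  simpa [TensorProduct.mapIncl] using h v.1 v.2 w.1 w.2

namespace ConcreteRegularityStructure

variable (𝒯 : ConcreteRegularityStructure Tp T Bp B)

lemma degp_nonneg (i : Bp) : 0 ≤ 𝒯.degp i := 𝒯.Ap_nonneg _ (𝒯.degp_mem i)

/-- The homogeneities of `T⁺` have a gap above `0`. -/
lemma exists_gap : ∃ a : ℝ, 0 < a ∧ ∀ i, 𝒯.degp i ≠ 0 → a ≤ 𝒯.degp i := by
  have hfin : ((𝒯.Ap ∩ Set.Icc 0 1) \ {0}).Finite := (𝒯.Ap_locallyFinite 0 1).subset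
    Set.sdiff_subset
  by_cases hne : ((𝒯.Ap ∩ Set.Icc 0 1) \ {0}).Nonempty
  · obtain ⟨a, ha, hmin⟩ := Set.exists_min_image _ id hfin hne
    refine ⟨a, lt_of_le_of_ne ha.1.2.1 (Ne.symm ha.2), fun i hi => ?_⟩
    rcases le_total (𝒯.degp i) 1 with h | h
    · exact hmin _ ⟨⟨𝒯.degp_mem i, 𝒯.degp_nonneg i, h⟩, hi⟩
    · exact ha.1.2.2.trans h
  · refine ⟨1, one_pos, fun i hi => ?_⟩
    by_contra hlt
    exact hne ⟨_, ⟨𝒯.degp_mem i, 𝒯.degp_nonneg i, (not_le.1 hlt).le⟩, hi⟩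

lemma comul_mem_ker {X : Type*} [AddCommGroup X] [Module ℝ X] (Φ : Tp ⊗[ℝ] Tp →ₗ[ℝ] X) {α : ℝ}
    (h : ∀ i j, 𝒯.degp i + 𝒯.degp j = α → Φ (𝒯.basisp i ⊗ₜ 𝒯.basisp j) = 0) {τ : Tp}
    (hτ : τ ∈ gradedPart 𝒯.basisp 𝒯.degp α) : Φ (Coalgebra.comul (R := ℝ) τ) = 0 := by
  suffices hle : (⨆ (μ : ℝ) (ν : ℝ) (_ : μ + ν = α), LinearMap.range (TensorProduct.mapIncl
      (gradedPart 𝒯.basisp 𝒯.degp μ) (gradedPart 𝒯.basisp 𝒯.degp ν))) ≤ LinearMap.ker Φ from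
    hle (𝒯.comul_graded α τ hτ)
  refine iSup_le fun μ => iSup_le fun ν => iSup_le fun hμν => ?_
  refine range_mapIncl_le_ker _ _ _ fun v hv w hw => ?_
  have h1 : ∀ i, 𝒯.degp i = μ → Φ (𝒯.basisp i ⊗ₜ w) = 0 := fun i hi =>
    gradedPart_le_ker 𝒯.basisp 𝒯.degp ν (Φ ∘ₗ TensorProduct.mk ℝ Tp Tp (𝒯.basisp i))
      (fun j hj => h i j (by rw [hi, hj, hμν])) hw
  exact gradedPart_le_ker 𝒯.basisp 𝒯.degp μ (Φ ∘ₗ (TensorProduct.mk ℝ Tp Tp).flip w) h1 hv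

lemma basisp_mem (i : Bp) : 𝒯.basisp i ∈ gradedPart 𝒯.basisp 𝒯.degp (𝒯.degp i) :=
  Submodule.subset_span ⟨i, rfl, rfl⟩

/-- By the grading of the coproduct, a convolution at a basis element only sees pairs of basis
elements whose degrees add up to its degree. -/
lemma convMul_apply_congr {f f' k k' : WithConv (Tp →ₗ[ℝ] ℝ)} {i : Bp}
    (h : ∀ j l, 𝒯.degp j + 𝒯.degp l = 𝒯.degp i →
      f.ofConv (𝒯.basisp j) * k.ofConv (𝒯.basisp l)
        = f'.ofConv (𝒯.basisp j) * k'.ofConv (𝒯.basisp l)) :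
    (f * k).ofConv (𝒯.basisp i) = (f' * k').ofConv (𝒯.basisp i) := by
  have h0 := 𝒯.comul_mem_ker (LinearMap.mul' ℝ ℝ ∘ₗ TensorProduct.map f.ofConv k.ofConv
    - LinearMap.mul' ℝ ℝ ∘ₗ TensorProduct.map f'.ofConv k'.ofConv)
    (fun j l hjl => by simpa [sub_eq_zero] using h j l hjl) (𝒯.basisp_mem i)
  rw [LinearMap.sub_apply, sub_eq_zero] at h0
  exact h0

/-- Powers of a functional that vanishes in degree `0` vanish in low degrees. -/
lemma pow_apply_eq_zero {a : ℝ} (ha : ∀ i, 𝒯.degp i ≠ 0 → a ≤ 𝒯.degp i)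
    {n : WithConv (Tp →ₗ[ℝ] ℝ)} (hn : ∀ i, 𝒯.degp i = 0 → n.ofConv (𝒯.basisp i) = 0) (k : ℕ) :
    ∀ i, 𝒯.degp i < k * a → (n ^ k).ofConv (𝒯.basisp i) = 0 := by
  induction k with
  | zero => exact fun i hi => absurd (𝒯.degp_nonneg i) (by simpa using hi)
  | succ k ih =>
    intro i hi
    rw [pow_succ']
    have h := 𝒯.convMul_apply_congr (f := n) (k := n ^ k) (f' := 0) (k' := 0) (i := i) ?_
    · simpa using h
    intro j l hjl
    have hz : (0 : WithConv (Tp →ₗ[ℝ] ℝ)).ofConv (𝒯.basisp j) = 0 := rfl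
    rw [hz, zero_mul]
    by_cases hj : 𝒯.degp j = 0
    · rw [hn j hj, zero_mul]
    · rw [ih l, mul_zero]
      have := ha j hj
      push_cast at hi
      linarith

/-- Neumann series: n = 1 - f vanishes in degree 0, and the gap a > 0 above degree 0 makes n^k
vanish in degrees below k a. The series Σ n^k is therefore a finite sum on each basis element,
without any convergence question. -/
lemma isUnit_of_degree_zero {f : WithConv (Tp →ₗ[ℝ] ℝ)}
    (hf : ∀ i, 𝒯.degp i = 0 → f.ofConv (𝒯.basisp i) = Coalgebra.counit (R := ℝ) (𝒯.basisp i)) :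
    IsUnit f := by
  obtain ⟨a, ha0, ha⟩ := 𝒯.exists_gap
  set n : WithConv (Tp →ₗ[ℝ] ℝ) := 1 - f with hn
  have hn0 : ∀ i, 𝒯.degp i = 0 → n.ofConv (𝒯.basisp i) = 0 := fun i hi => by
    have : n.ofConv (𝒯.basisp i)
      = Coalgebra.counit (R := ℝ) (𝒯.basisp i) - f.ofConv (𝒯.basisp i) := rfl
    rw [this, hf i hi, sub_self]
  have hpow := 𝒯.pow_apply_eq_zero ha hn0
  choose K hK using fun i => exists_nat_gt (𝒯.degp i / a)
  have hK' (i : Bp) : 𝒯.degp i < K i * a := (div_lt_iff₀ ha0).1 (hK i)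
  set S : ℕ → WithConv (Tp →ₗ[ℝ] ℝ) := fun m => ∑ k ∈ Finset.range m, n ^ k with hS
  have hstab (i : Bp) (m : ℕ) (hm : 𝒯.degp i < m * a) (l : ℕ) :
      (S (m + l)).ofConv (𝒯.basisp i) = (S m).ofConv (𝒯.basisp i) := by
    induction l with
    | zero => rfl
    | succ l ih =>
      have e : S (m + (l + 1)) = S (m + l) + n ^ (m + l) := Finset.sum_range_succ _ _
      have e' : (S (m + (l + 1))).ofConv (𝒯.basisp i)
        = (S (m + l)).ofConv (𝒯.basisp i) + (n ^ (m + l)).ofConv (𝒯.basisp i) := by rw [e]; rfl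
      rw [e', ih, hpow (m + l) i, add_zero]
      refine hm.trans_le (mul_le_mul_of_nonneg_right ?_ ha0.le)
      exact_mod_cast Nat.le_add_right m l
  have hstab' (i : Bp) (m m' : ℕ) (hm : 𝒯.degp i < m * a) (hm' : 𝒯.degp i < m' * a) :
      (S m).ofConv (𝒯.basisp i) = (S m').ofConv (𝒯.basisp i) := by
    rw [← hstab i m hm m', ← hstab i m' hm' m, add_comm]
  -- The inverse is defined basis element by basis element, with a truncation depending on the
  -- degree; by `hstab'` any later truncation gives the same value.
  set h : WithConv (Tp →ₗ[ℝ] ℝ) := WithConv.toConv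
    (𝒯.basisp.constr ℝ fun i => (S (K i)).ofConv (𝒯.basisp i)) with hh
  have hhS (i : Bp) (m : ℕ) (hm : 𝒯.degp i < m * a) :
      h.ofConv (𝒯.basisp i) = (S m).ofConv (𝒯.basisp i) := by
    have : h.ofConv (𝒯.basisp i) = (S (K i)).ofConv (𝒯.basisp i) :=
      𝒯.basisp.constr_basis ℝ _ i
    rw [this, hstab' i _ m (hK' i) hm]
  have hf' : f = 1 - n := by rw [hn, sub_sub_cancel]
  have hone (i : Bp) (m : ℕ) (hm : 𝒯.degp i < m * a) :
      ((1 : WithConv (Tp →ₗ[ℝ] ℝ)) - n ^ m).ofConv (𝒯.basisp i)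
        = (1 : WithConv (Tp →ₗ[ℝ] ℝ)).ofConv (𝒯.basisp i) := by
    change (1 : WithConv (Tp →ₗ[ℝ] ℝ)).ofConv (𝒯.basisp i) - (n ^ m).ofConv (𝒯.basisp i) = _
    rw [hpow m i hm, sub_zero]
  have hext {u v : WithConv (Tp →ₗ[ℝ] ℝ)}
      (huv : ∀ i, u.ofConv (𝒯.basisp i) = v.ofConv (𝒯.basisp i)) : u = v :=
    WithConv.ofConv_injective (𝒯.basisp.ext huv)
  have hlt {i j l : Bp} (hjl : 𝒯.degp j + 𝒯.degp l = 𝒯.degp i) :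
      𝒯.degp j < K i * a ∧ 𝒯.degp l < K i * a :=
    ⟨by linarith [hK' i, 𝒯.degp_nonneg l], by linarith [hK' i, 𝒯.degp_nonneg j]⟩
  -- Only degrees up to that of i enter, so h may be replaced by the single partial sum at K i, and
  -- f times that sum is 1 - n^(K i), which agrees with 1 at i.
  have h1 : f * h = 1 := hext fun i => by
    rw [← hone i (K i) (hK' i), ← mul_neg_geom_sum, ← hf']
    exact 𝒯.convMul_apply_congr fun j l hjl => by rw [hhS l (K i) (hlt hjl).2]
  have h2 : h * f = 1 := hext fun i => by
    rw [← hone i (K i) (hK' i), ← geom_sum_mul_neg, ← hf']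
    exact 𝒯.convMul_apply_congr fun j l hjl => by rw [hhS j (K i) (hlt hjl).1]
  exact ⟨⟨f, h, h1, h2⟩, rfl⟩

/-- By connectedness a basis element of degree 0 is a multiple of the unit, where every character
agrees with the counit. So `charInv` is a true inverse rather than the default value 0 of
`Ring.inverse`. -/
lemma isUnit_character (𝒯 : ConcreteRegularityStructure Tp T Bp B) (g : Tp →ₐ[ℝ] ℝ) :
    IsUnit (WithConv.toConv g.toLinearMap) := by
  refine 𝒯.isUnit_of_degree_zero fun i hi => ?_
  have hmem : 𝒯.basisp i ∈ Submodule.span ℝ {(1 : Tp)} := by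
    rw [← 𝒯.connected, ← hi]
    exact 𝒯.basisp_mem i
  obtain ⟨c, hc⟩ := Submodule.mem_span_singleton.1 hmem
  rw [← hc]
  simp

lemma charInv_mul (𝒯 : ConcreteRegularityStructure Tp T Bp B) (g : Tp →ₐ[ℝ] ℝ) :
    WithConv.toConv (charInv g) * WithConv.toConv g.toLinearMap = 1 :=
  Ring.inverse_mul_cancel _ (𝒯.isUnit_character g)

/-- This is the coassociativity of the splitting map, contracted with two functionals; it makes
convolution act on T. -/
lemma hat_hat (f k : WithConv (Tp →ₗ[ℝ] ℝ)) (τ : T) :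
    𝒯.hat f.ofConv (𝒯.hat k.ofConv τ) = 𝒯.hat (f * k).ofConv τ := by
  let Ψ : T ⊗[ℝ] (Tp ⊗[ℝ] Tp) →ₗ[ℝ] T := (TensorProduct.rid ℝ T).toLinearMap ∘ₗ
    (LinearMap.mul' ℝ ℝ ∘ₗ TensorProduct.map f.ofConv k.ofConv).lTensor T
  have e1 : 𝒯.hat f.ofConv ∘ₗ (TensorProduct.rid ℝ T).toLinearMap ∘ₗ k.ofConv.lTensor T
      = Ψ ∘ₗ (TensorProduct.assoc ℝ T Tp Tp).toLinearMap ∘ₗ 𝒯.split.rTensor Tp := by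
    refine TensorProduct.ext' fun σ ρ => ?_
    have e0 : ∀ z : T ⊗[ℝ] Tp, k.ofConv ρ •
        (TensorProduct.rid ℝ T) (f.ofConv.lTensor T z)
        = Ψ (TensorProduct.assoc ℝ T Tp Tp (z ⊗ₜ ρ)) := by
      intro z
      induction z using TensorProduct.induction_on with
      | zero => simp
      | tmul x y => simp [Ψ, smul_smul, mul_comm]
      | add x y hx hy => simp only [map_add, smul_add, hx, hy, TensorProduct.add_tmul]
    simpa [hat] using e0 (𝒯.split σ)
  have e2 := congrArg (fun L => Ψ (L τ)) 𝒯.split_coassoc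
  have e3 := LinearMap.congr_fun e1 (𝒯.split τ)
  refine (e3.trans e2).trans ?_
  change (TensorProduct.rid ℝ T) ((LinearMap.mul' ℝ ℝ ∘ₗ TensorProduct.map f.ofConv
    k.ofConv).lTensor T ((Coalgebra.comul (R := ℝ) (A := Tp)).lTensor T (𝒯.split τ))) = _
  rw [← LinearMap.lTensor_comp_apply]
  rfl

lemma PiAt_eq (g : Spacetime d → Tp →ₐ[ℝ] ℝ) (P : T →ₗ[ℝ] TempDist d) (x : Spacetime d) (τ : T) :
    𝒯.PiAt g P x τ = P (𝒯.hat (charInv (g x)) τ) := by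
  have e : ∀ z : T ⊗[ℝ] Tp, TensorProduct.rid ℝ (TempDist d)
      (TensorProduct.map P (charInv (g x)) z)
      = P (TensorProduct.rid ℝ T ((charInv (g x)).lTensor T z)) := by
    intro z
    induction z using TensorProduct.induction_on with
    | zero => simp
    | tmul x y => simp
    | add x y hx hy => simp only [map_add, hx, hy]
  exact e (𝒯.split τ)

/-- The factors g_y⁻¹ * g_y cancel. This re-expansion rule is the only link between the model at
different base points. -/
lemma PiAt_hat_transition (g : Spacetime d → Tp →ₐ[ℝ] ℝ) (P : T →ₗ[ℝ] TempDist d)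
    (y x : Spacetime d) (τ : T) :
    𝒯.PiAt g P y (𝒯.hat (transition g y x) τ) = 𝒯.PiAt g P x τ := by
  rw [PiAt_eq, PiAt_eq, transition]
  have h := 𝒯.hat_hat (WithConv.toConv (charInv (g y)))
    (WithConv.toConv (g y).toLinearMap * WithConv.toConv (charInv (g x))) τ
  rw [← mul_assoc, 𝒯.charInv_mul, one_mul] at h
  exact congrArg P h

lemma hat_transition_hat_transition (g : Spacetime d → Tp →ₐ[ℝ] ℝ) (z y x : Spacetime d) (τ : T) :
    𝒯.hat (transition g z y) (𝒯.hat (transition g y x) τ) = 𝒯.hat (transition g z x) τ := by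
  have h := 𝒯.hat_hat (WithConv.toConv (g z).toLinearMap * WithConv.toConv (charInv (g y)))
    (WithConv.toConv (g y).toLinearMap * WithConv.toConv (charInv (g x))) τ
  rw [mul_assoc, ← mul_assoc (WithConv.toConv (charInv (g y))), 𝒯.charInv_mul, one_mul] at h
  exact h

/-! ### Expansions in the basis -/

lemma finite_deg_lt (γ : ℝ) : {i | 𝒯.deg i < γ}.Finite := by
  obtain ⟨m, hm⟩ := 𝒯.A_bddBelow
  refine ((𝒯.A_locallyFinite m γ).biUnion fun β _ => 𝒯.deg_finite β).subset fun i hi => ?_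
  exact Set.mem_biUnion ⟨𝒯.deg_mem i, hm (𝒯.deg_mem i), le_of_lt hi⟩ rfl

instance (γ : ℝ) : Fintype {i // 𝒯.deg i < γ} := (𝒯.finite_deg_lt γ).fintype

lemma minHom_le (i : B) : 𝒯.minHom ≤ 𝒯.deg i := csInf_le 𝒯.A_bddBelow (𝒯.deg_mem i)

lemma TLt_le_ker {X : Type*} [AddCommGroup X] [Module ℝ X] {γ : ℝ} (ℓ : T →ₗ[ℝ] X)
    (h : ∀ i, 𝒯.deg i < γ → ℓ (𝒯.basis i) = 0) : 𝒯.TLt γ ≤ LinearMap.ker ℓ :=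
  iSup₂_le fun _ hβ => gradedPart_le_ker _ _ _ _ fun i hi => h i (hi ▸ hβ)

lemma eq_sum_of_mem_TLt {γ : ℝ} {τ : T} (hτ : τ ∈ 𝒯.TLt γ) :
    τ = ∑ i : {i // 𝒯.deg i < γ}, 𝒯.basis.repr τ i • 𝒯.basis i := by
  classical
  let ℓ : T →ₗ[ℝ] T := LinearMap.id -
    ∑ i : {i // 𝒯.deg i < γ}, (𝒯.basis.coord i).smulRight (𝒯.basis i)
  have h : ℓ τ = 0 := by
    refine 𝒯.TLt_le_ker ℓ (fun j hj => ?_) hτ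
    simp only [ℓ, LinearMap.sub_apply, LinearMap.id_apply, LinearMap.sum_apply,
      LinearMap.smulRight_apply, Module.Basis.coord_apply, Module.Basis.repr_self]
    rw [Finset.sum_eq_single ⟨j, hj⟩]
    · simp
    · intro i _ hij
      rw [Finsupp.single_eq_of_ne (fun h => hij (Subtype.ext h)), zero_smul]
    · simp
  simpa [ℓ, sub_eq_zero] using h

lemma hat_mem_TLt (g : Tp →ₗ[ℝ] ℝ) {γ : ℝ} {τ : T} (hτ : τ ∈ 𝒯.TLt γ) :
    𝒯.hat g τ ∈ 𝒯.TLt γ := by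
  rw [← Submodule.ker_mkQ (𝒯.TLt γ)]
  refine 𝒯.TLt_le_ker ((𝒯.TLt γ).mkQ ∘ₗ 𝒯.hat g) (fun i hi => ?_) hτ
  have hs := 𝒯.split_graded (𝒯.deg i) (𝒯.basis i) (Submodule.subset_span ⟨i, rfl, rfl⟩)
  suffices hle : (⨆ (α : ℝ) (_ : 0 ≤ α), LinearMap.range (TensorProduct.mapIncl
      (gradedPart 𝒯.basis 𝒯.deg (𝒯.deg i - α)) (gradedPart 𝒯.basisp 𝒯.degp α)))
      ≤ LinearMap.ker ((𝒯.TLt γ).mkQ ∘ₗ (TensorProduct.rid ℝ T).toLinearMap ∘ₗ g.lTensor T) from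
    hle hs
  refine iSup₂_le fun α hα => range_mapIncl_le_ker _ _ _ fun v hv w _ => ?_
  have hv' : v ∈ 𝒯.TLt γ :=
    le_iSup₂ (f := fun β (_ : β < γ) => gradedPart 𝒯.basis 𝒯.deg β) (𝒯.deg i - α)
      (by linarith) hv
  simpa using Or.inr hv'

end ConcreteRegularityStructure

end Algebra

/-! ### The germ of a modelled distribution -/

section Modelled

variable {Tp T Bp B : Type*} [Ring Tp] [Bialgebra ℝ Tp] [AddCommGroup T] [Module ℝ T]

lemma abs_le_of_enorm_div_le {r b : ℝ} {K : ℝ≥0∞} (hb : 0 ≤ b) (hK : K < ⊤)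
    (h : ‖r‖ₑ / ENNReal.ofReal b ≤ K) : |r| ≤ K.toReal * b := by
  rw [ENNReal.div_le_iff_le_mul (Or.inr hK.ne) (Or.inl ENNReal.ofReal_ne_top)] at h
  have h2 := ENNReal.toReal_mono (ENNReal.mul_ne_top hK.ne ENNReal.ofReal_ne_top) h
  rwa [toReal_enorm, ENNReal.toReal_mul, ENNReal.toReal_ofReal hb, Real.norm_eq_abs] at h2

lemma pdist_nonneg (x y : Spacetime d) : 0 ≤ pdist x y := by
  rw [pdist_eq]
  exact pnorm_nonneg _

lemma pdist_self (x : Spacetime d) : pdist x x = 0 := by simp [pdist]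

lemma continuous_pdist_rpow {a : ℝ} (ha : 0 ≤ a) {u v : Spacetime d → Spacetime d}
    (hu : Continuous u) (hv : Continuous v) : Continuous fun y => pdist (u y) (v y) ^ a := by
  simp only [pdist_eq]
  exact (continuous_pnorm_rpow ha).comp (hu.sub hv)

namespace ConcreteRegularityStructure

variable (𝒯 : ConcreteRegularityStructure Tp T Bp B)

lemma enorm_repr_le (i : B) (τ : T) :
    ‖𝒯.basis.repr τ i‖ₑ ≤ 𝒯.compENorm (𝒯.deg i) τ :=
  le_iSup₂ (f := fun j (_ : 𝒯.deg j = 𝒯.deg i) => ‖𝒯.basis.repr τ j‖ₑ) i rfl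

end ConcreteRegularityStructure

namespace Model

variable {𝒯 : ConcreteRegularityStructure Tp T Bp B} (M : Model d 𝒯)

lemma abs_transition_le (i : Bp) (y x : Spacetime d) :
    |transition M.g y x (𝒯.basisp i)|
      ≤ (𝒯.gENorm M.g (𝒯.degp i + 1)).toReal * pdist y x ^ 𝒯.degp i := by
  refine abs_le_of_enorm_div_le (Real.rpow_nonneg (pdist_nonneg y x) _) (M.g_bound _) ?_
  exact le_iSup₂_of_le (f := fun i (_ : 𝒯.degp i < _) => ⨆ (x) (y),
    ‖transition M.g y x (𝒯.basisp i)‖ₑ / ENNReal.ofReal (pdist y x ^ 𝒯.degp i)) i (lt_add_one _)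
    (le_iSup₂ (f := fun x y => ‖transition M.g y x (𝒯.basisp i)‖ₑ
      / ENNReal.ofReal (pdist y x ^ 𝒯.degp i)) x y)

/-- The values of `g_{yx}` are bounded by a continuous function of the base point. -/
lemma exists_continuous_bound (τ : Tp) (z : Spacetime d) : ∃ m : Spacetime d → ℝ,
    Continuous m ∧ ∀ y, |transition M.g z y τ| ≤ m y := by
  refine ⟨fun y => ∑ i ∈ (𝒯.basisp.repr τ).support, |𝒯.basisp.repr τ i| *
    ((𝒯.gENorm M.g (𝒯.degp i + 1)).toReal * pdist z y ^ 𝒯.degp i), ?_, fun y => ?_⟩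
  · exact continuous_finsetSum _ fun i _ => continuous_const.mul (continuous_const.mul
      (continuous_pdist_rpow (𝒯.degp_nonneg i) continuous_const continuous_id))
  · conv_lhs => rw [← 𝒯.basisp.linearCombination_repr τ, Finsupp.linearCombination_apply,
      Finsupp.sum, map_sum]
    refine (Finset.abs_sum_le_sum_abs _ _).trans (Finset.sum_le_sum fun i _ => ?_)
    rw [map_smul, smul_eq_mul, abs_mul]
    exact mul_le_mul_of_nonneg_left (M.abs_transition_le i z y) (abs_nonneg _)

lemma PiNorm_nonneg (γ : ℝ) : 0 ≤ M.PiNorm γ := ENNReal.toReal_nonneg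

lemma abs_PiX_basis_le {γ : ℝ} {i : B} (hi : 𝒯.deg i < γ) (x : Spacetime d) {t : ℝ} (ht : 0 < t)
    (ht1 : t ≤ 1) : |M.PiX x (𝒯.basis i) (heatAt t x)| ≤ M.PiNorm γ * t ^ (𝒯.deg i / 4) := by
  have h : ENNReal.ofReal (t ^ (-𝒯.deg i / 4)) * ‖M.PiX x (𝒯.basis i) (heatAt t x)‖ₑ
      ≤ 𝒯.PiENorm M.g M.P γ :=
    le_iSup₂_of_le (f := fun i (_ : 𝒯.deg i < γ) => ⨆ (x : Spacetime d) (t : ℝ)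
      (_ : t ∈ Set.Ioc (0 : ℝ) 1), ENNReal.ofReal (t ^ (-𝒯.deg i / 4)) *
        ‖𝒯.PiAt M.g M.P x (𝒯.basis i) (heatAt t x)‖ₑ) i hi
      (le_iSup_of_le x (le_iSup₂ (f := fun t (_ : t ∈ Set.Ioc (0 : ℝ) 1) =>
        ENNReal.ofReal (t ^ (-𝒯.deg i / 4)) *
          ‖𝒯.PiAt M.g M.P x (𝒯.basis i) (heatAt t x)‖ₑ) t ⟨ht, ht1⟩))
  have h2 := ENNReal.toReal_mono (M.P_bound γ).ne h
  rw [ENNReal.toReal_mul, ENNReal.toReal_ofReal (Real.rpow_nonneg ht.le _), toReal_enorm,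
    Real.norm_eq_abs, neg_div, Real.rpow_neg ht.le, inv_mul_le_iff₀ (Real.rpow_pos_of_pos ht _),
    mul_comm] at h2
  exact h2

end Model

namespace ModelledDistribution

variable {𝒯 : ConcreteRegularityStructure Tp T Bp B} {M : Model d 𝒯} {γ : ℝ}
  (f : ModelledDistribution 𝒯 M.g γ)

lemma mem_TLt (x : Spacetime d) : f.toFun x ∈ 𝒯.TLt γ := (Subtype.property f).1 x

lemma incr_mem_TLt (y x : Spacetime d) :
    f.toFun y - 𝒯.hat (transition M.g y x) (f.toFun x) ∈ 𝒯.TLt γ :=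
  sub_mem (f.mem_TLt y) (𝒯.hat_mem_TLt _ (f.mem_TLt x))

/-- The first part `⟦f⟧_{𝒟^γ}` of the norm of `f`. -/
def supNorm : ℝ := (𝒯.supENorm γ f.toFun).toReal

lemma incrNorm_nonneg : 0 ≤ f.incrNorm := ENNReal.toReal_nonneg

lemma supNorm_nonneg : 0 ≤ f.supNorm := ENNReal.toReal_nonneg

lemma norm_eq : ‖f‖ = f.supNorm + f.incrNorm := rfl

lemma abs_repr_le {i : B} (hi : 𝒯.deg i < γ) (x : Spacetime d) :
    |𝒯.basis.repr (f.toFun x) i| ≤ f.supNorm := by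
  have h : ‖𝒯.basis.repr (f.toFun x) i‖ₑ ≤ 𝒯.supENorm γ f.toFun :=
    (𝒯.enorm_repr_le i _).trans (le_iSup₂_of_le (f := fun β (_ : β < γ) =>
      ⨆ x, 𝒯.compENorm β (f.toFun x)) (𝒯.deg i) hi
      (le_iSup (fun x => 𝒯.compENorm (𝒯.deg i) (f.toFun x)) x))
  have h2 := ENNReal.toReal_mono (Subtype.property f).2.1.ne h
  rwa [toReal_enorm, Real.norm_eq_abs] at h2

lemma abs_repr_incr_le {i : B} (hi : 𝒯.deg i < γ) (y x : Spacetime d) :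
    |𝒯.basis.repr (f.toFun y - 𝒯.hat (transition M.g y x) (f.toFun x)) i|
      ≤ f.incrNorm * pdist y x ^ (γ - 𝒯.deg i) := by
  refine abs_le_of_enorm_div_le (Real.rpow_nonneg (pdist_nonneg y x) _)
    (Subtype.property f).2.2 ?_
  refine (ENNReal.div_le_div_right (𝒯.enorm_repr_le i _) _).trans ?_
  exact le_iSup₂_of_le (f := fun β (_ : β < γ) => ⨆ (x) (y),
      𝒯.compENorm β (f.toFun y - 𝒯.hat (transition M.g y x) (f.toFun x))
        / ENNReal.ofReal (pdist y x ^ (γ - β))) (𝒯.deg i) hi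
      (le_iSup₂ (f := fun x y =>
        𝒯.compENorm (𝒯.deg i) (f.toFun y - 𝒯.hat (transition M.g y x) (f.toFun x))
        / ENNReal.ofReal (pdist y x ^ (γ - 𝒯.deg i))) x y)

/-- The function `f` transported to a fixed base point is continuous. -/
lemma continuous_repr_transport (z : Spacetime d) (i : B) :
    Continuous fun y => 𝒯.basis.repr (𝒯.hat (transition M.g z y) (f.toFun y)) i := by
  have hentry (j : B) : ∃ m : Spacetime d → ℝ, Continuous m ∧ ∀ y,
      |𝒯.basis.repr (𝒯.hat (transition M.g z y) (𝒯.basis j)) i| ≤ m y := by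
    obtain ⟨m, hm, hle⟩ := M.exists_continuous_bound
      (TensorProduct.lid ℝ Tp ((𝒯.basis.coord i).rTensor Tp (𝒯.split (𝒯.basis j)))) z
    refine ⟨m, hm, fun y => ?_⟩
    have e : ∀ u : T ⊗[ℝ] Tp, 𝒯.basis.coord i
        (TensorProduct.rid ℝ T ((transition M.g z y).lTensor T u))
        = transition M.g z y (TensorProduct.lid ℝ Tp ((𝒯.basis.coord i).rTensor Tp u)) := by
      intro u
      induction u using TensorProduct.induction_on with
      | zero => simp
      | tmul a b => simp [mul_comm]
      | add a b ha hb => simp only [map_add, ha, hb]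
    have e' := e (𝒯.split (𝒯.basis j))
    exact (congrArg abs e').le.trans (hle y)
  choose m hm hle using hentry
  rw [continuous_iff_continuousAt]
  intro x
  have hbound (y : Spacetime d) :
      |𝒯.basis.repr (𝒯.hat (transition M.g z y) (f.toFun y)) i
        - 𝒯.basis.repr (𝒯.hat (transition M.g z x) (f.toFun x)) i|
      ≤ ∑ j : {j // 𝒯.deg j < γ}, f.incrNorm * pdist y x ^ (γ - 𝒯.deg j) * m j y := by
    -- By the cocycle identity the difference is ĝ_{zy} applied to f(y) - ĝ_{yx} f(x). The increment
    -- vanishes as y → x, and the matrix entries of ĝ_{zy} have a continuous majorant in y.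
    rw [← 𝒯.hat_transition_hat_transition M.g z y x, ← Finsupp.sub_apply, ← map_sub, ← map_sub]
    conv_lhs => rw [𝒯.eq_sum_of_mem_TLt (f.incr_mem_TLt y x)]
    rw [map_sum, map_sum, Finsupp.finsetSum_apply]
    refine (Finset.abs_sum_le_sum_abs _ _).trans (Finset.sum_le_sum fun j _ => ?_)
    rw [map_smul, map_smul, Finsupp.smul_apply, smul_eq_mul, abs_mul]
    exact mul_le_mul (f.abs_repr_incr_le j.2 y x) (hle j y) (abs_nonneg _)
      (mul_nonneg f.incrNorm_nonneg (Real.rpow_nonneg (pdist_nonneg y x) _))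
  have hcont : Continuous fun y => ∑ j : {j // 𝒯.deg j < γ},
      f.incrNorm * pdist y x ^ (γ - 𝒯.deg j) * m j y :=
    continuous_finsetSum _ fun j _ => (continuous_const.mul
      (continuous_pdist_rpow (sub_nonneg.2 j.2.le) continuous_id continuous_const)).mul (hm j)
  have hlim := hcont.tendsto x
  have hzero : ∑ j : {j // 𝒯.deg j < γ}, f.incrNorm * pdist x x ^ (γ - 𝒯.deg j) * m j x = 0 :=
    Finset.sum_eq_zero fun j _ => by
      rw [pdist_self, Real.zero_rpow (sub_pos.2 j.2).ne', mul_zero, zero_mul]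
  rw [hzero] at hlim
  rw [ContinuousAt, tendsto_iff_norm_sub_tendsto_zero]
  exact squeeze_zero (fun y => norm_nonneg _) hbound hlim

/-- The germ `x ↦ Π_x^g f(x)`. -/
def germ (x : Spacetime d) : TempDist d := M.PiX x (f.toFun x)

lemma PiX_apply_of_mem_TLt {τ : T} (hτ : τ ∈ 𝒯.TLt γ) (x : Spacetime d)
    (φ : 𝓢(Spacetime d, ℝ)) :
    M.PiX x τ φ
      = ∑ i : {i // 𝒯.deg i < γ}, 𝒯.basis.repr τ i * M.PiX x (𝒯.basis i) φ := by
  conv_lhs => rw [𝒯.eq_sum_of_mem_TLt hτ]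
  rw [map_sum, sum_apply]
  refine Finset.sum_congr rfl fun i _ => ?_
  rw [map_smul]
  rfl

/-- No regularity of g or f is assumed separately. Transport to the base point 0 writes the germ as
a finite sum of fixed distributions with coefficients that are continuous in the base point. -/
lemma measurable_germVal : Measurable (Function.uncurry (germVal f.germ)) := by
  have e : Function.uncurry (germVal f.germ) = fun p : ℝ × Spacetime d =>
      ∑ i : {i // 𝒯.deg i < γ}, 𝒯.basis.repr (𝒯.hat (transition M.g 0 p.2) (f.toFun p.2)) i
        * M.PiX 0 (𝒯.basis i) (heatAt p.1 p.2) := by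
    funext p
    rw [← PiX_apply_of_mem_TLt (𝒯.hat_mem_TLt _ (f.mem_TLt p.2))]
    exact congrArg (fun Λ : TempDist d => Λ (heatAt p.1 p.2))
      (𝒯.PiAt_hat_transition M.g M.P 0 p.2 (f.toFun p.2)).symm
  rw [e]
  exact Finset.measurable_fun_sum _ fun i _ =>
    ((f.continuous_repr_transport 0 i).measurable.comp measurable_snd).mul
      (measurable_apply_heatAt _)

lemma germ_sub (y x : Spacetime d) : f.germ y - f.germ x
    = M.PiX y (f.toFun y - 𝒯.hat (transition M.g y x) (f.toFun x)) := by
  rw [map_sub]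
  exact congrArg (f.germ y - ·) (𝒯.PiAt_hat_transition M.g M.P y x (f.toFun x)).symm

/-- Expanding f(y) - ĝ_{yx} f(x) in the basis, each coefficient brings the power of the distance and
each Π_y of a basis element brings the power of s. The coherence constant contains only ‖f‖_{𝒟^γ};
the sup part of the norm enters only the growth bound. -/
lemma isGerm_germ : IsGerm (fun i : {i // 𝒯.deg i < γ} => 𝒯.deg i) γ (min 𝒯.minHom 0)
    (M.PiNorm γ * f.incrNorm)
    (Fintype.card {i // 𝒯.deg i < γ} * M.PiNorm γ * f.supNorm) f.germ := by
  refine ⟨f.measurable_germVal, fun s h0 h1 x y => ?_, fun s h0 h1 y => ?_⟩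
  · rw [germ_sub, PiX_apply_of_mem_TLt (f.incr_mem_TLt y x), Finset.mul_sum]
    refine (Finset.abs_sum_le_sum_abs _ _).trans (Finset.sum_le_sum fun i _ => ?_)
    rw [abs_mul]
    refine (mul_le_mul (f.abs_repr_incr_le i.2 y x) (M.abs_PiX_basis_le i.2 y h0 h1)
      (abs_nonneg _) (mul_nonneg f.incrNorm_nonneg
        (Real.rpow_nonneg (pdist_nonneg y x) _))).trans (le_of_eq ?_)
    ring
  · rw [germVal, germ, PiX_apply_of_mem_TLt (f.mem_TLt y)]
    refine (Finset.abs_sum_le_sum_abs _ _).trans ?_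
    have hle (i : {i // 𝒯.deg i < γ}) :
        |𝒯.basis.repr (f.toFun y) i * M.PiX y (𝒯.basis i) (heatAt s y)|
          ≤ f.supNorm * (M.PiNorm γ * s ^ (min 𝒯.minHom 0 / 4)) := by
      rw [abs_mul]
      refine mul_le_mul (f.abs_repr_le i.2 y) ((M.abs_PiX_basis_le i.2 y h0 h1).trans ?_)
        (abs_nonneg _) f.supNorm_nonneg
      refine mul_le_mul_of_nonneg_left (rpow_le_rpow_of_le_one h0 h1 ?_) (M.PiNorm_nonneg γ)
      have := (min_le_left 𝒯.minHom 0).trans (𝒯.minHom_le i)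
      linarith
    refine (Finset.sum_le_sum fun i _ => hle i).trans (le_of_eq ?_)
    rw [Finset.sum_const, Finset.card_univ, nsmul_eq_mul]
    ring

variable (𝒯 M γ) in
/-- The linear map from modelled distributions to germs. -/
def germMap : ModelledDistribution 𝒯 M.g γ →ₗ[ℝ]
    germSpace d (fun i : {i // 𝒯.deg i < γ} => 𝒯.deg i) γ (min 𝒯.minHom 0) where
  toFun f := ⟨f.germ, _, _, f.isGerm_germ⟩
  map_add' f h := Subtype.ext (funext fun x => (M.PiX x).map_add (f.toFun x) (h.toFun x))
  map_smul' c f := Subtype.ext (funext fun x => (M.PiX x).map_smul c (f.toFun x))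

lemma eq_zero_of_isEmpty [IsEmpty {i // 𝒯.deg i < γ}] : f = 0 := by
  refine Subtype.ext (funext fun x => ?_)
  change f.toFun x = 0
  rw [𝒯.eq_sum_of_mem_TLt (f.mem_TLt x), Finset.univ_eq_empty, Finset.sum_empty]

end ModelledDistribution

/-! ### Continuity into the Hölder space -/

/-- The reconstruction bound for modelled distributions gives a continuous operator. -/
lemma exists_continuous_reconstruction {𝒯 : ConcreteRegularityStructure Tp T Bp B} {γ C : ℝ}
    (N : ℕ) (M : Model d 𝒯)
    (R : ModelledDistribution 𝒯 M.g γ →ₗ[ℝ] TempDist d)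
    (hR : ∀ (f : ModelledDistribution 𝒯 M.g γ) (x : Spacetime d) (t : ℝ), 0 < t → t ≤ 1 →
      |(R f - f.germ x) (heatAt t x)|
        ≤ C * (M.PiNorm γ * f.incrNorm) * t ^ (γ / 4)) :
    ∃ R : ModelledDistribution 𝒯 M.g γ →L[ℝ] HolderSpace d N (min 𝒯.minHom 0),
      M.ReconstructionBound R C := by
  set α := min 𝒯.minHom 0
  set n : ℝ := ((Fintype.card {i // 𝒯.deg i < γ} : ℕ) : ℝ)
  have hP := M.PiNorm_nonneg γ
  have hbound (f : ModelledDistribution 𝒯 M.g γ) (x : Spacetime d) (t : ℝ) (ht : 0 < t)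
      (ht1 : t ≤ 1) : |R f (heatAt t x)|
        ≤ (|C| + n) * M.PiNorm γ * ‖f‖ * t ^ (α / 4) := by
    have htα : 0 ≤ t ^ (α / 4) := Real.rpow_nonneg ht.le _
    -- A basis element of degree below γ gives β₀ < γ, which is needed to absorb t^(γ/4) in t^(α/4).
    -- Without one, every modelled distribution is zero.
    rcases isEmpty_or_nonempty {i // 𝒯.deg i < γ} with hE | ⟨⟨i⟩⟩
    · rw [f.eq_zero_of_isEmpty, map_zero, zero_apply, abs_zero]
      positivity
    · have hαγ : α / 4 ≤ γ / 4 := by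
        have h1 := min_le_left 𝒯.minHom 0
        have h2 := 𝒯.minHom_le i
        have h3 := i.2
        linarith
      have h1 := hR f x t ht ht1
      have h2 : |f.germ x (heatAt t x)| ≤ n * M.PiNorm γ * f.supNorm * t ^ (α / 4) :=
        f.isGerm_germ.bounded t ht ht1 x
      have h3 := rpow_le_rpow_of_le_one ht ht1 hαγ
      have hi := f.incrNorm_nonneg
      have hs := f.supNorm_nonneg
      have h4 : C * (M.PiNorm γ * f.incrNorm) * t ^ (γ / 4)
          ≤ |C| * (M.PiNorm γ * f.incrNorm) * t ^ (α / 4) := by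
        refine mul_le_mul (mul_le_mul_of_nonneg_right (le_abs_self C) (by positivity)) h3
          (Real.rpow_nonneg ht.le _) (by positivity)
      have h5 := abs_add_le ((R f - f.germ x) (heatAt t x))
        (f.germ x (heatAt t x))
      rw [sub_apply, sub_add_cancel, ← sub_apply] at h5
      refine h5.trans ((add_le_add (h1.trans h4) h2).trans ?_)
      rw [← add_mul, f.norm_eq]
      refine mul_le_mul_of_nonneg_right ?_ htα
      have h6 : 0 ≤ |C| * M.PiNorm γ * f.supNorm := by positivity
      have h7 : 0 ≤ n * M.PiNorm γ * f.incrNorm := by positivity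
      linarith
  have hholder (f : ModelledDistribution 𝒯 M.g γ) :
      holderENorm N α (R f)
        ≤ ENNReal.ofReal (holderConst d N α * ((|C| + n) * M.PiNorm γ * ‖f‖)) :=
    holderENorm_le (by positivity) (hbound f) N
  let S : ModelledDistribution 𝒯 M.g γ →ₗ[ℝ] HolderSpace d N α :=
    { toFun := fun f => ⟨R f,
        (hholder f).trans_lt ENNReal.ofReal_lt_top⟩
      map_add' := fun f h => Subtype.ext (R.map_add f h)
      map_smul' := fun c f => Subtype.ext (R.map_smul c f) }
  refine ⟨S.mkContinuous (|holderConst d N α| * ((|C| + n) * M.PiNorm γ)) fun f => ?_,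
    fun f x t ht ht1 => ?_⟩
  · have h := ENNReal.toReal_mono ENNReal.ofReal_ne_top (hholder f)
    have h0 : 0 ≤ (|C| + n) * M.PiNorm γ * ‖f‖ := by positivity
    refine h.trans ?_
    rw [ENNReal.toReal_ofReal', mul_assoc |holderConst d N α|]
    exact max_le (mul_le_mul_of_nonneg_right (le_abs_self _) h0) (mul_nonneg (abs_nonneg _) h0)
  · have h := hR f x t ht ht1
    rw [← mul_assoc] at h
    exact h

end Modelled

end RegStruct

end

/-! ### The reconstruction theorem -/

theorem mainTheorem1 {d N : ℕ} (hN : 1 ≤ N) {Tp T Bp B : Type*}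
    [Ring Tp] [Bialgebra ℝ Tp] [AddCommGroup T] [Module ℝ T]
    (𝒯 : RegStruct.ConcreteRegularityStructure Tp T Bp B) (γ : ℝ) (hγ : γ ≠ 0) :
    (∃ C : ℝ, ∀ M : RegStruct.Model d 𝒯,
      ∃ R : RegStruct.ModelledDistribution 𝒯 M.g γ →L[ℝ]
          RegStruct.HolderSpace d N (min 𝒯.minHom 0),
        M.ReconstructionBound R C) ∧
    (0 < γ → ∀ (M : RegStruct.Model d 𝒯)
      (R R' : RegStruct.ModelledDistribution 𝒯 M.g γ →L[ℝ]
          RegStruct.HolderSpace d N (min 𝒯.minHom 0)) (C C' : ℝ),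
        M.ReconstructionBound R C → M.ReconstructionBound R' C' → R = R') := by
  constructor
  · obtain ⟨C, R, hR⟩ := RegStruct.exists_reconstruction d
      (β := fun i : {i // 𝒯.deg i < γ} => 𝒯.deg i) (fun i => i.2) hγ (min_le_right 𝒯.minHom 0)
    -- C and R were fixed before the model: the model enters only through its germ map and its
    -- coherence constant.
    exact ⟨C, fun M => RegStruct.exists_continuous_reconstruction N M
      (R ∘ₗ RegStruct.ModelledDistribution.germMap 𝒯 M γ) fun f =>
      hR _ _ _ (mul_nonneg (M.PiNorm_nonneg γ) f.incrNorm_nonneg) f.isGerm_germ⟩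
  · intro hpos M R R' C C' hR hR'
    refine ContinuousLinearMap.ext fun f => ?_
    -- The local term Π_x^g f(x) cancels in the difference, leaving a distribution of size
    -- O(t^(γ/4)) on heat kernels.
    have h0 : (R f).toDist - (R' f).toDist = 0 := by
      refine RegStruct.eq_zero_of_heatAt_small _ (c := γ / 4) (by linarith)
        (C := C * M.PiNorm γ * f.incrNorm + C' * M.PiNorm γ * f.incrNorm) fun t ht ht1 x => ?_
      have h1 := hR f x t ht ht1
      have h2 := hR' f x t ht ht1
      have e : ((R f).toDist - (R' f).toDist) (RegStruct.heatAt t x)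
          = ((R f).toDist - M.PiX x (f.toFun x)) (RegStruct.heatAt t x)
            - ((R' f).toDist - M.PiX x (f.toFun x)) (RegStruct.heatAt t x) := by
        simp only [sub_apply]
        ring
      rw [e, add_mul]
      exact (abs_sub _ _).trans (add_le_add h1 h2)
    exact Subtype.ext (sub_eq_zero.1 h0)
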